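/- **Setting.** For each hypothesis $h\in\{0,1\}$ let $g_h\in\mathbb R$, $Q_h\ge 0$, $\gamma_h>0$, $\omega_{L,h}\in\mathbb R$ and $S_{\mathrm{ph},h}>0$ be given (transduction constant, spin-noise strength, relaxation rate, Larmor frequency, shot-noise density). Under hypothesis $h$, the record $\boldsymbol I_n=(I_1,\dots,I_n)^T$ of $n\ge 0$ stationary photocurrent samples with sampling period $\Delta>0$ has law $\mathcal N(0,T_{h,n})$, where $$(T_{h,n})_{ij}=K_{h,i-j},\qquad K_{h,k}=g_h^2\frac{Q_h}{2\gamma_h}e^{-\gamma_h|k|\Delta}\cos(k\,\omega_{L,h}\Delta)+\delta_{k,0}\frac{S_{\mathrm{ph},h}}{\Delta},$$ and density $p_h(x)=\exp(-\tfrac12x^TT_{h,n}^{-1}x)/\sqrt{(2\pi)^n\det T_{h,n}}$. Let $L_n=\log\frac{p_1(\boldsymbol I_n)}{p_0(\boldsymbol I_n)}$ be the log-likelihood ratio, $\phi_h(u)=\mathbb E_h[e^{iuL_n}]$, and let $\kappa^h_{m,n}=i^{-m}\frac{d^m}{du^m}\log\phi_h(u)\big|_{u=0}$ be its $m$-th cumulant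 under $h$. Put $D=T_{0,n}^{-1}-T_{1,n}^{-1}$ and $\eta=\det T_{0,n}/\det T_{1,n}$. The power spectral density $\bar S_h(\omega)=\int_{-\infty}^\infty K_{h,t}e^{-i\omega t}\,dt$ is the Fourier transform of the autocorrelation $K_{h,t}=g_h^2\frac{Q_h}{2\gamma_h}e^{-\gamma_h|t|}\cos(\omega_{L,h}t)+S_{\mathrm{ph},h}\,\delta(t)$. **Claim.** 1. (Exact.) For all $\Delta>0$ and $n$: each $T_{h,n}$ is positive definite and $p_h$ is indeed the density of $\mathcal N(0,T_{h,n})$; for every record, $$L_n=\tfrac12\log\eta+\tfrac12\,\boldsymbol I_n^TD\,\boldsymbol I_n;$$ and $\log\phi_h$ is smooth at $0$ with, for every $m\ge1$, $$\kappa^h_{m,n}=\tfrac12(m-1)!\,\mathrm{Tr}\big((D\,T_{h,n})^m\big)+\delta_{m,1}\,\tfrac12\log\eta .$$ 2. (Spectrum.) With $S_{\mathrm{at},h}=g_h^2Q_h/(2\gamma_h^2)$, $$\bar S_h(\omega)=S_{\mathrm{at},h}\Big(\frac{\gamma_h^2}{\gamma_h^2+(\omega-\omega_{L,h})^2}+\frac{\gamma_h^2}{\gamma_h^2+(\omega+\omega_{L,h})^2}\Big)+S_{\mathrm{ph},h}.$$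 3. (Long times.) Suppose $S_{\mathrm{ph},0}=S_{\mathrm{ph},1}$. For every $h$ and $m\ge1$ the integrals in $$c^h_m=\frac{(m-1)!}{2\pi}\int_0^\infty\Big(\frac{\bar S_h(\omega)}{\bar S_0(\omega)}-\frac{\bar S_h(\omega)}{\bar S_1(\omega)}\Big)^m d\omega+\frac{\delta_{m,1}}{2\pi}\int_0^\infty\log\frac{\bar S_0(\omega)}{\bar S_1(\omega)}\,d\omega$$ converge absolutely, and, with $t=n\Delta$, $$\kappa^h_{m,n}=t\,\big(c^h_m+r(\Delta)\big)+O(1),\qquad r(\Delta)=O(\Delta).$$ Precisely: for every $\Delta_0>0$ there are a constant $C$ and a function $r$ (depending only on the parameters, $h$, $m$ and $\Delta_0$) such that for all $0<\Delta\le\Delta_0$ one has $|r(\Delta)|\le C\Delta$ and $|\kappa^h_{m,n}-t(c^h_m+r(\Delta))|\le C$ for all $n$. So, for each fixed sampling period, every cumulant is a linear function of time up to a bounded correction. -/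

import Mathlib

open MeasureTheory ProbabilityTheory Matrix


noncomputable section

/-- Parameters of the spin-noise sensor under one hypothesis: the transduction constant `gD`, the
strength `Q` of the spin noise, the transverse relaxation rate `γ`, the Larmor frequency `ωL`, and
the spectral density `Sph` of the photon shot noise. -/
structure SpinSensor where
  gD : ℝ
  Q : ℝ
  γ : ℝ
  ωL : ℝ
  Sph : ℝ
  Q_nonneg : 0 ≤ Q
  γ_pos : 0 < γ
  Sph_pos : 0 < Sph

namespace SpinSensor

/-- The discrete autocovariance
`K_k = g_D² (Q / 2γ) exp (-γ |k| Δ) cos (k ω_L Δ) + δ_{k,0} S_ph / Δ`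
of the stationary photocurrent sampled with period `Δ`. -/
def autocov (p : SpinSensor) (Δ : ℝ) (k : ℤ) : ℝ :=
  p.gD ^ 2 * (p.Q / (2 * p.γ)) * Real.exp (-p.γ * |(k : ℝ)| * Δ) * Real.cos (k * p.ωL * Δ)
    + if k = 0 then p.Sph / Δ else 0

/-- The Toeplitz covariance matrix `T_n`, with entries `K_{i-j}`. -/
def cov (p : SpinSensor) (Δ : ℝ) (n : ℕ) : Matrix (Fin n) (Fin n) ℝ :=
  Matrix.of fun i j => p.autocov Δ ((i : ℤ) - (j : ℤ))

/-- The law `N(0, T_n)` of `n` successive samples of the photocurrent in the steady state. -/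
def law (p : SpinSensor) (Δ : ℝ) (n : ℕ) : Measure (EuclideanSpace ℝ (Fin n)) :=
  multivariateGaussian 0 (p.cov Δ n)

/-- The Gaussian probability density of `n` successive samples of the photocurrent. -/
def density (p : SpinSensor) (Δ : ℝ) (n : ℕ) (x : EuclideanSpace ℝ (Fin n)) : ℝ :=
  Real.exp (-(1 / 2) * (x.ofLp ⬝ᵥ (p.cov Δ n)⁻¹ *ᵥ x.ofLp)) /
    Real.sqrt ((2 * Real.pi) ^ n * (p.cov Δ n).det)

/-- The regular part of the continuous-time autocorrelation function of the photocurrent, whose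
full autocorrelation is `K_t = atomCorr t + S_ph δ(t)` with the Dirac distribution `δ`. -/
def atomCorr (p : SpinSensor) (t : ℝ) : ℝ :=
  p.gD ^ 2 * (p.Q / (2 * p.γ)) * Real.exp (-p.γ * |t|) * Real.cos (p.ωL * t)

/-- The Fourier transform `∫ K_t exp (-i ω t) dt` of the autocorrelation
`K_t = atomCorr t + S_ph δ(t)`; the white-noise part contributes `S_ph`. -/
def fourierPSD (p : SpinSensor) (ω : ℝ) : ℂ :=
  (∫ t : ℝ, (p.atomCorr t : ℂ) * Complex.exp (-(Complex.I * ω * t))) + p.Sph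

/-- The power spectral density of the photocurrent; it is the Fourier transform `fourierPSD`,
which is real-valued. -/
def psd (p : SpinSensor) (ω : ℝ) : ℝ := (p.fourierPSD ω).re

end SpinSensor

/-- The log-likelihood ratio `log (p₁(x) / p₀(x))` of a photocurrent record `x` of length `n`. -/
def logLikelihoodRatio (p : Fin 2 → SpinSensor) (Δ : ℝ) (n : ℕ)
    (x : EuclideanSpace ℝ (Fin n)) : ℝ :=
  Real.log ((p 1).density Δ n x / (p 0).density Δ n x)

/-- The matrix `D = T₀⁻¹ - T₁⁻¹`. -/
def diffPrecision (p : Fin 2 → SpinSensor) (Δ : ℝ) (n : ℕ) : Matrix (Fin n) (Fin n) ℝ :=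
  ((p 0).cov Δ n)⁻¹ - ((p 1).cov Δ n)⁻¹

/-- The determinant ratio `η = det T₀ / det T₁`. -/
def detRatio (p : Fin 2 → SpinSensor) (Δ : ℝ) (n : ℕ) : ℝ :=
  ((p 0).cov Δ n).det / ((p 1).cov Δ n).det

/-- The characteristic function `φ(u) = E_h[exp (i u L)]` of the log-likelihood ratio `L` under
hypothesis `h`. -/
def llrCharFun (p : Fin 2 → SpinSensor) (Δ : ℝ) (n : ℕ) (h : Fin 2) (u : ℝ) : ℂ :=
  ∫ x, Complex.exp (Complex.I * u * logLikelihoodRatio p Δ n x) ∂((p h).law Δ n)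

/-- The `m`-th cumulant `i^{-m} (d/du)^m log φ(u)` at `u = 0` of the log-likelihood ratio under
hypothesis `h` after `n` observations. -/
def llrCumulant (p : Fin 2 → SpinSensor) (Δ : ℝ) (n : ℕ) (h : Fin 2) (m : ℕ) : ℂ :=
  (Complex.I ^ m)⁻¹ * iteratedDeriv m (fun u : ℝ => Complex.log (llrCharFun p Δ n h u)) 0

/-- The spectral growth rate of the `m`-th cumulant under hypothesis `h`:
`(1/2π) (m-1)! ∫₀^∞ (S_h/S_0 - S_h/S_1)^m dω + δ_{m,1} (1/2π) ∫₀^∞ log (S_0/S_1) dω`. -/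
def cumulantRate (p : Fin 2 → SpinSensor) (h : Fin 2) (m : ℕ) : ℝ :=
  1 / (2 * Real.pi) * (m - 1).factorial *
      (∫ ω in Set.Ioi (0 : ℝ),
        ((p h).psd ω / (p 0).psd ω - (p h).psd ω / (p 1).psd ω) ^ m)
    + if m = 1 then
        1 / (2 * Real.pi) * ∫ ω in Set.Ioi (0 : ℝ), Real.log ((p 0).psd ω / (p 1).psd ω)
      else 0

end

/-!
Under either hypothesis the record is a centred Gaussian vector, so the log-likelihood ratio is a
constant plus the quadratic form `xᵀ D x / 2`. Writing the vector as `A z` with `A² = T_h` and `z`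
standard Gaussian, and rotating `z` to an eigenbasis of the symmetric matrix `A D A`, turns the
quadratic form into a sum of independent terms `aᵢ zᵢ² / 2`. Hence, near `u = 0`, the logarithm of
the characteristic function is `i u c - ½ ∑ log (1 - i u aᵢ)`, and its derivatives are power sums of
the `aᵢ`, that is, traces of powers of `D T_h` (`exists_charFun_quadraticForm`, `llrCumulant_eq`).

For long times, `D T_h = T_{1-h}⁻¹ (T_1 - T_0)` is a quotient of Toeplitz matrices, and a Toeplitz
matrix is the compression of a multiplication operator on the circle to the span of the first `n`
characters. Off the diagonal the autocovariance decays exponentially, so the block of the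
multiplication operator that couples this span to its complement has Hilbert–Schmidt norm bounded
independently of `n` and of the sampling period `Δ` (`SpinSensor.hsNorm_symbol_le`). An induction on
the power `m` then shows that the trace of the `m`-th power of the quotient of the compressions
differs by a bounded amount from the trace of the compression of the `m`-th power of the quotient,
which is `n` times a mean value of symbols (`norm_opTrace_pow_sub_le`, `exists_trace_bound`).
Integrating the case `m = 1` along the segment between the two covariance matrices gives the same
for the logarithm of the determinant ratio (`exists_log_det_bound`).

The symbol of the sampled record is a combination of Poisson kernels, which differ from the two
Lorentzians of the continuous-time spectrum by `O(Δ²)` on the frequency band `|ω| ≤ π / Δ`; the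
spectra under the two hypotheses differ by `O(ω⁻²)`, so that the frequencies outside the band
contribute `O(Δ)`. The mean values of symbols therefore equal `Δ / π` times the spectral integrals
up to `O(Δ²)` (`exists_periodMean_bound`). This yields the linear growth of the cumulants
(`exists_llrCumulant_asymptotics`).
-/

/-! ### Compressions of commuting operators in Hilbert–Schmidt norm -/

section Compression

variable {ι : Type*} [Fintype ι] {H : Type*} [NormedAddCommGroup H] [InnerProductSpace ℂ H]

/-- The Hilbert–Schmidt norm of an operator on a finite-dimensional Euclidean space with values in
a Hilbert space. -/
noncomputable def hsNorm (U : EuclideanSpace ℂ ι →L[ℂ] H) : ℝ :=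
  Real.sqrt (∑ i, ‖U (EuclideanSpace.basisFun ι ℂ i)‖ ^ 2)

/-- The trace of an operator on a finite-dimensional Euclidean space. -/
noncomputable def opTrace (A : EuclideanSpace ℂ ι →L[ℂ] EuclideanSpace ℂ ι) : ℂ :=
  ∑ i, inner ℂ (EuclideanSpace.basisFun ι ℂ i) (A (EuclideanSpace.basisFun ι ℂ i))

lemma hsNorm_nonneg (U : EuclideanSpace ℂ ι →L[ℂ] H) : 0 ≤ hsNorm U := Real.sqrt_nonneg _

lemma sq_hsNorm (U : EuclideanSpace ℂ ι →L[ℂ] H) :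
    hsNorm U ^ 2 = ∑ i, ‖U (EuclideanSpace.basisFun ι ℂ i)‖ ^ 2 :=
  Real.sq_sqrt (Finset.sum_nonneg fun _ _ => sq_nonneg _)

/-- The triangle inequality, from Minkowski's inequality in `ℓ²(ι)`. -/
lemma hsNorm_add_le (U W : EuclideanSpace ℂ ι →L[ℂ] H) :
    hsNorm (U + W) ≤ hsNorm U + hsNorm W := by
  let f (U : EuclideanSpace ℂ ι →L[ℂ] H) : PiLp 2 (fun _ : ι => H) :=
    WithLp.toLp 2 fun i => U (EuclideanSpace.basisFun ι ℂ i)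
  have hf : ∀ U, hsNorm U = ‖f U‖ := fun U => by simp [hsNorm, f, PiLp.norm_eq_of_L2]
  have hadd : f (U + W) = f U + f W := by ext i; simp [f]
  rw [hf, hf, hf, hadd]
  exact norm_add_le _ _

lemma hsNorm_neg (U : EuclideanSpace ℂ ι →L[ℂ] H) : hsNorm (-U) = hsNorm U := by
  simp [hsNorm]

lemma hsNorm_comp_left_le (L : H →L[ℂ] H) (U : EuclideanSpace ℂ ι →L[ℂ] H) :
    hsNorm (L ∘L U) ≤ ‖L‖ * hsNorm U := by
  refine Real.sqrt_le_iff.2 ⟨mul_nonneg (norm_nonneg _) (hsNorm_nonneg _), ?_⟩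
  rw [mul_pow, sq_hsNorm, Finset.mul_sum]
  refine Finset.sum_le_sum fun i _ => ?_
  rw [← mul_pow]
  exact pow_le_pow_left₀ (norm_nonneg _) (L.le_opNorm _) 2

lemma sum_norm_inner_le_hsNorm_mul (U W : EuclideanSpace ℂ ι →L[ℂ] H) :
    ‖∑ i, inner ℂ (U (EuclideanSpace.basisFun ι ℂ i)) (W (EuclideanSpace.basisFun ι ℂ i))‖
      ≤ hsNorm U * hsNorm W := by
  refine (norm_sum_le _ _).trans ?_
  refine (Finset.sum_le_sum fun i _ => norm_inner_le_norm _ _).trans ?_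
  exact Real.sum_mul_le_sqrt_mul_sqrt _ _ _

variable [CompleteSpace H]

/-- Multiplying on the right by an operator of the domain. The sum is expanded in an orthonormal
basis of the (finite-dimensional) range of `U`, where the adjoint turns the right factor into a
left factor. -/
lemma hsNorm_comp_right_le (U : EuclideanSpace ℂ ι →L[ℂ] H)
    (B : EuclideanSpace ℂ ι →L[ℂ] EuclideanSpace ℂ ι) :
    hsNorm (U ∘L B) ≤ hsNorm U * ‖B‖ := by
  let b := EuclideanSpace.basisFun ι ℂ
  let f := stdOrthonormalBasis ℂ (LinearMap.range (U : EuclideanSpace ℂ ι →ₗ[ℂ] H))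
  have key : ∀ W : EuclideanSpace ℂ ι →L[ℂ] H, (∀ x, W x ∈ LinearMap.range
      (U : EuclideanSpace ℂ ι →ₗ[ℂ] H)) →
      ∑ i, ‖W (b i)‖ ^ 2 = ∑ j, ‖W.adjoint (f j : H)‖ ^ 2 := by
    intro W hW
    have h1 : ∀ i, ‖W (b i)‖ ^ 2 = ∑ j, ‖inner ℂ (W.adjoint (f j : H)) (b i)‖ ^ 2 := by
      intro i
      have := f.sum_sq_norm_inner_right ⟨W (b i), hW _⟩
      simp only [Submodule.coe_inner, Submodule.coe_norm] at this
      rw [← this]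
      exact Finset.sum_congr rfl fun j _ => by rw [ContinuousLinearMap.adjoint_inner_left]
    simp_rw [h1]
    rw [Finset.sum_comm]
    exact Finset.sum_congr rfl fun j _ => b.sum_sq_norm_inner_left _
  refine Real.sqrt_le_iff.2 ⟨mul_nonneg (hsNorm_nonneg _) (norm_nonneg _), ?_⟩
  rw [mul_pow, sq_hsNorm]
  change ∑ i, ‖(U ∘L B) (b i)‖ ^ 2 ≤ (∑ i, ‖U (b i)‖ ^ 2) * _
  rw [key _ (fun x => ⟨B x, rfl⟩), key U (fun x => ⟨x, rfl⟩), Finset.sum_mul]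
  refine Finset.sum_le_sum fun j _ => ?_
  rw [← mul_pow, ContinuousLinearMap.adjoint_comp, mul_comm]
  refine pow_le_pow_left₀ (norm_nonneg _) ?_ 2
  have := (ContinuousLinearMap.adjoint B).le_opNorm (U.adjoint (f j : H))
  rwa [LinearIsometryEquiv.norm_map] at this

/-- The trace of `A X* Z` is bounded by the operator norm of `A` and the Hilbert–Schmidt norms of
the other factors. -/
lemma norm_opTrace_adjoint_comp_le (A : EuclideanSpace ℂ ι →L[ℂ] EuclideanSpace ℂ ι)
    (X Z : EuclideanSpace ℂ ι →L[ℂ] H) :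
    ‖opTrace (A ∘L X.adjoint ∘L Z)‖ ≤ ‖A‖ * (hsNorm X * hsNorm Z) := by
  have h : opTrace (A ∘L X.adjoint ∘L Z) = ∑ i, inner ℂ
      ((X ∘L A.adjoint) (EuclideanSpace.basisFun ι ℂ i)) (Z (EuclideanSpace.basisFun ι ℂ i)) := by
    refine Finset.sum_congr rfl fun i _ => ?_
    simp only [ContinuousLinearMap.comp_apply]
    rw [← ContinuousLinearMap.adjoint_inner_right X, ← ContinuousLinearMap.adjoint_inner_left A]
  rw [h]
  refine (sum_norm_inner_le_hsNorm_mul _ _).trans ?_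
  have h2 := hsNorm_comp_right_le X A.adjoint
  rw [LinearIsometryEquiv.norm_map] at h2
  calc hsNorm (X ∘L A.adjoint) * hsNorm Z ≤ (hsNorm X * ‖A‖) * hsNorm Z :=
        mul_le_mul_of_nonneg_right h2 (hsNorm_nonneg _)
    _ = _ := by ring

end Compression

section CompressionTrace

/-- The constants in the comparison of traces of powers: `b` bounds the operator norms and `κ` the
Hilbert–Schmidt norms of the off-diagonal blocks of the two given operators. -/
noncomputable def traceConst (b κ : ℝ) : ℕ → ℝ
  | 0 => 0
  | m + 1 => b ^ 2 * traceConst b κ m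
      + b * (κ * ((m + 1) * b ^ (m + 1) * (2 * b ^ 3 * κ)) + κ * (m * b ^ m * (2 * b ^ 3 * κ)))

lemma traceConst_nonneg {b κ : ℝ} (hb : 0 ≤ b) (hκ : 0 ≤ κ) (m : ℕ) : 0 ≤ traceConst b κ m := by
  induction m with
  | zero => exact le_rfl
  | succ m ih => rw [traceConst]; positivity

variable {ι : Type*} [Fintype ι] {H : Type*} [NormedAddCommGroup H] [InnerProductSpace ℂ H]
  [CompleteSpace H]

/-- The operator `1 - V V*`: for an isometry `V`, the orthogonal projection onto the complement of
its range. -/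
noncomputable def coproj (V : EuclideanSpace ℂ ι →L[ℂ] H) : H →L[ℂ] H := 1 - V ∘L V.adjoint

variable {V : EuclideanSpace ℂ ι →L[ℂ] H}

lemma coproj_add (V : EuclideanSpace ℂ ι →L[ℂ] H) (x : H) : coproj V x + V (V.adjoint x) = x := by
  simp [coproj]

lemma coproj_apply_range (hV : V.adjoint ∘L V = 1) (x : EuclideanSpace ℂ ι) :
    coproj V (V x) = 0 := by
  have := DFunLike.congr_fun hV x
  simp only [ContinuousLinearMap.comp_apply, one_apply_eq_self] at this
  simp [coproj, this]

lemma coproj_idem (hV : V.adjoint ∘L V = 1) (x : H) : coproj V (coproj V x) = coproj V x := by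
  have h := coproj_add V x
  have h2 : coproj V (coproj V x) + coproj V (V (V.adjoint x)) = coproj V x := by
    rw [← map_add, h]
  rwa [coproj_apply_range hV, add_zero] at h2

lemma coproj_adjoint (V : EuclideanSpace ℂ ι →L[ℂ] H) :
    ContinuousLinearMap.adjoint (coproj V) = coproj V := by
  simp only [coproj, map_sub, ContinuousLinearMap.adjoint_comp,
    ContinuousLinearMap.adjoint_adjoint]
  congr 1
  exact ContinuousLinearMap.adjoint_id

lemma norm_coproj_le (hV : V.adjoint ∘L V = 1) : ‖coproj V‖ ≤ 1 := by
  refine ContinuousLinearMap.opNorm_le_bound _ zero_le_one fun x => ?_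
  have h : ‖coproj V x‖ * ‖coproj V x‖ ≤ ‖coproj V x‖ * ‖x‖ := by
    have h1 : inner ℂ (coproj V x) (coproj V x) = inner ℂ (coproj V x) x := by
      conv_lhs => rw [← ContinuousLinearMap.adjoint_inner_left, coproj_adjoint, coproj_idem hV]
    have h2 := norm_inner_le_norm (𝕜 := ℂ) (coproj V x) x
    rwa [← h1, inner_self_eq_norm_sq_to_K, norm_pow, RCLike.norm_ofReal, abs_norm, sq] at h2
  rcases (norm_nonneg (coproj V x)).eq_or_lt with h0 | h0
  · rw [← h0]; positivity
  · rw [one_mul]; exact le_of_mul_le_mul_left h h0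

lemma norm_isometry_le (hV : V.adjoint ∘L V = 1) : ‖V‖ ≤ 1 := by
  refine ContinuousLinearMap.opNorm_le_bound _ zero_le_one fun x => ?_
  have h : inner ℂ (V x) (V x) = inner ℂ x x := by
    rw [← ContinuousLinearMap.adjoint_inner_left]
    exact congrArg (inner ℂ · x) (DFunLike.congr_fun hV x)
  have h2 : ‖V x‖ = ‖x‖ := by
    rw [norm_eq_sqrt_re_inner (𝕜 := ℂ), h, ← norm_eq_sqrt_re_inner (𝕜 := ℂ)]
  rw [h2, one_mul]

lemma norm_compression_le (hV : V.adjoint ∘L V = 1) (A : H →L[ℂ] H) :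
    ‖V.adjoint ∘L A ∘L V‖ ≤ ‖A‖ := by
  have h1 := norm_isometry_le hV
  have h2 : ‖V.adjoint‖ ≤ 1 := by rwa [LinearIsometryEquiv.norm_map]
  calc ‖V.adjoint ∘L A ∘L V‖ ≤ ‖V.adjoint‖ * (‖A‖ * ‖V‖) :=
        (ContinuousLinearMap.opNorm_comp_le _ _).trans
          (mul_le_mul_of_nonneg_left (ContinuousLinearMap.opNorm_comp_le _ _) (norm_nonneg _))
    _ ≤ 1 * (‖A‖ * 1) := by gcongr
    _ = ‖A‖ := by ring

/-- If the compression of `G` is invertible with inverse `R`, the off-diagonal block of `G⁻¹` is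
`-Q G⁻¹ Q G V R`, where `Q` is the complementary projection. -/
lemma coproj_inverse_eq (hV : V.adjoint ∘L V = 1) {G Gi : H →L[ℂ] H} (hG : Gi ∘L G = 1)
    {R : EuclideanSpace ℂ ι →L[ℂ] EuclideanSpace ℂ ι}
    (hR : (V.adjoint ∘L G ∘L V) ∘L R = 1) :
    coproj V ∘L Gi ∘L V = -((coproj V ∘L Gi) ∘L ((coproj V ∘L G ∘L V) ∘L R)) := by
  ext1 x
  have h1 : V.adjoint (G (V (R x))) = x := DFunLike.congr_fun hR x
  have h2 := coproj_add V (G (V (R x)))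
  rw [h1] at h2
  have h3 : Gi (G (V (R x))) = V (R x) := DFunLike.congr_fun hG _
  have h4 : coproj V (Gi (coproj V (G (V (R x))) + V x)) = 0 := by
    rw [h2, h3, coproj_apply_range hV]
  rw [map_add, map_add] at h4
  simpa using eq_neg_of_add_eq_zero_right h4

variable {b κ : ℝ} {G Gi E : H →L[ℂ] H} {R : EuclideanSpace ℂ ι →L[ℂ] EuclideanSpace ℂ ι}

/-- The off-diagonal block of `G⁻¹E` is controlled by those of `G` and `E`. -/
lemma hsNorm_quotient_le (hV : V.adjoint ∘L V = 1) (hb : 1 ≤ b) (hG : Gi ∘L G = 1)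
    (hR : (V.adjoint ∘L G ∘L V) ∘L R = 1) (hRb : ‖R‖ ≤ b) (hGib : ‖Gi‖ ≤ b) (hEb : ‖E‖ ≤ b)
    (hGκ : hsNorm (coproj V ∘L G ∘L V) ≤ κ) (hEκ : hsNorm (coproj V ∘L E ∘L V) ≤ κ) :
    hsNorm (coproj V ∘L (Gi ∘L E) ∘L V) ≤ 2 * b ^ 3 * κ := by
  have hκ : 0 ≤ κ := (hsNorm_nonneg _).trans hGκ
  have hb0 : 0 ≤ b := zero_le_one.trans hb
  have hQ := norm_coproj_le hV
  have hQGi : ‖coproj V ∘L Gi‖ ≤ b := by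
    refine (ContinuousLinearMap.opNorm_comp_le _ _).trans ?_
    calc _ ≤ 1 * b := by gcongr
      _ = b := one_mul b
  have h1 : coproj V ∘L (Gi ∘L E) ∘L V = (coproj V ∘L Gi) ∘L (coproj V ∘L E ∘L V)
      + (coproj V ∘L Gi ∘L V) ∘L (V.adjoint ∘L E ∘L V) := by
    ext1 x
    have := coproj_add V (E (V x))
    simp only [ContinuousLinearMap.comp_apply, _root_.add_apply]
    rw [← map_add, ← map_add, this]
  have h2 : hsNorm (coproj V ∘L Gi ∘L V) ≤ b * (κ * b) := by
    rw [coproj_inverse_eq hV hG hR, hsNorm_neg]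
    refine (hsNorm_comp_left_le _ _).trans ?_
    have := (hsNorm_comp_right_le (coproj V ∘L G ∘L V) R).trans
      (mul_le_mul hGκ hRb (norm_nonneg _) hκ)
    exact mul_le_mul hQGi this (hsNorm_nonneg _) hb0
  rw [h1]
  refine (hsNorm_add_le _ _).trans ?_
  have h3 := (hsNorm_comp_left_le (coproj V ∘L Gi) (coproj V ∘L E ∘L V)).trans
    (mul_le_mul hQGi hEκ (hsNorm_nonneg _) hb0)
  have h4 := (hsNorm_comp_right_le (coproj V ∘L Gi ∘L V) (V.adjoint ∘L E ∘L V)).trans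
    (mul_le_mul h2 ((norm_compression_le hV E).trans hEb) (norm_nonneg _) (by positivity))
  have h5 : b * κ ≤ b ^ 3 * κ := by
    refine mul_le_mul_of_nonneg_right ?_ hκ
    exact le_self_pow₀ hb (by norm_num)
  nlinarith

/-- Off-diagonal blocks of powers. -/
lemma hsNorm_pow_le (hV : V.adjoint ∘L V = 1) {Y : H →L[ℂ] H} {y : ℝ} (hb : 1 ≤ b)
    (hYb : ‖Y‖ ≤ b) (hYy : hsNorm (coproj V ∘L Y ∘L V) ≤ y) (m : ℕ) :
    hsNorm (coproj V ∘L (Y ^ m) ∘L V) ≤ m * b ^ m * y := by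
  have hy : 0 ≤ y := (hsNorm_nonneg _).trans hYy
  have hb0 : 0 ≤ b := zero_le_one.trans hb
  induction m with
  | zero =>
    have : coproj V ∘L (Y ^ 0) ∘L V = 0 := by ext1 x; simp [coproj_apply_range hV]
    rw [this]; simp [hsNorm]
  | succ m ih =>
    have h1 : coproj V ∘L (Y ^ (m + 1)) ∘L V = (coproj V ∘L Y) ∘L (coproj V ∘L (Y ^ m) ∘L V)
        + (coproj V ∘L Y ∘L V) ∘L (V.adjoint ∘L (Y ^ m) ∘L V) := by
      ext1 x
      have := coproj_add V ((Y ^ m) (V x))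
      simp only [ContinuousLinearMap.comp_apply, _root_.add_apply]
      rw [← map_add, ← map_add, this, pow_succ']
      rfl
    have hQY : ‖coproj V ∘L Y‖ ≤ b := by
      refine (ContinuousLinearMap.opNorm_comp_le _ _).trans ?_
      calc _ ≤ 1 * b := mul_le_mul (norm_coproj_le hV) hYb (norm_nonneg _) zero_le_one
        _ = b := one_mul b
    have hYm : ‖V.adjoint ∘L (Y ^ m) ∘L V‖ ≤ b ^ m := by
      refine (norm_compression_le hV _).trans ?_
      rcases m.eq_zero_or_pos with rfl | hm
      · rw [pow_zero, pow_zero]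
        exact ContinuousLinearMap.norm_id_le
      · exact (norm_pow_le' Y hm).trans (pow_le_pow_left₀ (norm_nonneg _) hYb m)
    rw [h1]
    refine (hsNorm_add_le _ _).trans ?_
    have h3 := (hsNorm_comp_left_le (coproj V ∘L Y) (coproj V ∘L (Y ^ m) ∘L V)).trans
      (mul_le_mul hQY ih (hsNorm_nonneg _) hb0)
    have h4 := (hsNorm_comp_right_le (coproj V ∘L Y ∘L V) (V.adjoint ∘L (Y ^ m) ∘L V)).trans
      (mul_le_mul hYy hYm (norm_nonneg _) hy)
    have h5 : y * b ^ m ≤ y * b ^ (m + 1) :=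
      mul_le_mul_of_nonneg_left (pow_le_pow_right₀ hb (Nat.le_succ m)) hy
    push_cast
    rw [pow_succ] at h5 ⊢
    nlinarith

/-- The trace of `A V* U Q W V` is controlled by the off-diagonal blocks of `U` and `W`. -/
lemma norm_opTrace_corner_le (hV : V.adjoint ∘L V = 1)
    (A : EuclideanSpace ℂ ι →L[ℂ] EuclideanSpace ℂ ι) {U W : H →L[ℂ] H} {u w a : ℝ}
    (hU : ContinuousLinearMap.adjoint U = U) (hA : ‖A‖ ≤ a)
    (hu : hsNorm (coproj V ∘L U ∘L V) ≤ u) (hw : hsNorm (coproj V ∘L W ∘L V) ≤ w) :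
    ‖opTrace (A ∘L V.adjoint ∘L U ∘L coproj V ∘L W ∘L V)‖ ≤ a * (u * w) := by
  have h : A ∘L V.adjoint ∘L U ∘L coproj V ∘L W ∘L V
      = A ∘L (coproj V ∘L U ∘L V).adjoint ∘L (coproj V ∘L W ∘L V) := by
    simp only [ContinuousLinearMap.adjoint_comp, coproj_adjoint, hU]
    ext1 x
    simp only [ContinuousLinearMap.comp_apply, coproj_idem hV]
  rw [h]
  refine (norm_opTrace_adjoint_comp_le _ _ _).trans ?_
  exact mul_le_mul hA (mul_le_mul hu hw (hsNorm_nonneg _) ((hsNorm_nonneg _).trans hu))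
    (mul_nonneg (hsNorm_nonneg _) (hsNorm_nonneg _)) ((norm_nonneg _).trans hA)

lemma opTrace_add (A B : EuclideanSpace ℂ ι →L[ℂ] EuclideanSpace ℂ ι) :
    opTrace (A + B) = opTrace A + opTrace B := by
  simp [opTrace, Finset.sum_add_distrib]

lemma opTrace_sub (A B : EuclideanSpace ℂ ι →L[ℂ] EuclideanSpace ℂ ι) :
    opTrace (A - B) = opTrace A - opTrace B := by
  simp [opTrace, Finset.sum_sub_distrib]

/-- For commuting self-adjoint operators `G` and `E`, with `G` and its compression to the range of
`V` boundedly invertible, the trace of a power of the quotient of the compressions differs from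
that of the compressed power of the quotient by a bound that only depends on operator norms and
on the Hilbert–Schmidt norms of the off-diagonal blocks of `G` and `E`. -/
lemma norm_opTrace_pow_sub_le (hV : V.adjoint ∘L V = 1) (hb : 1 ≤ b) (hG : Gi ∘L G = 1)
    (hG' : G ∘L Gi = 1) (hGa : ContinuousLinearMap.adjoint G = G)
    (hEa : ContinuousLinearMap.adjoint E = E)
    (hR : (V.adjoint ∘L G ∘L V) ∘L R = 1) (hR' : R ∘L (V.adjoint ∘L G ∘L V) = 1)
    (hRb : ‖R‖ ≤ b) (hGib : ‖Gi‖ ≤ b) (hEb : ‖E‖ ≤ b) (hYb : ‖Gi ∘L E‖ ≤ b)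
    (hGκ : hsNorm (coproj V ∘L G ∘L V) ≤ κ) (hEκ : hsNorm (coproj V ∘L E ∘L V) ≤ κ) (m : ℕ)
    (A : EuclideanSpace ℂ ι →L[ℂ] EuclideanSpace ℂ ι) :
    ‖opTrace (A ∘L ((R ∘L (V.adjoint ∘L E ∘L V)) ^ m))
      - opTrace (A ∘L (V.adjoint ∘L ((Gi ∘L E) ^ m) ∘L V))‖ ≤ traceConst b κ m * ‖A‖ := by
  have hκ : 0 ≤ κ := (hsNorm_nonneg _).trans hGκ
  have hb0 : 0 ≤ b := zero_le_one.trans hb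
  have hy := hsNorm_quotient_le hV hb hG hR hRb hGib hEb hGκ hEκ
  have hpow := hsNorm_pow_le hV hb hYb hy
  induction m generalizing A with
  | zero =>
    have : V.adjoint ∘L ((Gi ∘L E) ^ 0) ∘L V = 1 := hV
    rw [this, pow_zero, sub_self, norm_zero, traceConst, zero_mul]
  | succ m ih =>
    set TE := V.adjoint ∘L E ∘L V with hTE
    set Y := Gi ∘L E with hY
    have hGY : ∀ x, G (Y x) = E x := fun x => DFunLike.congr_fun hG' (E x)
    have e1 : A ∘L ((R ∘L TE) ^ (m + 1)) = (A ∘L R ∘L TE) ∘L ((R ∘L TE) ^ m) := by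
      rw [pow_succ']; rfl
    -- The recursion: peeling off one factor `R TE` produces the next power and two corner terms, as
    -- `V V* = 1 - Q` may be inserted after `G` and after `E` and `G Y = E`.
    have e2 : (A ∘L R ∘L TE) ∘L (V.adjoint ∘L (Y ^ m) ∘L V)
        = A ∘L (V.adjoint ∘L (Y ^ (m + 1)) ∘L V)
          + (A ∘L R) ∘L V.adjoint ∘L G ∘L coproj V ∘L (Y ^ (m + 1)) ∘L V
          - (A ∘L R) ∘L V.adjoint ∘L E ∘L coproj V ∘L (Y ^ m) ∘L V := by
      ext1 x
      have h1 := coproj_add V ((Y ^ m) (V x))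
      have h2 := coproj_add V ((Y ^ (m + 1)) (V x))
      have h3 : G ((Y ^ (m + 1)) (V x)) = E ((Y ^ m) (V x)) := by
        rw [pow_succ']; exact hGY _
      have h4 : R (V.adjoint (G (V (V.adjoint ((Y ^ (m + 1)) (V x))))))
          = V.adjoint ((Y ^ (m + 1)) (V x)) := DFunLike.congr_fun hR' _
      simp only [ContinuousLinearMap.comp_apply, _root_.add_apply,
        _root_.sub_apply, hTE]
      rw [eq_sub_iff_add_eq, ← map_add, ← map_add, ← map_add, ← map_add, add_comm (V _), h1, ← h3,
        ← h4, ← map_add, ← map_add, ← map_add, ← map_add, add_comm (V _), h2]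
    have hAR : ‖A ∘L R‖ ≤ b * ‖A‖ := by
      refine (ContinuousLinearMap.opNorm_comp_le _ _).trans ?_
      rw [mul_comm]
      exact mul_le_mul_of_nonneg_right hRb (norm_nonneg _)
    have hARE : ‖A ∘L R ∘L TE‖ ≤ b ^ 2 * ‖A‖ := by
      refine (ContinuousLinearMap.opNorm_comp_le (A ∘L R) TE).trans ?_
      calc _ ≤ (b * ‖A‖) * b :=
            mul_le_mul hAR ((norm_compression_le hV E).trans hEb) (norm_nonneg _) (by positivity)
        _ = _ := by ring
    have i1 := ih (A ∘L R ∘L TE)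
    rw [e2, opTrace_sub, opTrace_add, ← e1] at i1
    have i2 := norm_opTrace_corner_le hV (A ∘L R) hGa hAR hGκ (hpow (m + 1))
    have i3 := norm_opTrace_corner_le hV (A ∘L R) hEa hAR hEκ (hpow m)
    have i4 := mul_le_mul_of_nonneg_left hARE (traceConst_nonneg hb0 hκ m)
    set X := opTrace (A ∘L ((R ∘L TE) ^ (m + 1)))
    set X1 := opTrace (A ∘L (V.adjoint ∘L (Y ^ (m + 1)) ∘L V))
    set X2 := opTrace ((A ∘L R) ∘L V.adjoint ∘L G ∘L coproj V ∘L (Y ^ (m + 1)) ∘L V)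
    set X3 := opTrace ((A ∘L R) ∘L V.adjoint ∘L E ∘L coproj V ∘L (Y ^ m) ∘L V)
    have e3 : X - X1 = (X - (X1 + X2 - X3)) + X2 - X3 := by ring
    rw [e3]
    refine (norm_sub_le _ _).trans ((add_le_add_left (norm_add_le _ _) _).trans ?_)
    rw [traceConst]
    push_cast at i2
    nlinarith

end CompressionTrace

/-! ### Multiplication operators on the circle and Toeplitz matrices -/

section Circle

open AddCircle
open scoped ENNReal

variable {T : ℝ} [hT : Fact (0 < T)]

/-- Multiplication by a continuous function, as an operator on the square-integrable functions on
the circle. -/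
noncomputable def mulOp (f : C(AddCircle T, ℂ)) :
    Lp ℂ 2 (haarAddCircle (T := T)) →L[ℂ] Lp ℂ 2 (haarAddCircle (T := T)) :=
  (ContinuousLinearMap.mul ℂ ℂ).holderL haarAddCircle ∞ 2 2
    (ContinuousMap.toLp ∞ haarAddCircle ℂ f)

lemma coeFn_mulOp (f : C(AddCircle T, ℂ)) (g : Lp ℂ 2 (haarAddCircle (T := T))) :
    mulOp f g =ᵐ[haarAddCircle] fun x => f x * g x := by
  have h1 := (ContinuousLinearMap.mul ℂ ℂ).coeFn_holder (r := 2)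
    (ContinuousMap.toLp ∞ (haarAddCircle (T := T)) ℂ f) g
  have h2 := ContinuousMap.coeFn_toLp (p := ∞) (𝕜 := ℂ) (haarAddCircle (T := T)) f
  filter_upwards [h1, h2] with x hx1 hx2
  rw [← hx2]
  exact hx1

lemma mulOp_mul (f g : C(AddCircle T, ℂ)) : mulOp (f * g) = mulOp f ∘L mulOp g := by
  ext1 u
  apply Lp.ext
  filter_upwards [coeFn_mulOp (f * g) u, coeFn_mulOp f (mulOp g u), coeFn_mulOp g u] with x h1 h2 h3
  rw [ContinuousLinearMap.comp_apply, h1, h2, h3, ContinuousMap.mul_apply, mul_assoc]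

lemma mulOp_one : mulOp (1 : C(AddCircle T, ℂ)) = 1 := by
  ext1 u
  apply Lp.ext
  filter_upwards [coeFn_mulOp 1 u] with x h1
  rw [h1]
  simp

lemma mulOp_pow (f : C(AddCircle T, ℂ)) (m : ℕ) : mulOp f ^ m = mulOp (f ^ m) := by
  induction m with
  | zero => rw [pow_zero, pow_zero, mulOp_one]
  | succ m ih => rw [pow_succ, pow_succ, mulOp_mul, ih]; rfl

lemma norm_mulOp_le (f : C(AddCircle T, ℂ)) : ‖mulOp f‖ ≤ ‖f‖ := by
  have h1 : ‖ContinuousMap.toLp ∞ (haarAddCircle (T := T)) ℂ f‖ ≤ ‖f‖ := by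
    refine (ContinuousLinearMap.le_opNorm _ _).trans ?_
    have := ContinuousMap.toLp_norm_le (p := ∞) (E := ℂ) (𝕜 := ℂ) (μ := haarAddCircle (T := T))
    have h2 : ‖ContinuousMap.toLp ∞ (haarAddCircle (T := T)) ℂ (E := ℂ)‖ ≤ 1 := by simpa using this
    exact (mul_le_mul_of_nonneg_right h2 (norm_nonneg _)).trans_eq (one_mul _)
  refine (ContinuousLinearMap.le_opNorm _ _).trans ?_
  have h3 : ‖(ContinuousLinearMap.mul ℂ ℂ).holderL (haarAddCircle (T := T)) ∞ 2 2‖ ≤ 1 :=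
    (ContinuousLinearMap.norm_holderL_le _).trans (ContinuousLinearMap.opNorm_mul_le ℂ ℂ)
  exact (mul_le_mul h3 h1 (norm_nonneg _) zero_le_one).trans_eq (one_mul _)

lemma adjoint_mulOp (f : C(AddCircle T, ℂ)) :
    ContinuousLinearMap.adjoint (mulOp f) = mulOp (star f) := by
  symm
  rw [ContinuousLinearMap.eq_adjoint_iff]
  intro u v
  rw [L2.inner_def, L2.inner_def]
  refine integral_congr_ae ?_
  filter_upwards [coeFn_mulOp (star f) u, coeFn_mulOp f v] with x h1 h2
  rw [h1, h2]
  simp [mul_comm, mul_left_comm]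

lemma inner_fourierLp_mulOp (f : C(AddCircle T, ℂ)) (j k : ℤ) :
    inner ℂ (fourierLp (T := T) 2 j) (mulOp f (fourierLp 2 k)) = fourierCoeff f (j - k) := by
  rw [L2.inner_def, fourierCoeff]
  refine integral_congr_ae ?_
  filter_upwards [coeFn_mulOp f (fourierLp 2 k), coeFn_fourierLp (T := T) 2 j,
    coeFn_fourierLp (T := T) 2 k] with x h1 h2 h3
  rw [h1, h2, h3, neg_sub, sub_eq_add_neg, fourier_add, fourier_neg]
  simp only [RCLike.inner_apply, smul_eq_mul]
  ring

/-- The isometry sending the standard basis to the characters of index `0, …, n - 1`. -/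
noncomputable def charEmbed (T : ℝ) [Fact (0 < T)] (n : ℕ) :
    EuclideanSpace ℂ (Fin n) →L[ℂ] Lp ℂ 2 (haarAddCircle (T := T)) :=
  LinearMap.toContinuousLinearMap ((EuclideanSpace.basisFun (Fin n) ℂ).toBasis.constr ℂ
    fun i => fourierLp (T := T) 2 (i : ℤ))

lemma charEmbed_basisFun (n : ℕ) (i : Fin n) :
    charEmbed T n (EuclideanSpace.basisFun (Fin n) ℂ i) = fourierLp 2 (i : ℤ) := by
  have := (EuclideanSpace.basisFun (Fin n) ℂ).toBasis.constr_basis ℂ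
    (fun i => fourierLp (T := T) 2 (i : ℤ)) i
  rw [OrthonormalBasis.coe_toBasis] at this
  exact this

/-- A continuous linear map into a Euclidean space is determined by its matrix entries. -/
lemma clm_ext_inner {n : ℕ} {A B : EuclideanSpace ℂ (Fin n) →L[ℂ] EuclideanSpace ℂ (Fin n)}
    (h : ∀ i j, inner ℂ (EuclideanSpace.basisFun (Fin n) ℂ i) (A (EuclideanSpace.basisFun _ ℂ j))
      = inner ℂ (EuclideanSpace.basisFun (Fin n) ℂ i) (B (EuclideanSpace.basisFun _ ℂ j))) :
    A = B := by
  have : (A : EuclideanSpace ℂ (Fin n) →ₗ[ℂ] EuclideanSpace ℂ (Fin n)) = B := by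
    refine (EuclideanSpace.basisFun (Fin n) ℂ).toBasis.ext fun j => ?_
    refine InnerProductSpace.ext_inner_left_basis (EuclideanSpace.basisFun (Fin n) ℂ).toBasis fun i => ?_
    simpa using h i j
  exact ContinuousLinearMap.coe_injective this

lemma inner_compression (n : ℕ) (f : C(AddCircle T, ℂ)) (i j : Fin n) :
    inner ℂ (EuclideanSpace.basisFun (Fin n) ℂ i)
      (((charEmbed T n).adjoint ∘L mulOp f ∘L charEmbed T n) (EuclideanSpace.basisFun _ ℂ j))
      = fourierCoeff f (i - j) := by
  simp only [ContinuousLinearMap.comp_apply]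
  rw [ContinuousLinearMap.adjoint_inner_right, charEmbed_basisFun, charEmbed_basisFun,
    inner_fourierLp_mulOp]

lemma charEmbed_adjoint_comp (n : ℕ) : (charEmbed T n).adjoint ∘L charEmbed T n = 1 := by
  refine clm_ext_inner fun i j => ?_
  have h2 : mulOp (1 : C(AddCircle T, ℂ)) ∘L charEmbed T n = charEmbed T n := by
    rw [mulOp_one]; rfl
  have := orthonormal_iff_ite.1 (orthonormal_fourier (T := T)) (i : ℤ) (j : ℤ)
  rw [ContinuousLinearMap.comp_apply, ContinuousLinearMap.adjoint_inner_right,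
    charEmbed_basisFun, charEmbed_basisFun, this, one_apply_eq_self,
    orthonormal_iff_ite.1 (EuclideanSpace.basisFun (Fin n) ℂ).orthonormal]
  simp [Fin.ext_iff]

/-- The Toeplitz matrix whose entries are the Fourier coefficients of a continuous function. -/
noncomputable def toeplitz (n : ℕ) (f : C(AddCircle T, ℂ)) : Matrix (Fin n) (Fin n) ℂ :=
  Matrix.of fun i j => fourierCoeff f ((i : ℤ) - (j : ℤ))

lemma inner_basis_toEuclideanCLM {n : ℕ} (A : Matrix (Fin n) (Fin n) ℂ) (i j : Fin n) :
    inner ℂ (EuclideanSpace.basisFun (Fin n) ℂ i)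
      (toEuclideanCLM (𝕜 := ℂ) A (EuclideanSpace.basisFun _ ℂ j)) = A i j := by
  simp [EuclideanSpace.inner_single_left]

/-- Toeplitz matrices are compressions of multiplication operators. -/
lemma compression_mulOp_eq (n : ℕ) (f : C(AddCircle T, ℂ)) :
    (charEmbed T n).adjoint ∘L mulOp f ∘L charEmbed T n
      = toEuclideanCLM (𝕜 := ℂ) (toeplitz n f) := by
  refine clm_ext_inner fun i j => ?_
  rw [inner_compression, inner_basis_toEuclideanCLM]
  rfl

lemma opTrace_toEuclideanCLM {n : ℕ} (A : Matrix (Fin n) (Fin n) ℂ) :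
    opTrace (toEuclideanCLM (𝕜 := ℂ) A) = A.trace :=
  Finset.sum_congr rfl fun i _ => inner_basis_toEuclideanCLM A i i

lemma trace_toeplitz (n : ℕ) (f : C(AddCircle T, ℂ)) :
    (toeplitz n f).trace = n * ∫ x, f x ∂haarAddCircle := by
  simp [toeplitz, Matrix.trace, fourierCoeff]

end Circle

/-! ### Traces of powers of quotients of Toeplitz matrices -/

section ToeplitzTrace

open AddCircle

lemma HilbertBasis.norm_sq_le_of_hasSum {ι H : Type*} [NormedAddCommGroup H]
    [InnerProductSpace ℂ H] (B : HilbertBasis ι ℂ H) {x : H} {g : ι → ℝ} {s : ℝ}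
    (hg : HasSum g s) (h : ∀ i, ‖inner ℂ (B i) x‖ ^ 2 ≤ g i) : ‖x‖ ^ 2 ≤ s := by
  have h1 := (B.hasSum_inner_mul_inner x x).mapL Complex.reCLM
  have h2 : (fun i => Complex.reCLM (inner ℂ x (B i) * inner ℂ (B i) x))
      = fun i => ‖inner ℂ (B i) x‖ ^ 2 := by
    funext i
    rw [← inner_conj_symm x (B i), ← Complex.normSq_eq_conj_mul_self, Complex.reCLM_apply,
      Complex.ofReal_re, Complex.normSq_eq_norm_sq]
  have h3 : Complex.reCLM (inner ℂ x x) = ‖x‖ ^ 2 := by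
    rw [Complex.reCLM_apply]
    exact inner_self_eq_norm_sq (𝕜 := ℂ) x
  rw [h3] at h1
  have h4 : HasSum (fun i => ‖inner ℂ (B i) x‖ ^ 2) (‖x‖ ^ 2) := h2 ▸ h1
  exact hasSum_le h h4 hg

/-- A geometric sequence around `k`, summed over the complement of `{0, …, n - 1}`. -/
lemma hasSum_geometric_outside {q : ℝ} (hq0 : 0 ≤ q) (hq1 : q < 1) (n : ℕ) (k : Fin n) :
    HasSum (fun j : ℤ => if 0 ≤ j ∧ j < n then 0 else q ^ (j - k).natAbs)
      (q ^ (n - k : ℕ) * (1 - q)⁻¹ + q ^ (k + 1 : ℕ) * (1 - q)⁻¹) := by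
  have hk := k.2
  apply HasSum.of_nat_of_neg_add_one
  · refine (hasSum_nat_add_iff' n).1 ?_
    have h0 : ∑ i ∈ Finset.range n, (if 0 ≤ (i : ℤ) ∧ (i : ℤ) < n then (0 : ℝ)
        else q ^ ((i : ℤ) - (k : ℤ)).natAbs) = 0 :=
      Finset.sum_eq_zero fun i hi => by
        rw [if_pos ⟨by omega, by have := Finset.mem_range.1 hi; omega⟩]
    rw [h0, sub_zero]
    refine ((hasSum_geometric_of_lt_one hq0 hq1).mul_left (q ^ (n - k : ℕ))).congr_fun fun i => ?_
    rw [if_neg (by push_cast; omega), ← pow_add]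
    congr 1
    push_cast; omega
  · refine ((hasSum_geometric_of_lt_one hq0 hq1).mul_left (q ^ (k + 1 : ℕ))).congr_fun fun i => ?_
    rw [if_neg (by omega), ← pow_add]
    congr 1
    omega

variable {T : ℝ}

/-- A real continuous function, viewed as a complex one. -/
noncomputable def cpx (f : C(AddCircle T, ℝ)) : C(AddCircle T, ℂ) :=
  (⟨Complex.ofReal, Complex.continuous_ofReal⟩ : C(ℝ, ℂ)).comp f

@[simp] lemma cpx_apply (f : C(AddCircle T, ℝ)) (x : AddCircle T) : cpx f x = (f x : ℂ) := rfl

variable [hT : Fact (0 < T)]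

lemma inner_fourierLp_coproj (n : ℕ) (j : ℤ) (u : Lp ℂ 2 (haarAddCircle (T := T))) :
    inner ℂ (fourierLp (T := T) 2 j) (coproj (charEmbed T n) u)
      = if 0 ≤ j ∧ j < n then 0 else inner ℂ (fourierLp (T := T) 2 j) u := by
  rw [← ContinuousLinearMap.adjoint_inner_left, coproj_adjoint]
  split_ifs with h
  · obtain ⟨i, rfl⟩ : ∃ i : Fin n, j = (i : ℤ) := ⟨⟨j.toNat, by omega⟩, by simp [h.1]⟩
    rw [← charEmbed_basisFun, coproj_apply_range (charEmbed_adjoint_comp n), inner_zero_left]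
  · congr 1
    have h1 : (charEmbed T n).adjoint (fourierLp (T := T) 2 j) = 0 := by
      refine InnerProductSpace.ext_inner_left_basis
        (EuclideanSpace.basisFun (Fin n) ℂ).toBasis fun i => ?_
      rw [OrthonormalBasis.coe_toBasis, ContinuousLinearMap.adjoint_inner_right,
        charEmbed_basisFun, orthonormal_iff_ite.1 (orthonormal_fourier (T := T)), inner_zero_right,
        if_neg]
      have := i.2
      omega
    have h2 := coproj_add (charEmbed T n) (fourierLp (T := T) 2 j)
    rwa [h1, map_zero, add_zero] at h2

/-- The off-diagonal blocks of multiplication by a function with geometrically decaying Fourier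
coefficients have Hilbert–Schmidt norm bounded independently of the size of the block. -/
lemma sq_hsNorm_mulOp_le {q M : ℝ} (hq0 : 0 ≤ q) (hq1 : q < 1) (n : ℕ) {f : C(AddCircle T, ℂ)}
    (hf : ∀ d : ℤ, d ≠ 0 → ‖fourierCoeff f d‖ ^ 2 ≤ M ^ 2 * q ^ d.natAbs) :
    hsNorm (coproj (charEmbed T n) ∘L mulOp f ∘L charEmbed T n) ^ 2
      ≤ 2 * M ^ 2 * (q / (1 - q) ^ 2) := by
  have h1q : 0 < 1 - q := by linarith
  have h1 : ∀ k : Fin n, ‖(coproj (charEmbed T n) ∘L mulOp f ∘L charEmbed T n)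
      (EuclideanSpace.basisFun (Fin n) ℂ k)‖ ^ 2
      ≤ M ^ 2 * (q ^ (n - k : ℕ) * (1 - q)⁻¹ + q ^ (k + 1 : ℕ) * (1 - q)⁻¹) := by
    intro k
    -- Parseval: only the characters outside `0, …, n - 1` survive the projection
    refine (fourierBasis (T := T)).norm_sq_le_of_hasSum
      ((hasSum_geometric_outside hq0 hq1 n k).mul_left (M ^ 2)) fun j => ?_
    rw [coe_fourierBasis, ContinuousLinearMap.comp_apply, ContinuousLinearMap.comp_apply,
      inner_fourierLp_coproj, charEmbed_basisFun, inner_fourierLp_mulOp]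
    split_ifs with h
    · simp
    · exact hf _ (by have := k.2; omega)
  have h2 : ∑ k : Fin n, q ^ (k + 1 : ℕ) ≤ q * (1 - q)⁻¹ := by
    have := (hasSum_geometric_of_lt_one hq0 hq1).mul_left q
    rw [Fin.sum_univ_eq_sum_range (fun k => q ^ (k + 1)) n]
    simp_rw [pow_succ']
    exact sum_le_hasSum _ (fun i _ => by positivity) this
  have h3 : ∑ k : Fin n, q ^ (n - k : ℕ) = ∑ k : Fin n, q ^ (k + 1 : ℕ) := by
    rw [← Equiv.sum_comp Fin.revPerm]
    refine Finset.sum_congr rfl fun k _ => ?_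
    have := k.2
    congr 1
    simp only [Fin.revPerm_apply, Fin.val_rev]
    omega
  rw [sq_hsNorm]
  refine (Finset.sum_le_sum fun k _ => h1 k).trans ?_
  rw [← Finset.mul_sum, Finset.sum_add_distrib, ← Finset.sum_mul, ← Finset.sum_mul, h3]
  have h4 : q / (1 - q) ^ 2 = q * (1 - q)⁻¹ * (1 - q)⁻¹ := by field_simp
  have h5 : (∑ k : Fin n, q ^ (k + 1 : ℕ)) * (1 - q)⁻¹ ≤ q * (1 - q)⁻¹ * (1 - q)⁻¹ :=
    mul_le_mul_of_nonneg_right h2 (by positivity)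
  rw [h4]
  nlinarith [sq_nonneg M]

lemma norm_cpx_le {f : C(AddCircle T, ℝ)} {b : ℝ} (hb : 0 ≤ b) (h : ∀ x, |f x| ≤ b) :
    ‖cpx f‖ ≤ b :=
  (ContinuousMap.norm_le _ hb).2 fun x => by simpa using h x

lemma adjoint_mulOp_cpx (f : C(AddCircle T, ℝ)) :
    ContinuousLinearMap.adjoint (mulOp (cpx f)) = mulOp (cpx f) := by
  rw [adjoint_mulOp]
  congr 1
  ext x
  simp

/-- A multiplication operator inherits a pointwise lower bound of its symbol, because the
difference is the square of a self-adjoint multiplication operator. -/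
lemma le_re_inner_mulOp {f : C(AddCircle T, ℝ)} {s : ℝ} (h : ∀ x, s ≤ f x)
    (u : Lp ℂ 2 (haarAddCircle (T := T))) :
    s * ‖u‖ ^ 2 ≤ Complex.re (inner ℂ u (mulOp (cpx f) u)) := by
  let r : C(AddCircle T, ℝ) := ⟨fun x => Real.sqrt (f x - s), by fun_prop⟩
  have h1 : cpx f = cpx r * cpx r + (s : ℂ) • 1 := by
    ext x
    have : Real.sqrt (f x - s) * Real.sqrt (f x - s) = f x - s :=
      Real.mul_self_sqrt (sub_nonneg.2 (h x))
    have h2 : f x = r x * r x + s := by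
      change f x = Real.sqrt (f x - s) * Real.sqrt (f x - s) + s
      rw [this]; ring
    simp only [cpx_apply, ContinuousMap.add_apply, ContinuousMap.mul_apply,
      ContinuousMap.smul_apply, ContinuousMap.one_apply, smul_eq_mul, mul_one]
    rw [h2]
    push_cast
    rfl
  have h2 : mulOp (cpx f) u = mulOp (cpx r) (mulOp (cpx r) u) + (s : ℂ) • u := by
    rw [h1]
    have e1 : mulOp (cpx r * cpx r + (s : ℂ) • 1) = mulOp (cpx r * cpx r)
        + (s : ℂ) • mulOp (1 : C(AddCircle T, ℂ)) := by
      rw [mulOp, map_add, map_add, map_smul, map_smul]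
      rfl
    rw [e1, mulOp_mul, mulOp_one]
    rfl
  rw [h2, inner_add_right, inner_smul_right, ← ContinuousLinearMap.adjoint_inner_left,
    adjoint_mulOp_cpx, Complex.add_re, Complex.re_ofReal_mul]
  have h3 : Complex.re (inner ℂ u u) = ‖u‖ ^ 2 := inner_self_eq_norm_sq (𝕜 := ℂ) u
  have h4 : 0 ≤ Complex.re (inner ℂ (mulOp (cpx r) u) (mulOp (cpx r) u)) :=
    inner_self_nonneg (𝕜 := ℂ)
  rw [h3]
  linarith

lemma norm_charEmbed (n : ℕ) (x : EuclideanSpace ℂ (Fin n)) : ‖charEmbed T n x‖ = ‖x‖ := by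
  have h : inner ℂ (charEmbed T n x) (charEmbed T n x) = inner ℂ x x := by
    rw [← ContinuousLinearMap.adjoint_inner_left]
    exact congrArg (inner ℂ · x) (DFunLike.congr_fun (charEmbed_adjoint_comp n) x)
  rw [norm_eq_sqrt_re_inner (𝕜 := ℂ), h, ← norm_eq_sqrt_re_inner (𝕜 := ℂ)]

lemma mul_norm_le_norm_toeplitz {f : C(AddCircle T, ℝ)} {s : ℝ} (h : ∀ x, s ≤ f x)
    (n : ℕ) (x : EuclideanSpace ℂ (Fin n)) :
    s * ‖x‖ ≤ ‖toEuclideanCLM (𝕜 := ℂ) (toeplitz n (cpx f)) x‖ := by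
  have h1 := le_re_inner_mulOp h (charEmbed T n x)
  have h2 : inner ℂ (charEmbed T n x) (mulOp (cpx f) (charEmbed T n x))
      = inner ℂ x (toEuclideanCLM (𝕜 := ℂ) (toeplitz n (cpx f)) x) := by
    rw [← compression_mulOp_eq, ContinuousLinearMap.comp_apply, ContinuousLinearMap.comp_apply,
      ContinuousLinearMap.adjoint_inner_right]
  rw [h2, norm_charEmbed] at h1
  have h3 := h1.trans ((Complex.re_le_norm _).trans (norm_inner_le_norm _ _))
  rcases (norm_nonneg x).eq_or_lt with h0 | h0
  · rw [← h0, mul_zero]; exact norm_nonneg _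
  · refine le_of_mul_le_mul_left ?_ h0
    linarith [h3]

lemma isUnit_det_toeplitz {f : C(AddCircle T, ℝ)} {s : ℝ} (hs : 0 < s) (h : ∀ x, s ≤ f x)
    (n : ℕ) : IsUnit (toeplitz n (cpx f)).det := by
  rw [← Matrix.isUnit_iff_isUnit_det, ← Matrix.mulVec_injective_iff_isUnit]
  intro x y hxy
  have h1 := mul_norm_le_norm_toeplitz h n (WithLp.toLp 2 (x - y))
  have h2 : toEuclideanCLM (𝕜 := ℂ) (toeplitz n (cpx f)) (WithLp.toLp 2 (x - y)) = 0 := by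
    have hxy' : toeplitz n (cpx f) *ᵥ x = toeplitz n (cpx f) *ᵥ y := hxy
    rw [toEuclideanCLM_toLp, Matrix.mulVec_sub, hxy', sub_self]
    rfl
  rw [h2, norm_zero] at h1
  have h3 : ‖(WithLp.toLp 2 (x - y) : EuclideanSpace ℂ (Fin n))‖ = 0 :=
    le_antisymm (nonpos_of_mul_nonpos_right h1 hs) (norm_nonneg _)
  have h4 := norm_eq_zero.1 h3
  exact sub_eq_zero.1 (congrArg WithLp.ofLp h4)

lemma norm_inv_toeplitz_le {f : C(AddCircle T, ℝ)} {s : ℝ} (hs : 0 < s) (h : ∀ x, s ≤ f x)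
    (n : ℕ) : ‖toEuclideanCLM (𝕜 := ℂ) (toeplitz n (cpx f))⁻¹‖ ≤ s⁻¹ := by
  refine ContinuousLinearMap.opNorm_le_bound _ (by positivity) fun x => ?_
  have h1 := mul_norm_le_norm_toeplitz h n (toEuclideanCLM (𝕜 := ℂ) (toeplitz n (cpx f))⁻¹ x)
  rw [← mul_apply_eq_comp, ← map_mul, Matrix.mul_nonsing_inv _ (isUnit_det_toeplitz hs h n),
    map_one, one_apply_eq_self] at h1
  rwa [inv_mul_eq_div, le_div_iff₀ hs, mul_comm]

/-- Traces of powers of a quotient of Toeplitz matrices, compared with the mean of the power of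
the quotient of their symbols; the error is bounded independently of the size of the matrices. -/
theorem norm_trace_toeplitz_pow_sub_le {c d : C(AddCircle T, ℝ)} {b κ : ℝ} (hb : 1 ≤ b)
    (hc : ∀ x, b⁻¹ ≤ c x) (hd : ∀ x, |d x| ≤ b) (hdc : ∀ x, |d x / c x| ≤ b) (n : ℕ)
    (hcκ : hsNorm (coproj (charEmbed T n) ∘L mulOp (cpx c) ∘L charEmbed T n) ≤ κ)
    (hdκ : hsNorm (coproj (charEmbed T n) ∘L mulOp (cpx d) ∘L charEmbed T n) ≤ κ) (m : ℕ) :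
    ‖(((toeplitz n (cpx c))⁻¹ * toeplitz n (cpx d)) ^ m).trace
      - ((n * ∫ x, (d x / c x) ^ m ∂haarAddCircle : ℝ) : ℂ)‖ ≤ traceConst b κ m := by
  have hb0 : 0 < b := by linarith
  have hbi : 0 < b⁻¹ := inv_pos.2 hb0
  have hcpos : ∀ x, 0 < c x := fun x => hbi.trans_le (hc x)
  let ci : C(AddCircle T, ℝ) := ⟨fun x => (c x)⁻¹, c.continuous.inv₀ fun x => (hcpos x).ne'⟩
  have hci : cpx ci * cpx c = 1 := by
    ext x
    have : ((c x : ℝ) : ℂ) ≠ 0 := by exact_mod_cast (hcpos x).ne'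
    simp [ci, this]
  have hcib : ∀ x, |ci x| ≤ b := fun x => by
    change |(c x)⁻¹| ≤ b
    rw [abs_of_pos (inv_pos.2 (hcpos x))]
    exact inv_le_of_inv_le₀ hb0 (hc x)
  have hu := isUnit_det_toeplitz hbi hc n
  have key := norm_opTrace_pow_sub_le (b := b) (κ := κ) (G := mulOp (cpx c))
    (Gi := mulOp (cpx ci)) (E := mulOp (cpx d))
    (R := toEuclideanCLM (𝕜 := ℂ) (toeplitz n (cpx c))⁻¹)
    (charEmbed_adjoint_comp (T := T) n) hb (by rw [← mulOp_mul, hci, mulOp_one])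
    (by rw [← mulOp_mul, mul_comm, hci, mulOp_one]) (adjoint_mulOp_cpx c) (adjoint_mulOp_cpx d)
    (by
      rw [compression_mulOp_eq]
      change toEuclideanCLM (𝕜 := ℂ) _ * toEuclideanCLM (𝕜 := ℂ) _ = 1
      rw [← map_mul, Matrix.mul_nonsing_inv _ hu, map_one])
    (by
      rw [compression_mulOp_eq]
      change toEuclideanCLM (𝕜 := ℂ) _ * toEuclideanCLM (𝕜 := ℂ) _ = 1
      rw [← map_mul, Matrix.nonsing_inv_mul _ hu, map_one])
    (by simpa using norm_inv_toeplitz_le hbi hc n)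
    ((norm_mulOp_le _).trans (norm_cpx_le hb0.le hcib))
    ((norm_mulOp_le _).trans (norm_cpx_le hb0.le hd))
    (by
      rw [← mulOp_mul]
      refine (norm_mulOp_le _).trans ((ContinuousMap.norm_le _ hb0.le).2 fun x => ?_)
      have h1 : (cpx ci * cpx d) x = ((d x / c x : ℝ) : ℂ) := by
        simp [ci, div_eq_mul_inv, mul_comm]
      rw [h1, Complex.norm_real]
      exact hdc x) hcκ hdκ m 1
  have e1 : opTrace ((1 : EuclideanSpace ℂ (Fin n) →L[ℂ] EuclideanSpace ℂ (Fin n)) ∘L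
      ((toEuclideanCLM (𝕜 := ℂ) (toeplitz n (cpx c))⁻¹ ∘L
        ((charEmbed T n).adjoint ∘L mulOp (cpx d) ∘L charEmbed T n)) ^ m))
      = (((toeplitz n (cpx c))⁻¹ * toeplitz n (cpx d)) ^ m).trace := by
    rw [compression_mulOp_eq, ← opTrace_toEuclideanCLM, map_pow, map_mul]
    rfl
  have e2 : opTrace ((1 : EuclideanSpace ℂ (Fin n) →L[ℂ] EuclideanSpace ℂ (Fin n)) ∘L
      ((charEmbed T n).adjoint ∘L ((mulOp (cpx ci) ∘L mulOp (cpx d)) ^ m) ∘L charEmbed T n))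
      = ((n * ∫ x, (d x / c x) ^ m ∂haarAddCircle : ℝ) : ℂ) := by
    rw [← mulOp_mul, mulOp_pow, compression_mulOp_eq]
    change opTrace (toEuclideanCLM (𝕜 := ℂ) _) = _
    rw [opTrace_toEuclideanCLM, trace_toeplitz]
    push_cast
    rw [← integral_complex_ofReal]
    congr 2
    funext x
    simp [ci, div_eq_mul_inv, mul_comm]
  rw [e1, e2] at key
  refine key.trans ?_
  calc _ ≤ traceConst b κ m * 1 := mul_le_mul_of_nonneg_left ContinuousLinearMap.norm_id_le
        (traceConst_nonneg hb0.le ((hsNorm_nonneg _).trans hcκ) m)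
    _ = _ := mul_one _

end ToeplitzTrace

/-! ### The symbol of the sampled autocovariance -/

section Symbol

open AddCircle

/-- The Poisson kernel `(1 - ρ²) / (1 - 2 ρ cos β + ρ²)`. -/
noncomputable def poissonK (ρ β : ℝ) : ℝ := (1 - ρ ^ 2) / (1 - 2 * ρ * Real.cos β + ρ ^ 2)

lemma poissonK_denom_ge {ρ : ℝ} (h0 : 0 ≤ ρ) (β : ℝ) :
    (1 - ρ) ^ 2 ≤ 1 - 2 * ρ * Real.cos β + ρ ^ 2 := by
  nlinarith [Real.cos_le_one β]

lemma poissonK_nonneg {ρ : ℝ} (h0 : 0 ≤ ρ) (h1 : ρ < 1) (β : ℝ) : 0 ≤ poissonK ρ β :=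
  div_nonneg (by nlinarith) ((sq_nonneg _).trans (poissonK_denom_ge h0 β))

lemma poissonK_le {ρ : ℝ} (h0 : 0 ≤ ρ) (h1 : ρ < 1) (β : ℝ) : poissonK ρ β ≤ 2 / (1 - ρ) := by
  have h2 : 0 < 1 - ρ := by linarith
  calc poissonK ρ β ≤ (1 - ρ ^ 2) / (1 - ρ) ^ 2 :=
        div_le_div_of_nonneg_left (by nlinarith) (by positivity) (poissonK_denom_ge h0 β)
    _ = (1 + ρ) / (1 - ρ) := by field_simp; ring
    _ ≤ 2 / (1 - ρ) := by gcongr; linarith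

/-- The Fourier expansion of the Poisson kernel. -/
lemma hasSum_poissonK {ρ : ℝ} (h0 : 0 ≤ ρ) (h1 : ρ < 1) (β : ℝ) :
    HasSum (fun k : ℤ => (ρ : ℂ) ^ k.natAbs * Complex.exp (Complex.I * k * β))
      (poissonK ρ β : ℂ) := by
  set w : ℂ := ρ * Complex.exp (Complex.I * β) with hw
  set v : ℂ := ρ * Complex.exp (-(Complex.I * β)) with hv
  have hwn : ‖w‖ < 1 := by
    rw [hw, norm_mul, mul_comm Complex.I, Complex.norm_exp_ofReal_mul_I, Complex.norm_real,
      Real.norm_of_nonneg h0, mul_one]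
    exact h1
  have hvn : ‖v‖ < 1 := by
    have : -(Complex.I * (β : ℂ)) = ((-β : ℝ) : ℂ) * Complex.I := by push_cast; ring
    rw [hv, this, norm_mul, Complex.norm_exp_ofReal_mul_I, Complex.norm_real,
      Real.norm_of_nonneg h0, mul_one]
    exact h1
  have hwv : w * v = (ρ : ℂ) ^ 2 := by
    have : Complex.exp (Complex.I * β) * Complex.exp (-(Complex.I * β)) = 1 := by
      rw [← Complex.exp_add, add_neg_cancel, Complex.exp_zero]
    calc w * v = (ρ : ℂ) ^ 2 * (Complex.exp (Complex.I * β) * Complex.exp (-(Complex.I * β))) := by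
          rw [hw, hv]; ring
      _ = _ := by rw [this, mul_one]
  have hwpv : w + v = 2 * ρ * Real.cos β := by
    rw [Complex.ofReal_cos, Complex.cos, hw, hv]
    ring_nf
  have hw1 : 1 - w ≠ 0 := fun h => by
    rw [← sub_eq_zero.1 h, norm_one] at hwn; exact lt_irrefl _ hwn
  have hv1 : 1 - v ≠ 0 := fun h => by
    rw [← sub_eq_zero.1 h, norm_one] at hvn; exact lt_irrefl _ hvn
  have hsum : (poissonK ρ β : ℂ) = (1 - w)⁻¹ + v * (1 - v)⁻¹ := by
    have hden : ((1 - 2 * ρ * Real.cos β + ρ ^ 2 : ℝ) : ℂ) = (1 - w) * (1 - v) := by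
      push_cast
      push_cast at hwpv
      linear_combination hwpv - hwv
    rw [poissonK, Complex.ofReal_div, hden]
    push_cast
    field_simp
    linear_combination hwv
  rw [hsum]
  apply HasSum.of_nat_of_neg_add_one
  · refine (hasSum_geometric_of_norm_lt_one hwn).congr_fun fun k => ?_
    rw [hw, mul_pow, ← Complex.exp_nat_mul]
    congr 2
    push_cast; ring
  · refine ((hasSum_geometric_of_norm_lt_one hvn).mul_left v).congr_fun fun k => ?_
    rw [← pow_succ', hv, mul_pow, ← Complex.exp_nat_mul]
    congr 2
    push_cast; ring

variable {T : ℝ} [hT : Fact (0 < T)]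

/-- The Fourier coefficients of the sum of an absolutely convergent Fourier series. -/
lemma fourierCoeff_tsum {c : ℤ → ℂ} (hc : Summable fun k => ‖c k‖) (j : ℤ) :
    fourierCoeff (∑' k, c k • fourier k : C(AddCircle T, ℂ)) j = c j := by
  have h1 : Summable fun k => c k • (fourier k : C(AddCircle T, ℂ)) := by
    refine Summable.of_norm (hc.congr fun k => ?_)
    rw [norm_smul, fourier_norm, mul_one]
  set F : C(AddCircle T, ℂ) := ∑' k, c k • fourier k
  have h2 := (h1.hasSum.mapL (ContinuousMap.toLp 2 (haarAddCircle (T := T)) ℂ)).mapL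
    (innerSL ℂ (fourierLp (T := T) 2 j))
  have h3 : ∀ k, innerSL ℂ (fourierLp (T := T) 2 j) (ContinuousMap.toLp 2
      (haarAddCircle (T := T)) ℂ (c k • fourier k)) = if k = j then c j else 0 := by
    intro k
    rw [map_smul, map_smul]
    have := orthonormal_iff_ite.1 (orthonormal_fourier (T := T)) j k
    rw [innerSL_apply_apply]
    change c k • inner ℂ (fourierLp (T := T) 2 j) (fourierLp (T := T) 2 k) = _
    rw [this]
    by_cases h : k = j
    · simp [h]
    · simp [h, Ne.symm h]
  simp_rw [h3] at h2
  have h4 := h2.unique (hasSum_ite_eq j (c j))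
  rw [innerSL_apply_apply, ← coe_fourierBasis, ← HilbertBasis.repr_apply_apply, fourierBasis_repr,
    fourierCoeff_toLp] at h4
  exact h4

lemma integral_haarAddCircle_eq (f : AddCircle T → ℝ) :
    ∫ x, f x ∂haarAddCircle = 1 / T * ∫ x in (-(T / 2))..(T / 2), f x := by
  have h := fourierCoeff_eq_intervalIntegral (T := T) (fun x => (f x : ℂ)) 0 (-(T / 2))
  have h1 : fourierCoeff (fun x : AddCircle T => (f x : ℂ)) 0
      = ((∫ x, f x ∂haarAddCircle : ℝ) : ℂ) := by
    rw [← integral_complex_ofReal]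
    simp [fourierCoeff]
  rw [h1, show -(T / 2) + T = T / 2 by ring] at h
  simp only [neg_zero, fourier_zero, one_smul] at h
  rw [intervalIntegral.integral_ofReal, Complex.real_smul] at h
  exact_mod_cast h

end Symbol

namespace SpinSensor

open AddCircle

/-- The stationary variance `g_D² Q / (2γ)` of the spin signal. -/
noncomputable def atomVar (p : SpinSensor) : ℝ := p.gD ^ 2 * (p.Q / (2 * p.γ))

lemma atomVar_nonneg (p : SpinSensor) : 0 ≤ p.atomVar := by
  have := p.Q_nonneg
  have := p.γ_pos
  unfold atomVar
  positivity

/-- The spectral density of the sampled record: the Fourier series with coefficients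
`Δ K_k`, in closed form. -/
noncomputable def sampledPSD (p : SpinSensor) (Δ ω : ℝ) : ℝ :=
  p.Sph + p.atomVar * Δ / 2 * (poissonK (Real.exp (-p.γ * Δ)) ((ω - p.ωL) * Δ)
    + poissonK (Real.exp (-p.γ * Δ)) ((ω + p.ωL) * Δ))

lemma exp_lt_one (p : SpinSensor) {Δ : ℝ} (hΔ : 0 < Δ) : Real.exp (-p.γ * Δ) < 1 := by
  have := mul_pos p.γ_pos hΔ
  rw [Real.exp_lt_one_iff]
  linarith

lemma Sph_le_sampledPSD (p : SpinSensor) {Δ : ℝ} (hΔ : 0 < Δ) (ω : ℝ) :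
    p.Sph ≤ p.sampledPSD Δ ω := by
  have h1 := poissonK_nonneg (Real.exp_pos (-p.γ * Δ)).le (p.exp_lt_one hΔ)
  have := p.atomVar_nonneg
  have h2 := h1 ((ω - p.ωL) * Δ)
  have h3 := h1 ((ω + p.ωL) * Δ)
  unfold sampledPSD
  have : 0 ≤ p.atomVar * Δ / 2 := by positivity
  nlinarith

lemma sampledPSD_sub_le (p : SpinSensor) {Δ Δ₀ : ℝ} (hΔ : 0 < Δ) (h : Δ ≤ Δ₀) (ω : ℝ) :
    p.sampledPSD Δ ω - p.Sph ≤ p.atomVar * (2 * (1 + p.γ * Δ₀) / p.γ) := by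
  have hγ := p.γ_pos
  have hA := p.atomVar_nonneg
  set ρ := Real.exp (-p.γ * Δ) with hρ
  have h1 : ρ < 1 := p.exp_lt_one hΔ
  have hx : 0 < p.γ * Δ := mul_pos hγ hΔ
  have h2 : p.γ * Δ / (1 + p.γ * Δ) ≤ 1 - ρ := by
    have h3 : ρ ≤ (1 + p.γ * Δ)⁻¹ := by
      rw [hρ, neg_mul, Real.exp_neg]
      exact inv_anti₀ (by linarith) (by linarith [Real.add_one_le_exp (p.γ * Δ)])
    have h4 : p.γ * Δ / (1 + p.γ * Δ) = 1 - (1 + p.γ * Δ)⁻¹ := by field_simp; ring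
    linarith
  have h5 : Δ * (2 / (1 - ρ)) ≤ 2 * (1 + p.γ * Δ₀) / p.γ := by
    calc Δ * (2 / (1 - ρ)) ≤ Δ * (2 / (p.γ * Δ / (1 + p.γ * Δ))) := by gcongr
      _ = 2 * (1 + p.γ * Δ) / p.γ := by field_simp
      _ ≤ _ := by gcongr
  have h6 := fun β => poissonK_le (Real.exp_pos (-p.γ * Δ)).le h1 β
  calc p.sampledPSD Δ ω - p.Sph ≤ p.atomVar * Δ / 2 * (2 / (1 - ρ) + 2 / (1 - ρ)) := by
        rw [sampledPSD, add_sub_cancel_left]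
        have := h6 ((ω - p.ωL) * Δ)
        have := h6 ((ω + p.ωL) * Δ)
        gcongr
    _ = p.atomVar * (Δ * (2 / (1 - ρ))) := by ring
    _ ≤ _ := by gcongr

lemma autocov_eq (p : SpinSensor) {Δ : ℝ} (hΔ : 0 < Δ) (k : ℤ) :
    Δ * p.autocov Δ k = p.atomVar * Δ * Real.exp (-p.γ * Δ) ^ k.natAbs * Real.cos (k * p.ωL * Δ)
      + if k = 0 then p.Sph else 0 := by
  have h : Real.exp (-p.γ * |(k : ℝ)| * Δ) = Real.exp (-p.γ * Δ) ^ k.natAbs := by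
    rw [← Real.exp_nat_mul, Nat.cast_natAbs, Int.cast_abs]
    congr 1; ring
  rw [autocov, h, atomVar]
  split_ifs
  · field_simp
  · ring

lemma hasSum_sampledPSD (p : SpinSensor) {Δ : ℝ} (hΔ : 0 < Δ) (ω : ℝ) :
    HasSum (fun k : ℤ => ((Δ * p.autocov Δ k : ℝ) : ℂ) * Complex.exp (Complex.I * k * (ω * Δ)))
      (p.sampledPSD Δ ω : ℂ) := by
  have h0 := (Real.exp_pos (-p.γ * Δ)).le
  have h1 := p.exp_lt_one hΔ
  have hs := ((hasSum_poissonK h0 h1 ((ω - p.ωL) * Δ)).add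
    (hasSum_poissonK h0 h1 ((ω + p.ωL) * Δ))).mul_left ((p.atomVar * Δ / 2 : ℝ) : ℂ)
  have hS := hasSum_ite_eq (0 : ℤ) (p.Sph : ℂ)
  have := hS.add hs
  rw [show (p.sampledPSD Δ ω : ℂ) = _ by rw [sampledPSD, Complex.ofReal_add, Complex.ofReal_mul,
    Complex.ofReal_add]]
  refine this.congr_fun fun k => ?_
  rw [p.autocov_eq hΔ]
  have hc : ((Real.cos (k * p.ωL * Δ) : ℝ) : ℂ)
      = (Complex.exp (Complex.I * (k * p.ωL * Δ)) + Complex.exp (-(Complex.I * (k * p.ωL * Δ)))) / 2 := by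
    rw [Complex.ofReal_cos, Complex.cos]
    push_cast
    ring_nf
  have he1 : Complex.exp (Complex.I * k * ((ω - p.ωL) * Δ : ℝ))
      = Complex.exp (Complex.I * k * (ω * Δ)) * Complex.exp (-(Complex.I * (k * p.ωL * Δ))) := by
    rw [← Complex.exp_add]; push_cast; ring_nf
  have he2 : Complex.exp (Complex.I * k * ((ω + p.ωL) * Δ : ℝ))
      = Complex.exp (Complex.I * k * (ω * Δ)) * Complex.exp (Complex.I * (k * p.ωL * Δ)) := by
    rw [← Complex.exp_add]; push_cast; ring_nf
  rw [he1, he2, Complex.ofReal_add, Complex.ofReal_mul, hc]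
  by_cases hk : k = 0
  · subst hk; simp; ring
  · simp only [hk, if_false]
    push_cast
    ring

lemma summable_autocov (p : SpinSensor) {Δ : ℝ} (hΔ : 0 < Δ) :
    Summable fun k : ℤ => ‖((Δ * p.autocov Δ k : ℝ) : ℂ)‖ := by
  have h0 := (Real.exp_pos (-p.γ * Δ)).le
  have h1 := p.exp_lt_one hΔ
  have hA := p.atomVar_nonneg
  have hg := (summable_geometric_of_lt_one h0 h1).mul_left (p.atomVar * Δ)
  have hb : Summable fun k : ℤ => p.atomVar * Δ * Real.exp (-p.γ * Δ) ^ k.natAbs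
      + if k = 0 then p.Sph else 0 := by
    refine Summable.add ?_ (hasSum_ite_eq (0 : ℤ) p.Sph).summable
    exact Summable.of_nat_of_neg (by simpa using hg) (by simpa using hg)
  refine Summable.of_nonneg_of_le (fun _ => norm_nonneg _) (fun k => ?_) hb
  rw [Complex.norm_real, p.autocov_eq hΔ]
  refine (norm_add_le _ _).trans (add_le_add ?_ ?_)
  · have : 0 ≤ p.atomVar * Δ * Real.exp (-p.γ * Δ) ^ k.natAbs := by positivity
    rw [norm_mul, Real.norm_of_nonneg this]
    exact mul_le_of_le_one_right this (Real.abs_cos_le_one _)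
  · split_ifs
    · rw [Real.norm_of_nonneg p.Sph_pos.le]
    · simp

variable {Δ : ℝ}

/-- The sampled spectral density as a continuous function on the circle of circumference `2π/Δ`. -/
noncomputable def symbol (p : SpinSensor) (Δ : ℝ) [Fact (0 < 2 * Real.pi / Δ)] :
    C(AddCircle (2 * Real.pi / Δ), ℝ) :=
  (⟨Complex.re, Complex.continuous_re⟩ : C(ℂ, ℝ)).comp
    (∑' k, ((Δ * p.autocov Δ k : ℝ) : ℂ) • fourier k : C(AddCircle (2 * Real.pi / Δ), ℂ))

variable [hT : Fact (0 < 2 * Real.pi / Δ)]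

lemma hasSum_fourierSeries (p : SpinSensor) (hΔ : 0 < Δ) :
    HasSum (fun k => ((Δ * p.autocov Δ k : ℝ) : ℂ) •
      (fourier k : C(AddCircle (2 * Real.pi / Δ), ℂ)))
      (∑' k, ((Δ * p.autocov Δ k : ℝ) : ℂ) • fourier k) := by
  refine Summable.hasSum (Summable.of_norm ((p.summable_autocov hΔ).congr fun k => ?_))
  rw [norm_smul, fourier_norm, mul_one]

lemma fourierSeries_coe (p : SpinSensor) (hΔ : 0 < Δ) (ω : ℝ) :
    (∑' k, ((Δ * p.autocov Δ k : ℝ) : ℂ) • fourier k : C(AddCircle (2 * Real.pi / Δ), ℂ)) ω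
      = (p.sampledPSD Δ ω : ℂ) := by
  have h := (p.hasSum_fourierSeries hΔ).mapL
    (ContinuousMap.evalCLM ℂ (ω : AddCircle (2 * Real.pi / Δ)))
  refine h.unique ((p.hasSum_sampledPSD hΔ ω).congr_fun fun k => ?_)
  simp only [map_smul, ContinuousMap.evalCLM_apply, fourier_coe_apply, smul_eq_mul]
  congr 2
  have : (Δ : ℂ) ≠ 0 := by exact_mod_cast hΔ.ne'
  have : (Real.pi : ℂ) ≠ 0 := by exact_mod_cast Real.pi_ne_zero
  push_cast
  field_simp

lemma symbol_coe (p : SpinSensor) (hΔ : 0 < Δ) (ω : ℝ) :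
    p.symbol Δ (ω : AddCircle (2 * Real.pi / Δ)) = p.sampledPSD Δ ω := by
  have := p.fourierSeries_coe hΔ ω
  change Complex.re _ = _
  rw [this, Complex.ofReal_re]

lemma cpx_symbol (p : SpinSensor) (hΔ : 0 < Δ) :
    cpx (p.symbol Δ) = ∑' k, ((Δ * p.autocov Δ k : ℝ) : ℂ) • fourier k := by
  ext x
  obtain ⟨ω, rfl⟩ := QuotientAddGroup.mk_surjective x
  rw [cpx_apply]
  exact (congrArg _ (p.symbol_coe hΔ ω)).trans (p.fourierSeries_coe hΔ ω).symm

lemma fourierCoeff_symbol (p : SpinSensor) (hΔ : 0 < Δ) (k : ℤ) :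
    fourierCoeff (cpx (p.symbol Δ)) k = ((Δ * p.autocov Δ k : ℝ) : ℂ) := by
  rw [p.cpx_symbol hΔ, fourierCoeff_tsum (p.summable_autocov hΔ)]

/-- The Toeplitz matrix of the symbol is the covariance matrix, multiplied by `Δ`. -/
lemma toeplitz_symbol (p : SpinSensor) (hΔ : 0 < Δ) (n : ℕ) :
    toeplitz n (cpx (p.symbol Δ)) = (Δ • p.cov Δ n).map Complex.ofReal := by
  ext i j
  simp [toeplitz, p.fourierCoeff_symbol hΔ, cov]

/-- The off-diagonal blocks are bounded independently of the number of samples and of the sampling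
period: the factor `Δ` in the coefficients compensates the slow geometric decay for small `Δ`. -/
lemma hsNorm_symbol_le (p : SpinSensor) (hΔ : 0 < Δ) (n : ℕ) :
    hsNorm (coproj (charEmbed (2 * Real.pi / Δ) n) ∘L mulOp (cpx (p.symbol Δ)) ∘L
      charEmbed (2 * Real.pi / Δ) n) ≤ p.atomVar / p.γ := by
  have hγ := p.γ_pos
  have hA := p.atomVar_nonneg
  set x := p.γ * Δ with hx
  have hx0 : 0 < x := mul_pos hγ hΔ
  set ρ := Real.exp (-p.γ * Δ) with hρ
  have hρx : ρ = Real.exp (-x) := by rw [hρ, hx, neg_mul]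
  have hρ0 : 0 < ρ := Real.exp_pos _
  have hρ1 : ρ < 1 := p.exp_lt_one hΔ
  have hq1 : ρ ^ 2 < 1 := by nlinarith
  have h1 := sq_hsNorm_mulOp_le (M := p.atomVar * Δ) (sq_nonneg ρ) hq1 n
    (f := cpx (p.symbol Δ)) (fun d hd => by
      rw [p.fourierCoeff_symbol hΔ, Complex.norm_real, p.autocov_eq hΔ, if_neg hd, add_zero,
        norm_mul, mul_pow, Real.norm_of_nonneg (by positivity), mul_pow, ← pow_mul, ← pow_mul,
        mul_comm 2]
      refine mul_le_of_le_one_right (by positivity) ?_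
      rw [Real.norm_eq_abs, sq_abs]
      exact Real.cos_sq_le_one _)
  -- `2 x ≤ 2 sinh x` bounds the geometric sum by `1 / (4 x²)`
  have h2 : ρ ^ 2 / (1 - ρ ^ 2) ^ 2 ≤ 1 / (4 * x ^ 2) := by
    rw [div_le_div_iff₀ (by nlinarith) (by positivity)]
    have h3 := Real.self_le_sinh_iff.2 hx0.le
    rw [Real.sinh_eq] at h3
    have h4 : ρ * Real.exp x = 1 := by rw [hρx, ← Real.exp_add]; simp
    rw [← hρx] at h3
    have h5 : 2 * x * ρ ≤ 1 - ρ ^ 2 := by nlinarith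
    have h6 : (2 * x * ρ) ^ 2 ≤ (1 - ρ ^ 2) ^ 2 := pow_le_pow_left₀ (by positivity) h5 2
    nlinarith
  refine (sq_le_sq₀ (hsNorm_nonneg _) (by positivity)).1 (h1.trans ?_)
  calc 2 * (p.atomVar * Δ) ^ 2 * (ρ ^ 2 / (1 - ρ ^ 2) ^ 2)
      ≤ 2 * (p.atomVar * Δ) ^ 2 * (1 / (4 * x ^ 2)) := by gcongr
    _ = (p.atomVar / p.γ) ^ 2 / 2 := by rw [hx]; field_simp; ring
    _ ≤ (p.atomVar / p.γ) ^ 2 := half_le_self (sq_nonneg _)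

end SpinSensor

/-! ### Covariance matrices as Toeplitz matrices -/

section Uniform

open AddCircle

variable {T : ℝ} [hT : Fact (0 < T)]

lemma hsNorm_smul {ι H : Type*} [Fintype ι] [NormedAddCommGroup H] [InnerProductSpace ℂ H] (a : ℂ)
    (U : EuclideanSpace ℂ ι →L[ℂ] H) : hsNorm (a • U) = ‖a‖ * hsNorm U := by
  simp only [hsNorm, _root_.smul_apply, norm_smul, mul_pow, ← Finset.mul_sum]
  rw [Real.sqrt_mul (sq_nonneg _), Real.sqrt_sq (norm_nonneg _)]

lemma mulOp_cpx_comb (a b : ℝ) (f g : C(AddCircle T, ℝ)) :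
    mulOp (cpx (a • f + b • g)) = (a : ℂ) • mulOp (cpx f) + (b : ℂ) • mulOp (cpx g) := by
  have h : cpx (a • f + b • g) = (a : ℂ) • cpx f + (b : ℂ) • cpx g := by
    ext x
    simp
  rw [h, mulOp, map_add, map_add, map_smul, map_smul, map_smul, map_smul]
  rfl

lemma hsNorm_comb_le (n : ℕ) (a b : ℝ) (f g : C(AddCircle T, ℝ)) {u v : ℝ}
    (hf : hsNorm (coproj (charEmbed T n) ∘L mulOp (cpx f) ∘L charEmbed T n) ≤ u)
    (hg : hsNorm (coproj (charEmbed T n) ∘L mulOp (cpx g) ∘L charEmbed T n) ≤ v)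
    (ha : |a| ≤ 1) (hb : |b| ≤ 1) :
    hsNorm (coproj (charEmbed T n) ∘L mulOp (cpx (a • f + b • g)) ∘L charEmbed T n) ≤ u + v := by
  have h : coproj (charEmbed T n) ∘L mulOp (cpx (a • f + b • g)) ∘L charEmbed T n
      = (a : ℂ) • (coproj (charEmbed T n) ∘L mulOp (cpx f) ∘L charEmbed T n)
        + (b : ℂ) • (coproj (charEmbed T n) ∘L mulOp (cpx g) ∘L charEmbed T n) := by
    ext1 x
    simp only [mulOp_cpx_comb, ContinuousLinearMap.comp_apply, _root_.add_apply,
      _root_.smul_apply, map_add, map_smul]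
  rw [h]
  refine (hsNorm_add_le _ _).trans (add_le_add ?_ ?_)
  · rw [hsNorm_smul, Complex.norm_real]
    exact (mul_le_of_le_one_left (hsNorm_nonneg _) ha).trans hf
  · rw [hsNorm_smul, Complex.norm_real]
    exact (mul_le_of_le_one_left (hsNorm_nonneg _) hb).trans hg

lemma toeplitz_comb (n : ℕ) (a b : ℝ) (f g : C(AddCircle T, ℝ)) :
    toeplitz n (cpx (a • f + b • g)) = (a : ℂ) • toeplitz n (cpx f) + (b : ℂ) • toeplitz n (cpx g) := by
  ext i j
  simp only [toeplitz, Matrix.of_apply, Matrix.add_apply, Matrix.smul_apply]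
  rw [← inner_fourierLp_mulOp, ← inner_fourierLp_mulOp, ← inner_fourierLp_mulOp, mulOp_cpx_comb]
  simp only [_root_.add_apply, _root_.smul_apply, inner_add_right, inner_smul_right, smul_eq_mul]

/-- A real symmetric matrix that is Toeplitz with a positive symbol is positive definite. -/
lemma posDef_of_toeplitz {n : ℕ} {A : Matrix (Fin n) (Fin n) ℝ} (hA : A.IsSymm)
    {f : C(AddCircle T, ℝ)} {s : ℝ} (hs : 0 < s) (hf : ∀ x, s ≤ f x)
    (hAf : toeplitz n (cpx f) = A.map Complex.ofReal) : A.PosDef := by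
  refine Matrix.PosDef.of_dotProduct_mulVec_pos (by simpa using hA) fun x hx => ?_
  let z : EuclideanSpace ℂ (Fin n) := WithLp.toLp 2 fun i => (x i : ℂ)
  have h1 := le_re_inner_mulOp hf (charEmbed T n z)
  have h2 : inner ℂ (charEmbed T n z) (mulOp (cpx f) (charEmbed T n z))
      = ((star x ⬝ᵥ A *ᵥ x : ℝ) : ℂ) := by
    have e1 : inner ℂ (charEmbed T n z) (mulOp (cpx f) (charEmbed T n z))
        = inner ℂ z (toEuclideanCLM (𝕜 := ℂ) (toeplitz n (cpx f)) z) := by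
      rw [← compression_mulOp_eq, ContinuousLinearMap.comp_apply, ContinuousLinearMap.comp_apply,
        ContinuousLinearMap.adjoint_inner_right]
    rw [e1, hAf, toEuclideanCLM_toLp, EuclideanSpace.inner_eq_star_dotProduct]
    simp only [z, dotProduct, Matrix.mulVec, Matrix.map_apply, Pi.star_apply]
    push_cast
    simp [mul_comm]
  rw [h2, Complex.ofReal_re, norm_charEmbed] at h1
  refine lt_of_lt_of_le ?_ h1
  have h3 : z ≠ 0 := fun h => hx (by
    funext i
    have := congrArg (fun y : EuclideanSpace ℂ (Fin n) => y i) h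
    simpa [z] using this)
  have := norm_pos_iff.2 h3
  positivity

lemma trace_map_ofReal_inv_mul_pow {n : ℕ} {A B : Matrix (Fin n) (Fin n) ℝ} (hA : IsUnit A.det)
    (m : ℕ) : (((A.map Complex.ofReal)⁻¹ * B.map Complex.ofReal) ^ m).trace
      = (((A⁻¹ * B) ^ m).trace : ℂ) := by
  let φ : Matrix (Fin n) (Fin n) ℝ →+* Matrix (Fin n) (Fin n) ℂ := Complex.ofRealHom.mapMatrix
  have h1 : (φ A)⁻¹ = φ A⁻¹ :=
    Matrix.inv_eq_right_inv (by rw [← map_mul, Matrix.mul_nonsing_inv _ hA, map_one])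
  change (((φ A)⁻¹ * φ B) ^ m).trace = _
  rw [h1, ← map_mul, ← map_pow]
  exact (AddMonoidHom.map_trace Complex.ofRealHom.toAddMonoidHom _).symm

end Uniform

namespace SpinSensor

open AddCircle

lemma autocov_neg (p : SpinSensor) (Δ : ℝ) (k : ℤ) : p.autocov Δ (-k) = p.autocov Δ k := by
  simp [autocov]

lemma cov_isSymm (p : SpinSensor) (Δ : ℝ) (n : ℕ) : (p.cov Δ n).IsSymm := by
  ext i j
  simp only [cov, Matrix.transpose_apply, Matrix.of_apply]
  rw [← autocov_neg, neg_sub]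

lemma fact_period {Δ : ℝ} (hΔ : 0 < Δ) : Fact (0 < 2 * Real.pi / Δ) :=
  ⟨by positivity⟩

/-- The mean over one period `2π/Δ` of a function of the frequency. -/
noncomputable def periodMean (Δ : ℝ) (F : ℝ → ℝ) : ℝ :=
  Δ / (2 * Real.pi) * ∫ ω in (-(Real.pi / Δ))..(Real.pi / Δ), F ω

/-- Interpolation between the sampled spectral densities of two sensors. -/
noncomputable def mixPSD (p q : SpinSensor) (Δ s ω : ℝ) : ℝ :=
  s * p.sampledPSD Δ ω + (1 - s) * q.sampledPSD Δ ω

/-- Interpolation between the covariance matrices of two sensors. -/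
noncomputable def mixCov (p q : SpinSensor) (Δ : ℝ) (n : ℕ) (s : ℝ) : Matrix (Fin n) (Fin n) ℝ :=
  s • p.cov Δ n + (1 - s) • q.cov Δ n

lemma min_Sph_le_mixPSD (p q : SpinSensor) {Δ s : ℝ} (hΔ : 0 < Δ) (hs : s ∈ Set.Icc (0 : ℝ) 1)
    (ω : ℝ) : min p.Sph q.Sph ≤ mixPSD p q Δ s ω := by
  have h1 := (min_le_left p.Sph q.Sph).trans (p.Sph_le_sampledPSD hΔ ω)
  have h2 := (min_le_right p.Sph q.Sph).trans (q.Sph_le_sampledPSD hΔ ω)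
  have h3 : 0 ≤ 1 - s := by linarith [hs.2]
  have := mul_le_mul_of_nonneg_left h1 hs.1
  have := mul_le_mul_of_nonneg_left h2 h3
  unfold mixPSD
  linarith

lemma min_Sph_pos (p q : SpinSensor) : 0 < min p.Sph q.Sph := lt_min p.Sph_pos q.Sph_pos

lemma mixPSD_pos (p q : SpinSensor) {Δ s : ℝ} (hΔ : 0 < Δ) (hs : s ∈ Set.Icc (0 : ℝ) 1)
    (ω : ℝ) : 0 < mixPSD p q Δ s ω :=
  (min_Sph_pos p q).trans_le (min_Sph_le_mixPSD p q hΔ hs ω)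

lemma symbol_comb_coe {Δ : ℝ} [Fact (0 < 2 * Real.pi / Δ)] (p q : SpinSensor) (hΔ : 0 < Δ)
    (a b ω : ℝ) : (a • p.symbol Δ + b • q.symbol Δ) (ω : AddCircle (2 * Real.pi / Δ))
      = a * p.sampledPSD Δ ω + b * q.sampledPSD Δ ω := by
  rw [ContinuousMap.add_apply, ContinuousMap.smul_apply, ContinuousMap.smul_apply,
    p.symbol_coe hΔ, q.symbol_coe hΔ]
  rfl

lemma toeplitz_symbol_comb {Δ : ℝ} [Fact (0 < 2 * Real.pi / Δ)] (p q : SpinSensor) (hΔ : 0 < Δ)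
    (n : ℕ) (a b : ℝ) : toeplitz n (cpx (a • p.symbol Δ + b • q.symbol Δ))
      = (Δ • (a • p.cov Δ n + b • q.cov Δ n)).map Complex.ofReal := by
  rw [toeplitz_comb, p.toeplitz_symbol hΔ, q.toeplitz_symbol hΔ]
  ext i j
  simp
  ring

lemma mixCov_isSymm (p q : SpinSensor) (Δ : ℝ) (n : ℕ) (s : ℝ) : (mixCov p q Δ n s).IsSymm := by
  rw [Matrix.IsSymm, mixCov, Matrix.transpose_add, Matrix.transpose_smul, Matrix.transpose_smul,
    (p.cov_isSymm Δ n).eq, (q.cov_isSymm Δ n).eq]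

lemma mixCov_posDef (p q : SpinSensor) {Δ s : ℝ} (hΔ : 0 < Δ) (hs : s ∈ Set.Icc (0 : ℝ) 1)
    (n : ℕ) : (mixCov p q Δ n s).PosDef := by
  have := fact_period hΔ
  have h1 : (Δ • mixCov p q Δ n s).PosDef := by
    refine posDef_of_toeplitz (f := s • p.symbol Δ + (1 - s) • q.symbol Δ) ?_ (min_Sph_pos p q)
      (fun x => ?_) (toeplitz_symbol_comb p q hΔ n s (1 - s))
    · rw [Matrix.IsSymm, Matrix.transpose_smul, (mixCov_isSymm p q Δ n s).eq]
    · obtain ⟨ω, rfl⟩ := QuotientAddGroup.mk_surjective x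
      refine (min_Sph_le_mixPSD p q hΔ hs ω).trans_eq ?_
      exact (symbol_comb_coe p q hΔ s (1 - s) ω).symm
  have h2 := h1.smul (inv_pos.2 hΔ)
  rwa [smul_smul, inv_mul_cancel₀ hΔ.ne', one_smul] at h2

lemma cov_posDef (p : SpinSensor) {Δ : ℝ} (hΔ : 0 < Δ) (n : ℕ) : (p.cov Δ n).PosDef := by
  have := mixCov_posDef p p hΔ ⟨zero_le_one, le_rfl⟩ n
  simpa [mixCov] using this

/-- The traces of powers of `T_s⁻¹ (T_p - T_q)`, with `T_s` between `T_p` and `T_q`, are linear in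
the number of samples up to an error that is uniform in the number of samples, in `s`, and in
bounded sampling periods. -/
theorem exists_trace_bound (p q : SpinSensor) (Δ₀ : ℝ) : ∃ C : ℕ → ℝ, ∀ Δ : ℝ, 0 < Δ → Δ ≤ Δ₀ →
    ∀ s ∈ Set.Icc (0 : ℝ) 1, ∀ n m : ℕ,
      |(((mixCov p q Δ n s)⁻¹ * (p.cov Δ n - q.cov Δ n)) ^ m).trace
        - n * periodMean Δ (fun ω =>
          ((p.sampledPSD Δ ω - q.sampledPSD Δ ω) / mixPSD p q Δ s ω) ^ m)| ≤ C m := by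
  set S := min p.Sph q.Sph with hS
  have hSpos : 0 < S := min_Sph_pos p q
  set D := |p.Sph + p.atomVar * (2 * (1 + p.γ * Δ₀) / p.γ)|
    + |q.Sph + q.atomVar * (2 * (1 + q.γ * Δ₀) / q.γ)| with hD
  have hD0 : 0 ≤ D := by positivity
  set b := 1 + D + D / S + S⁻¹ with hb
  have hb1 : 1 ≤ b := by
    have : 0 ≤ D / S := by positivity
    have : 0 ≤ S⁻¹ := by positivity
    linarith
  refine ⟨traceConst b (p.atomVar / p.γ + q.atomVar / q.γ), fun Δ hΔ hΔ₀ s hs n m => ?_⟩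
  have := fact_period hΔ
  let c := s • p.symbol Δ + (1 - s) • q.symbol Δ
  let d := (1 : ℝ) • p.symbol Δ + (-1 : ℝ) • q.symbol Δ
  have hc : ∀ ω : ℝ, c (ω : AddCircle (2 * Real.pi / Δ)) = mixPSD p q Δ s ω := fun ω =>
    symbol_comb_coe p q hΔ s (1 - s) ω
  have hd : ∀ ω : ℝ, d (ω : AddCircle (2 * Real.pi / Δ))
      = p.sampledPSD Δ ω - q.sampledPSD Δ ω := fun ω => by
    rw [symbol_comb_coe p q hΔ]; ring
  have hcS : ∀ x, S ≤ c x := fun x => by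
    obtain ⟨ω, rfl⟩ := QuotientAddGroup.mk_surjective x
    exact (min_Sph_le_mixPSD p q hΔ hs ω).trans_eq (hc ω).symm
  have hdD : ∀ x, |d x| ≤ D := fun x => by
    obtain ⟨ω, rfl⟩ := QuotientAddGroup.mk_surjective x
    rw [show d (QuotientAddGroup.mk ω) = _ from hd ω]
    have h1 := p.sampledPSD_sub_le hΔ hΔ₀ ω
    have h2 := q.sampledPSD_sub_le hΔ hΔ₀ ω
    have h3 := p.Sph_le_sampledPSD hΔ ω
    have h4 := q.Sph_le_sampledPSD hΔ ω
    have h5 := p.Sph_pos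
    have h6 := q.Sph_pos
    have h7 := le_abs_self (p.Sph + p.atomVar * (2 * (1 + p.γ * Δ₀) / p.γ))
    have h8 := le_abs_self (q.Sph + q.atomVar * (2 * (1 + q.γ * Δ₀) / q.γ))
    rw [abs_le]
    constructor <;> linarith
  have hbS : b⁻¹ ≤ S := by
    refine inv_le_of_inv_le₀ hSpos ?_
    have : 0 ≤ D / S := by positivity
    linarith
  have hdc : ∀ x, |d x / c x| ≤ b := fun x => by
    have hcx : 0 < c x := hSpos.trans_le (hcS x)
    rw [abs_div, abs_of_pos hcx]
    have h1 : |d x| / c x ≤ D / S := div_le_div₀ hD0 (hdD x) hSpos (hcS x)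
    have : 0 ≤ S⁻¹ := by positivity
    linarith
  have hdb : ∀ x, |d x| ≤ b := fun x => (hdD x).trans (by
    have : 0 ≤ S⁻¹ := by positivity
    have : 0 ≤ D / S := by positivity
    linarith)
  have key := norm_trace_toeplitz_pow_sub_le (c := c) (d := d) hb1 (fun x => hbS.trans (hcS x))
    hdb hdc n
    (hsNorm_comb_le n s (1 - s) _ _ (p.hsNorm_symbol_le hΔ n) (q.hsNorm_symbol_le hΔ n)
      (abs_le.2 ⟨by linarith [hs.1], hs.2⟩) (abs_le.2 ⟨by linarith [hs.2], by linarith [hs.1]⟩))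
    (hsNorm_comb_le n 1 (-1) _ _ (p.hsNorm_symbol_le hΔ n) (q.hsNorm_symbol_le hΔ n)
      (by simp) (by simp)) m
  have hu : IsUnit (mixCov p q Δ n s).det := (mixCov_posDef p q hΔ hs n).isUnit.map Matrix.detMonoidHom
  have hu' : IsUnit (Δ • mixCov p q Δ n s).det := by
    rw [Matrix.det_smul]
    exact (isUnit_iff_ne_zero.2 (pow_ne_zero _ hΔ.ne')).mul hu
  have e1 : toeplitz n (cpx c) = (Δ • mixCov p q Δ n s).map Complex.ofReal :=
    toeplitz_symbol_comb p q hΔ n s (1 - s)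
  have e2 : toeplitz n (cpx d) = (Δ • (p.cov Δ n - q.cov Δ n)).map Complex.ofReal := by
    rw [toeplitz_symbol_comb p q hΔ]
    congr 2
    simp [sub_eq_add_neg]
  have e3 : (Δ • mixCov p q Δ n s)⁻¹ * (Δ • (p.cov Δ n - q.cov Δ n))
      = (mixCov p q Δ n s)⁻¹ * (p.cov Δ n - q.cov Δ n) := by
    have : (Δ • mixCov p q Δ n s)⁻¹ = Δ⁻¹ • (mixCov p q Δ n s)⁻¹ := by
      refine Matrix.inv_eq_right_inv ?_
      rw [smul_mul_smul_comm, mul_inv_cancel₀ hΔ.ne', Matrix.mul_nonsing_inv _ hu, one_smul]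
    rw [this, smul_mul_smul_comm, inv_mul_cancel₀ hΔ.ne', one_smul]
  have e4 : ∫ x, (d x / c x) ^ m ∂haarAddCircle = periodMean Δ (fun ω =>
      ((p.sampledPSD Δ ω - q.sampledPSD Δ ω) / mixPSD p q Δ s ω) ^ m) := by
    rw [integral_haarAddCircle_eq, periodMean]
    have h1 : 2 * Real.pi / Δ / 2 = Real.pi / Δ := by ring
    simp_rw [hc, hd]
    rw [h1]
    congr 1
    field_simp
  rw [e1, e2, trace_map_ofReal_inv_mul_pow hu', e3, e4, ← Complex.ofReal_sub, Complex.norm_real]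
    at key
  exact key

end SpinSensor

/-! ### The logarithm of the determinant -/

/-- Jacobi's formula at an invertible matrix. -/
lemma hasDerivAt_det_add_smul {n : ℕ} {A B : Matrix (Fin n) (Fin n) ℝ} (hA : IsUnit A.det) :
    HasDerivAt (fun s : ℝ => (A + s • B).det) (A.det * (A⁻¹ * B).trace) 0 := by
  have h1 : ∀ s : ℝ, (A + s • B).det = A.det * (1 + (A⁻¹ * B).trace * s
      + ((1 + (Polynomial.X : Polynomial ℝ) • (A⁻¹ * B).map Polynomial.C).det.divX.divX.eval s)
        * s ^ 2) := by
    intro s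
    rw [← Matrix.det_one_add_smul, ← Matrix.det_mul, mul_add, mul_one, Matrix.mul_smul,
      ← mul_assoc, Matrix.mul_nonsing_inv _ hA, one_mul]
  simp_rw [h1]
  set P := (1 + (Polynomial.X : Polynomial ℝ) • (A⁻¹ * B).map Polynomial.C).det.divX.divX
  have h2 := (((hasDerivAt_id (0 : ℝ)).const_mul (A⁻¹ * B).trace).const_add 1).add
    ((P.hasDerivAt 0).mul ((hasDerivAt_id (0 : ℝ)).pow 2))
  have h3 := h2.const_mul A.det
  convert! h3 using 1
  simp

namespace SpinSensor

lemma continuous_sampledPSD (p : SpinSensor) {Δ : ℝ} (hΔ : 0 < Δ) :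
    Continuous (p.sampledPSD Δ) := by
  have h0 := (Real.exp_pos (-p.γ * Δ)).le
  have h1 := p.exp_lt_one hΔ
  have h2 : Continuous (poissonK (Real.exp (-p.γ * Δ))) := by
    unfold poissonK
    refine Continuous.div (by fun_prop) (by fun_prop) fun β => ?_
    refine (lt_of_lt_of_le ?_ (poissonK_denom_ge h0 β)).ne'
    have : 0 < 1 - Real.exp (-p.γ * Δ) := by linarith
    positivity
  unfold sampledPSD
  fun_prop

lemma exists_abs_sampledPSD_sub_le (p q : SpinSensor) {Δ : ℝ} (hΔ : 0 < Δ) :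
    ∃ D : ℝ, ∀ ω, |p.sampledPSD Δ ω - q.sampledPSD Δ ω| ≤ D := by
  refine ⟨|p.Sph - q.Sph| + p.atomVar * (2 * (1 + p.γ * Δ) / p.γ)
    + q.atomVar * (2 * (1 + q.γ * Δ) / q.γ), fun ω => ?_⟩
  have h1 := p.sampledPSD_sub_le hΔ le_rfl ω
  have h2 := q.sampledPSD_sub_le hΔ le_rfl ω
  have h3 := p.Sph_le_sampledPSD hΔ ω
  have h4 := q.Sph_le_sampledPSD hΔ ω
  have h5 := le_abs_self (p.Sph - q.Sph)
  have h6 := neg_abs_le (p.Sph - q.Sph)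
  rw [abs_le]
  constructor <;> linarith

lemma hasDerivAt_log_det_mixCov (p q : SpinSensor) {Δ s : ℝ} (hΔ : 0 < Δ)
    (hs : s ∈ Set.Icc (0 : ℝ) 1) (n : ℕ) :
    HasDerivAt (fun s => Real.log (mixCov p q Δ n s).det)
      ((mixCov p q Δ n s)⁻¹ * (p.cov Δ n - q.cov Δ n)).trace s := by
  have hpos := (mixCov_posDef p q hΔ hs n).det_pos
  have h1 := hasDerivAt_det_add_smul (B := p.cov Δ n - q.cov Δ n)
    (isUnit_iff_ne_zero.2 hpos.ne')
  rw [← sub_self s] at h1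
  have h2 := (h1.comp_sub_const s s)
  have h3 : (fun t => (mixCov p q Δ n s + (t - s) • (p.cov Δ n - q.cov Δ n)).det)
      = fun t => (mixCov p q Δ n t).det := by
    funext t
    congr 1
    simp only [mixCov]
    module
  rw [h3] at h2
  have h4 := h2.log hpos.ne'
  rwa [mul_div_assoc, mul_comm, div_mul_cancel₀ _ hpos.ne'] at h4

lemma hasDerivAt_periodMean_log (p q : SpinSensor) {Δ s : ℝ} (hΔ : 0 < Δ)
    (hs : s ∈ Set.Icc (0 : ℝ) 1) :
    HasDerivAt (fun s => periodMean Δ fun ω => Real.log (mixPSD p q Δ s ω))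
      (periodMean Δ fun ω => (p.sampledPSD Δ ω - q.sampledPSD Δ ω) / mixPSD p q Δ s ω) s := by
  obtain ⟨D, hD⟩ := exists_abs_sampledPSD_sub_le p q hΔ
  have hD0 : 0 ≤ D := (abs_nonneg _).trans (hD 0)
  set S := min p.Sph q.Sph with hS
  have hSpos : 0 < S := min_Sph_pos p q
  have hcp := p.continuous_sampledPSD hΔ
  have hcq := q.continuous_sampledPSD hΔ
  have hε : 0 < S / (2 * (D + 1)) := by positivity
  -- close to `s` the interpolated densities are still bounded below by `S / 2`
  have hlow : ∀ t ∈ Metric.ball s (S / (2 * (D + 1))), ∀ ω, S / 2 ≤ mixPSD p q Δ t ω := by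
    intro t ht ω
    have h1 : mixPSD p q Δ t ω = mixPSD p q Δ s ω
        + (t - s) * (p.sampledPSD Δ ω - q.sampledPSD Δ ω) := by simp only [mixPSD]; ring
    have h2 : |(t - s) * (p.sampledPSD Δ ω - q.sampledPSD Δ ω)| ≤ S / (2 * (D + 1)) * D := by
      rw [abs_mul]
      exact mul_le_mul (Metric.mem_ball.1 ht).le (hD ω) (abs_nonneg _) hε.le
    have h3 : S / (2 * (D + 1)) * D ≤ S / 2 := by
      rw [div_mul_eq_mul_div, div_le_div_iff₀ (by positivity) (by positivity)]
      nlinarith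
    have h4 := min_Sph_le_mixPSD p q hΔ hs ω
    have h5 := neg_abs_le ((t - s) * (p.sampledPSD Δ ω - q.sampledPSD Δ ω))
    rw [h1]
    linarith
  have hcm : ∀ t, Continuous (mixPSD p q Δ t) := fun t => by unfold mixPSD; fun_prop
  have hclog : ∀ t ∈ Metric.ball s (S / (2 * (D + 1))),
      Continuous fun ω => Real.log (mixPSD p q Δ t ω) := fun t ht =>
    (hcm t).log fun ω => by have := hlow t ht ω; linarith
  have hcF : Continuous fun ω => (p.sampledPSD Δ ω - q.sampledPSD Δ ω) / mixPSD p q Δ s ω :=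
    (hcp.sub hcq).div (hcm s) fun ω => (mixPSD_pos p q hΔ hs ω).ne'
  have hball := Metric.ball_mem_nhds s hε
  refine HasDerivAt.const_mul _ ?_
  refine (intervalIntegral.hasDerivAt_integral_of_dominated_loc_of_deriv_le
    (F := fun t ω => Real.log (mixPSD p q Δ t ω))
    (F' := fun t ω => (p.sampledPSD Δ ω - q.sampledPSD Δ ω) / mixPSD p q Δ t ω)
    (bound := fun _ => D / (S / 2)) hball ?_ ?_ ?_ ?_ ?_ ?_).2
  · filter_upwards [hball] with t ht
    exact (hclog t ht).aestronglyMeasurable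
  · exact (hclog s (Metric.mem_ball_self hε)).intervalIntegrable _ _
  · exact hcF.aestronglyMeasurable
  · refine Filter.Eventually.of_forall fun ω _ t ht => ?_
    have h1 := hlow t ht ω
    rw [Real.norm_eq_abs, abs_div, abs_of_pos (show 0 < mixPSD p q Δ t ω by linarith)]
    exact div_le_div₀ hD0 (hD ω) (by positivity) h1
  · exact intervalIntegrable_const
  · refine Filter.Eventually.of_forall fun ω _ t ht => ?_
    have h1 := hlow t ht ω
    have h2 : HasDerivAt (fun t => mixPSD p q Δ t ω)
        (p.sampledPSD Δ ω - q.sampledPSD Δ ω) t := by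
      have h3 := ((hasDerivAt_id t).mul_const (p.sampledPSD Δ ω)).add
        (((hasDerivAt_id t).const_sub 1).mul_const (q.sampledPSD Δ ω))
      convert! h3 using 1
      ring
    exact h2.log (by linarith)

/-- The logarithm of the ratio of determinants, obtained from the case of first powers in
`exists_trace_bound` by interpolating between the two covariance matrices. -/
theorem exists_log_det_bound (p q : SpinSensor) (Δ₀ : ℝ) : ∃ C : ℝ, ∀ Δ : ℝ, 0 < Δ → Δ ≤ Δ₀ →
    ∀ n : ℕ, |Real.log ((p.cov Δ n).det / (q.cov Δ n).det)
      - n * periodMean Δ (fun ω => Real.log (p.sampledPSD Δ ω / q.sampledPSD Δ ω))| ≤ C := by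
  obtain ⟨C, hC⟩ := exists_trace_bound p q Δ₀
  refine ⟨C 1, fun Δ hΔ hΔ₀ n => ?_⟩
  have h1 := Convex.norm_image_sub_le_of_norm_hasDerivWithin_le (C := C 1)
    (f := fun s => Real.log (mixCov p q Δ n s).det
      - n * periodMean Δ fun ω => Real.log (mixPSD p q Δ s ω))
    (fun s hs => ((hasDerivAt_log_det_mixCov p q hΔ hs n).sub
      ((hasDerivAt_periodMean_log p q hΔ hs).const_mul (n : ℝ))).hasDerivWithinAt)
    (fun s hs => by
      have := hC Δ hΔ hΔ₀ s hs n 1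
      simpa only [pow_one, Real.norm_eq_abs] using this)
    (convex_Icc (0 : ℝ) 1) ⟨le_rfl, zero_le_one⟩ ⟨zero_le_one, le_rfl⟩
  have e1 : mixCov p q Δ n 1 = p.cov Δ n := by simp [mixCov]
  have e0 : mixCov p q Δ n 0 = q.cov Δ n := by simp [mixCov]
  have e2 : ∀ ω, mixPSD p q Δ 1 ω = p.sampledPSD Δ ω := fun ω => by simp [mixPSD]
  have e3 : ∀ ω, mixPSD p q Δ 0 ω = q.sampledPSD Δ ω := fun ω => by simp [mixPSD]
  have hp : ∀ ω, p.sampledPSD Δ ω ≠ 0 := fun ω =>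
    (p.Sph_pos.trans_le (p.Sph_le_sampledPSD hΔ ω)).ne'
  have hq : ∀ ω, q.sampledPSD Δ ω ≠ 0 := fun ω =>
    (q.Sph_pos.trans_le (q.Sph_le_sampledPSD hΔ ω)).ne'
  have hi : ∀ r : SpinSensor, IntervalIntegrable (fun ω => Real.log (r.sampledPSD Δ ω)) volume
      (-(Real.pi / Δ)) (Real.pi / Δ) := fun r =>
    ((r.continuous_sampledPSD hΔ).log fun ω =>
      (r.Sph_pos.trans_le (r.Sph_le_sampledPSD hΔ ω)).ne').intervalIntegrable _ _
  have e4 : periodMean Δ (fun ω => Real.log (p.sampledPSD Δ ω / q.sampledPSD Δ ω))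
      = periodMean Δ (fun ω => Real.log (p.sampledPSD Δ ω))
        - periodMean Δ (fun ω => Real.log (q.sampledPSD Δ ω)) := by
    simp only [periodMean, Real.log_div (hp _) (hq _)]
    rw [intervalIntegral.integral_sub (hi p) (hi q), mul_sub]
  simp only [e0, e1, e2, e3, sub_zero, norm_one, mul_one] at h1
  rw [Real.log_div (p.cov_posDef hΔ n).det_pos.ne' (q.cov_posDef hΔ n).det_pos.ne', e4]
  rw [Real.norm_eq_abs] at h1
  convert! h1 using 2
  ring

end SpinSensor

/-! ### The power spectral density -/

lemma hasIntegral_exp_neg_abs {γ : ℝ} (hγ : 0 < γ) (β : ℝ) :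
    Integrable (fun t : ℝ => (Real.exp (-γ * |t|) : ℂ) * Complex.exp (Complex.I * β * t)) ∧
    ∫ t : ℝ, (Real.exp (-γ * |t|) : ℂ) * Complex.exp (Complex.I * β * t)
      = ((2 * (γ / (γ ^ 2 + β ^ 2)) : ℝ) : ℂ) := by
  set a : ℂ := -γ + Complex.I * β with ha
  set b : ℂ := γ + Complex.I * β with hb
  have hare : a.re < 0 := by simp [ha, hγ]
  have hbre : 0 < b.re := by simp [hb, hγ]
  set F : ℝ → ℂ := fun t => (Real.exp (-γ * |t|) : ℂ) * Complex.exp (Complex.I * β * t) with hF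
  have h1 : Set.EqOn F (fun t : ℝ => Complex.exp (a * t)) (Set.Ioi 0) := fun t ht => by
    simp only [hF, abs_of_pos (Set.mem_Ioi.1 ht)]
    rw [Complex.ofReal_exp, ← Complex.exp_add, ha]
    congr 1; push_cast; ring
  have h2 : Set.EqOn F (fun t : ℝ => Complex.exp (b * t)) (Set.Iic 0) := fun t ht => by
    simp only [hF, abs_of_nonpos (Set.mem_Iic.1 ht)]
    rw [Complex.ofReal_exp, ← Complex.exp_add, hb]
    congr 1; push_cast; ring
  have i1 : IntegrableOn F (Set.Ioi 0) :=
    (integrableOn_exp_mul_complex_Ioi hare 0).congr_fun h1.symm measurableSet_Ioi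
  have i2 : IntegrableOn F (Set.Iic 0) :=
    (integrableOn_exp_mul_complex_Iic hbre 0).congr_fun h2.symm measurableSet_Iic
  have i3 : Integrable F := by
    rw [← integrableOn_univ, ← Set.Iic_union_Ioi (a := (0 : ℝ))]
    exact i2.union i1
  refine ⟨i3, ?_⟩
  have ha0 : a ≠ 0 := fun h => by rw [h] at hare; simp at hare
  have hb0 : b ≠ 0 := fun h => by rw [h] at hbre; simp at hbre
  rw [← intervalIntegral.integral_Iic_add_Ioi i2 i1, setIntegral_congr_fun measurableSet_Ioi h1,
    setIntegral_congr_fun measurableSet_Iic h2, integral_exp_mul_complex_Ioi hare,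
    integral_exp_mul_complex_Iic hbre]
  have hd : ((γ : ℂ) ^ 2 + (β : ℂ) ^ 2) = -(a * b) := by
    rw [ha, hb]
    linear_combination (β : ℂ) ^ 2 * Complex.I_sq
  push_cast
  rw [hd]
  simp only [mul_zero, Complex.exp_zero]
  field_simp
  rw [ha, hb]
  ring

namespace SpinSensor

lemma atomCorr_mul_exp (p : SpinSensor) (ω t : ℝ) :
    (p.atomCorr t : ℂ) * Complex.exp (-(Complex.I * ω * t))
      = (p.atomVar / 2 : ℂ) * ((Real.exp (-p.γ * |t|) : ℂ)
          * Complex.exp (Complex.I * ((-(ω - p.ωL) : ℝ) : ℂ) * t)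
        + (Real.exp (-p.γ * |t|) : ℂ) * Complex.exp (Complex.I * ((-(ω + p.ωL) : ℝ) : ℂ) * t)) := by
  have h1 : Complex.exp (Complex.I * ((-(ω - p.ωL) : ℝ) : ℂ) * t)
      = Complex.exp (p.ωL * t * Complex.I) * Complex.exp (-(Complex.I * ω * t)) := by
    rw [← Complex.exp_add]; congr 1; push_cast; ring
  have h2 : Complex.exp (Complex.I * ((-(ω + p.ωL) : ℝ) : ℂ) * t)
      = Complex.exp (-(p.ωL * t) * Complex.I) * Complex.exp (-(Complex.I * ω * t)) := by
    rw [← Complex.exp_add]; congr 1; push_cast; ring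
  rw [h1, h2, atomCorr, ← atomVar]
  push_cast
  rw [Complex.cos]
  ring

lemma integrable_atomCorr (p : SpinSensor) : Integrable fun t : ℝ => p.atomCorr t := by
  have h1 := (hasIntegral_exp_neg_abs p.γ_pos 0).1.norm
  have h2 : Integrable fun t : ℝ => Real.exp (-p.γ * |t|) := by
    refine h1.congr (Filter.Eventually.of_forall fun t => ?_)
    simp only [Complex.ofReal_zero, mul_zero, zero_mul, Complex.exp_zero, mul_one,
      Complex.norm_real, Real.norm_eq_abs, Real.abs_exp]
  have h3 : Continuous fun t : ℝ => Real.cos (p.ωL * t) := by fun_prop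
  exact (h2.const_mul _).mul_bdd (c := 1) h3.aestronglyMeasurable
    (Filter.Eventually.of_forall fun t => Real.abs_cos_le_one _)

/-- The Fourier transform of the autocorrelation, as a sum of two Lorentzians and a constant. -/
lemma fourierPSD_eq (p : SpinSensor) (ω : ℝ) : p.fourierPSD ω
    = ((p.Sph + p.atomVar * (p.γ / (p.γ ^ 2 + (ω - p.ωL) ^ 2)
        + p.γ / (p.γ ^ 2 + (ω + p.ωL) ^ 2)) : ℝ) : ℂ) := by
  have h1 := hasIntegral_exp_neg_abs p.γ_pos (-(ω - p.ωL))
  have h2 := hasIntegral_exp_neg_abs p.γ_pos (-(ω + p.ωL))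
  rw [fourierPSD]
  simp_rw [p.atomCorr_mul_exp]
  rw [integral_const_mul, integral_add h1.1 h2.1, h1.2, h2.2, neg_sq, neg_sq]
  push_cast
  ring

lemma psd_eq (p : SpinSensor) (ω : ℝ) : p.psd ω = p.Sph
    + p.atomVar * (p.γ / (p.γ ^ 2 + (ω - p.ωL) ^ 2) + p.γ / (p.γ ^ 2 + (ω + p.ωL) ^ 2)) := by
  rw [psd, fourierPSD_eq, Complex.ofReal_re]

lemma fourierPSD_eq_psd (p : SpinSensor) (ω : ℝ) : p.fourierPSD ω = (p.psd ω : ℂ) := by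
  rw [psd_eq, fourierPSD_eq]

lemma psd_eq_lorentzian (p : SpinSensor) (ω : ℝ) : p.psd ω =
    p.gD ^ 2 * p.Q / (2 * p.γ ^ 2) * (p.γ ^ 2 / (p.γ ^ 2 + (ω - p.ωL) ^ 2)
      + p.γ ^ 2 / (p.γ ^ 2 + (ω + p.ωL) ^ 2)) + p.Sph := by
  have hγ := p.γ_pos
  rw [psd_eq, atomVar]
  field_simp
  ring

lemma Sph_le_psd (p : SpinSensor) (ω : ℝ) : p.Sph ≤ p.psd ω := by
  have := p.atomVar_nonneg
  have := p.γ_pos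
  rw [psd_eq]
  have : 0 ≤ p.atomVar * (p.γ / (p.γ ^ 2 + (ω - p.ωL) ^ 2) + p.γ / (p.γ ^ 2 + (ω + p.ωL) ^ 2)) := by
    positivity
  linarith

lemma psd_pos (p : SpinSensor) (ω : ℝ) : 0 < p.psd ω := p.Sph_pos.trans_le (p.Sph_le_psd ω)

lemma psd_neg (p : SpinSensor) (ω : ℝ) : p.psd (-ω) = p.psd ω := by
  rw [psd_eq, psd_eq]
  have h1 : (-ω - p.ωL) ^ 2 = (ω + p.ωL) ^ 2 := by ring
  have h2 : (-ω + p.ωL) ^ 2 = (ω - p.ωL) ^ 2 := by ring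
  rw [h1, h2]
  ring

lemma continuous_psd (p : SpinSensor) : Continuous p.psd := by
  have hγ := p.γ_pos
  have h : p.psd = fun ω => p.Sph
      + p.atomVar * (p.γ / (p.γ ^ 2 + (ω - p.ωL) ^ 2) + p.γ / (p.γ ^ 2 + (ω + p.ωL) ^ 2)) :=
    funext p.psd_eq
  rw [h]
  refine continuous_const.add (continuous_const.mul (Continuous.add ?_ ?_)) <;>
    exact continuous_const.div (by fun_prop) fun ω => by positivity

/-- The contribution of the spins to the spectrum decays quadratically. -/
lemma exists_psd_sub_le (p : SpinSensor) :
    ∃ K : ℝ, 0 ≤ K ∧ ∀ ω, p.psd ω - p.Sph ≤ K * (1 + ω ^ 2)⁻¹ := by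
  have hγ := p.γ_pos
  have hA := p.atomVar_nonneg
  set c := (1 + 2 * p.ωL ^ 2) / p.γ ^ 2 + 2 with hc
  have hc0 : 0 ≤ c := by positivity
  have h1 : ∀ a ω : ℝ, a ^ 2 = p.ωL ^ 2 →
      p.γ / (p.γ ^ 2 + (ω - a) ^ 2) ≤ p.γ * c * (1 + ω ^ 2)⁻¹ := by
    intro a ω ha
    rw [← div_eq_mul_inv, div_le_div_iff₀ (by positivity) (by positivity), mul_assoc]
    refine mul_le_mul_of_nonneg_left ?_ hγ.le
    have h2 : c * (p.γ ^ 2 + (ω - a) ^ 2) = (1 + 2 * p.ωL ^ 2) + 2 * p.γ ^ 2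
        + c * (ω - a) ^ 2 := by
      rw [hc]; field_simp
    have h3 : 2 * (ω - a) ^ 2 ≤ c * (ω - a) ^ 2 := by
      refine mul_le_mul_of_nonneg_right ?_ (sq_nonneg _)
      have : 0 ≤ (1 + 2 * p.ωL ^ 2) / p.γ ^ 2 := by positivity
      linarith
    rw [h2]
    nlinarith [sq_nonneg (ω - 2 * a), sq_nonneg p.γ]
  refine ⟨p.atomVar * (2 * (p.γ * c)), by positivity, fun ω => ?_⟩
  rw [psd_eq, add_sub_cancel_left, mul_assoc]
  refine mul_le_mul_of_nonneg_left ?_ hA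
  have h4 := h1 p.ωL ω rfl
  have h5 := h1 (-p.ωL) ω (neg_sq _)
  rw [sub_neg_eq_add] at h5
  linarith

end SpinSensor

/-! ### From the sampled to the continuous-time spectrum -/

lemma one_sub_cos_ge {y : ℝ} (hy : |y| ≤ 3 * Real.pi / 2) :
    4 / (9 * Real.pi ^ 2) * y ^ 2 ≤ 1 - Real.cos y := by
  have hπ := Real.pi_pos
  rcases le_or_gt |y| Real.pi with h | h
  · have h1 := Real.cos_le_one_sub_mul_cos_sq h
    have h2 : 4 / (9 * Real.pi ^ 2) * y ^ 2 ≤ 2 / Real.pi ^ 2 * y ^ 2 := by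
      refine mul_le_mul_of_nonneg_right ?_ (sq_nonneg _)
      rw [div_le_div_iff₀ (by positivity) (by positivity)]
      nlinarith [sq_nonneg Real.pi]
    linarith
  · have h1 : Real.cos y ≤ 0 := by
      rw [← Real.cos_abs]
      exact Real.cos_nonpos_of_pi_div_two_le_of_le (by linarith) (by linarith)
    have h2 : 4 / (9 * Real.pi ^ 2) * y ^ 2 ≤ 1 := by
      rw [div_mul_eq_mul_div, div_le_one (by positivity), ← sq_abs]
      nlinarith [abs_nonneg y]
    linarith

lemma abs_sinh_sub_le {x : ℝ} (h0 : 0 < x) (h1 : x ≤ 1) : |Real.sinh x - x| ≤ x ^ 3 := by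
  have hx : |x| ≤ 1 := by rwa [abs_of_pos h0]
  have e1 := Real.exp_bound hx (n := 3) (by norm_num)
  have e2 := Real.exp_bound (x := -x) (by rwa [abs_neg]) (n := 3) (by norm_num)
  simp only [Finset.sum_range_succ, Finset.sum_range_zero, abs_neg, abs_of_pos h0] at e1 e2
  norm_num [Nat.factorial] at e1 e2
  rw [abs_le] at e1 e2 ⊢
  rw [Real.sinh_eq]
  have : 0 < x ^ 3 := by positivity
  constructor <;> linarith [e1.1, e1.2, e2.1, e2.2]

lemma abs_cosh_sub_le {x : ℝ} (h0 : 0 < x) (h1 : x ≤ 1) :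
    |Real.cosh x - 1 - x ^ 2 / 2| ≤ x ^ 4 := by
  have hx : |x| ≤ 1 := by rwa [abs_of_pos h0]
  have e1 := Real.exp_bound hx (n := 4) (by norm_num)
  have e2 := Real.exp_bound (x := -x) (by rwa [abs_neg]) (n := 4) (by norm_num)
  simp only [Finset.sum_range_succ, Finset.sum_range_zero, abs_neg, abs_of_pos h0] at e1 e2
  norm_num [Nat.factorial] at e1 e2
  rw [abs_le] at e1 e2 ⊢
  rw [Real.cosh_eq]
  have : 0 < x ^ 4 := by positivity
  constructor <;> linarith [e1.1, e1.2, e2.1, e2.2]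

lemma abs_cos_sub_le (y : ℝ) : |1 - y ^ 2 / 2 - Real.cos y| ≤ y ^ 4 := by
  have h0 := Real.one_sub_sq_div_two_le_cos (x := y)
  rcases le_or_gt |y| 1 with h | h
  · have h1 := Real.cos_bound h
    rw [abs_sub_comm] at h1
    refine h1.trans ?_
    rw [show |y| ^ 4 = y ^ 4 from Even.pow_abs (by decide) y]
    nlinarith [pow_two_nonneg (y ^ 2)]
  · have h1 : 1 ≤ y ^ 2 := by rw [← sq_abs]; nlinarith
    have h2 := Real.cos_le_one y
    rw [abs_le]
    constructor <;> nlinarith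

/-- The Poisson kernel approximates the Lorentzian profile up to an error that is linear in the
width, uniformly over more than one period of the angle. -/
lemma abs_poissonK_sub_le {x y : ℝ} (h0 : 0 < x) (h1 : x ≤ 1) (hy : |y| ≤ 3 * Real.pi / 2) :
    |poissonK (Real.exp (-x)) y - 2 * x / (x ^ 2 + y ^ 2)| ≤ 27 * Real.pi ^ 2 / 4 * x := by
  have hπ := Real.pi_gt_three
  set c := 4 / (9 * Real.pi ^ 2) with hc
  have hc0 : 0 < c := by positivity
  have hc1 : c ≤ 1 / 2 := by
    rw [hc, div_le_div_iff₀ (by positivity) (by norm_num)]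
    nlinarith
  set r := x ^ 2 + y ^ 2 with hr
  have hr0 : 0 < r := by positivity
  set w := Real.cosh x - Real.cos y with hw
  have hcosh : x ^ 2 / 2 ≤ Real.cosh x - 1 := by
    have e1 := Real.cosh_two_mul (x / 2)
    have e2 := Real.cosh_sq (x / 2)
    have e3 := Real.self_le_sinh_iff.2 (by positivity : 0 ≤ x / 2)
    rw [mul_div_cancel₀ _ two_ne_zero] at e1
    nlinarith
  have hwr : c * r ≤ w := by
    have := one_sub_cos_ge hy
    rw [← hc] at this
    nlinarith [sq_nonneg x]
  have hw0 : 0 < w := (mul_pos hc0 hr0).trans_le hwr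
  -- hyperbolic form of the kernel
  have hK : poissonK (Real.exp (-x)) y = Real.sinh x / w := by
    have hE : Real.exp (-x) * Real.exp x = 1 := by rw [← Real.exp_add]; simp
    have hEx := Real.exp_pos x
    have hden : 1 - 2 * Real.exp (-x) * Real.cos y + Real.exp (-x) ^ 2
        = 2 * Real.exp (-x) * w := by
      rw [hw, Real.cosh_eq]
      linear_combination (-1 : ℝ) * hE
    have hnum : 1 - Real.exp (-x) ^ 2 = 2 * Real.exp (-x) * Real.sinh x := by
      rw [Real.sinh_eq]
      linear_combination (-1 : ℝ) * hE
    rw [poissonK, hden, hnum]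
    exact mul_div_mul_left _ _ (by positivity)
  have hnum : |Real.sinh x * r - w * (2 * x)| ≤ 3 * x * r ^ 2 := by
    have e : Real.sinh x * r - w * (2 * x) = (Real.sinh x - x) * r
        - 2 * x * (Real.cosh x - 1 - x ^ 2 / 2) - 2 * x * (1 - y ^ 2 / 2 - Real.cos y) := by
      rw [hw, hr]; ring
    have b1 := abs_sinh_sub_le h0 h1
    have b2 := abs_cosh_sub_le h0 h1
    have b3 := abs_cos_sub_le y
    rw [e]
    have t1 : |(Real.sinh x - x) * r| ≤ x ^ 3 * r := by
      rw [abs_mul, abs_of_pos hr0]; gcongr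
    have t2 : |2 * x * (Real.cosh x - 1 - x ^ 2 / 2)| ≤ 2 * x * x ^ 4 := by
      rw [abs_mul, abs_of_pos (by positivity : 0 < 2 * x)]; gcongr
    have t3 : |2 * x * (1 - y ^ 2 / 2 - Real.cos y)| ≤ 2 * x * y ^ 4 := by
      rw [abs_mul, abs_of_pos (by positivity : 0 < 2 * x)]; gcongr
    refine (abs_sub _ _).trans ((add_le_add ((abs_sub _ _).trans (add_le_add t1 t2)) t3).trans ?_)
    have t4 : x ^ 3 * r + 2 * x * x ^ 4 + 2 * x * y ^ 4
        = 3 * x * r ^ 2 - x * (5 * (x ^ 2 * y ^ 2) + y ^ 4) := by rw [hr]; ring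
    rw [t4]
    have : 0 ≤ x * (5 * (x ^ 2 * y ^ 2) + y ^ 4) := by positivity
    linarith
  rw [hK, div_sub_div _ _ hw0.ne' hr0.ne', abs_div, abs_of_pos (mul_pos hw0 hr0),
    div_le_iff₀ (mul_pos hw0 hr0)]
  refine hnum.trans ?_
  have h3 : 27 * Real.pi ^ 2 / 4 * c = 3 := by rw [hc]; field_simp; norm_num
  calc 3 * x * r ^ 2 = 27 * Real.pi ^ 2 / 4 * x * (c * r * r) := by
        rw [← h3]; ring
    _ ≤ 27 * Real.pi ^ 2 / 4 * x * (w * r) := by gcongr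

namespace SpinSensor

/-- Sampling changes the spectrum by `O(Δ²)` on the fundamental frequency band. -/
lemma exists_abs_sampledPSD_sub_psd_le (p : SpinSensor) : ∃ C Δ₁ : ℝ, 0 ≤ C ∧ 0 < Δ₁ ∧
    ∀ Δ, 0 < Δ → Δ ≤ Δ₁ → ∀ ω, |ω| ≤ Real.pi / Δ →
      |p.sampledPSD Δ ω - p.psd ω| ≤ C * Δ ^ 2 := by
  have hγ := p.γ_pos
  have hA := p.atomVar_nonneg
  have hπ := Real.pi_pos
  -- the second bound on `Δ` keeps the shifted angles `(ω ± ω_L) Δ` within `[-3π/2, 3π/2]`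
  refine ⟨p.atomVar * (27 * Real.pi ^ 2 / 4 * p.γ),
    min (1 / p.γ) (Real.pi / (2 * (|p.ωL| + 1))), by positivity, by positivity, ?_⟩
  intro Δ hΔ hΔ₁ ω hω
  have hx1 : p.γ * Δ ≤ 1 := by
    have := hΔ₁.trans (min_le_left _ _)
    rwa [le_div_iff₀ hγ, mul_comm] at this
  have hL : |p.ωL| * Δ ≤ Real.pi / 2 := by
    have h := hΔ₁.trans (min_le_right _ _)
    rw [le_div_iff₀ (by positivity)] at h
    nlinarith [abs_nonneg p.ωL]
  have hωΔ : |ω| * Δ ≤ Real.pi := by rwa [le_div_iff₀ hΔ] at hω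
  have hx0 : 0 < p.γ * Δ := mul_pos hγ hΔ
  have key : ∀ a, |a| = |p.ωL| →
      |Δ / 2 * poissonK (Real.exp (-p.γ * Δ)) ((ω - a) * Δ) - p.γ / (p.γ ^ 2 + (ω - a) ^ 2)|
        ≤ 27 * Real.pi ^ 2 / 4 * p.γ / 2 * Δ ^ 2 := by
    intro a ha
    have hy : |(ω - a) * Δ| ≤ 3 * Real.pi / 2 := by
      rw [abs_mul, abs_of_pos hΔ]
      have := mul_le_mul_of_nonneg_right (abs_sub ω a) hΔ.le
      rw [add_mul, ha] at this
      linarith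
    have h1 := abs_poissonK_sub_le hx0 hx1 hy
    have h2 : Δ / 2 * poissonK (Real.exp (-p.γ * Δ)) ((ω - a) * Δ)
        - p.γ / (p.γ ^ 2 + (ω - a) ^ 2) = Δ / 2 * (poissonK (Real.exp (-(p.γ * Δ))) ((ω - a) * Δ)
          - 2 * (p.γ * Δ) / ((p.γ * Δ) ^ 2 + ((ω - a) * Δ) ^ 2)) := by
      rw [neg_mul]
      field_simp
    rw [h2, abs_mul, abs_of_pos (by positivity : 0 < Δ / 2)]
    calc _ ≤ Δ / 2 * (27 * Real.pi ^ 2 / 4 * (p.γ * Δ)) := by gcongr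
      _ = _ := by ring
  have k1 := key p.ωL rfl
  have k2 := key (-p.ωL) (abs_neg _)
  rw [sub_neg_eq_add] at k2
  have e : p.sampledPSD Δ ω - p.psd ω = p.atomVar
      * ((Δ / 2 * poissonK (Real.exp (-p.γ * Δ)) ((ω - p.ωL) * Δ)
          - p.γ / (p.γ ^ 2 + (ω - p.ωL) ^ 2))
        + (Δ / 2 * poissonK (Real.exp (-p.γ * Δ)) ((ω + p.ωL) * Δ)
          - p.γ / (p.γ ^ 2 + (ω + p.ωL) ^ 2))) := by
    rw [sampledPSD, psd_eq]; ring
  rw [e, abs_mul, abs_of_nonneg hA, mul_assoc]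
  refine mul_le_mul_of_nonneg_left ((abs_add_le _ _).trans ((add_le_add k1 k2).trans_eq ?_)) hA
  ring

/-- Period means of functions that approximate, to second order in the sampling period, an even
function with integrable quadratic tails. -/
lemma exists_periodMean_bound {F : ℝ → ℝ} {G : ℝ → ℝ → ℝ} {K C Δ₀ Δ₁ B : ℝ} (hΔ₁ : 0 < Δ₁)
    (hF : Continuous F) (hFe : ∀ ω, F (-ω) = F ω) (hFK : ∀ ω, |F ω| ≤ K * (1 + ω ^ 2)⁻¹)
    (hG : ∀ Δ, 0 < Δ → Continuous (G Δ)) (hGB : ∀ Δ, 0 < Δ → Δ ≤ Δ₀ → ∀ ω, |G Δ ω| ≤ B)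
    (hGF : ∀ Δ, 0 < Δ → Δ ≤ Δ₁ → ∀ ω, |ω| ≤ Real.pi / Δ → |G Δ ω - F ω| ≤ C * Δ ^ 2) :
    IntegrableOn F (Set.Ioi 0) ∧ ∃ C' : ℝ, ∀ Δ, 0 < Δ → Δ ≤ Δ₀ →
      |periodMean Δ (G Δ) / Δ - 1 / Real.pi * ∫ ω in Set.Ioi (0 : ℝ), F ω| ≤ C' * Δ := by
  have hπ := Real.pi_pos
  have hFi : Integrable F := (integrable_inv_one_add_sq.const_mul K).mono' hF.aestronglyMeasurable
    (Filter.Eventually.of_forall hFK)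
  refine ⟨hFi.integrableOn, ?_⟩
  set J := ∫ ω in Set.Ioi (0 : ℝ), F ω with hJ
  have hK0 : 0 ≤ K := by
    have := (abs_nonneg _).trans (hFK 0)
    simpa using this
  refine ⟨|C + K / Real.pi ^ 2| + (|B| / Δ₁ + |1 / Real.pi * J|) / Δ₁, fun Δ hΔ hΔ₀ => ?_⟩
  have hN : 0 < Real.pi / Δ := by positivity
  -- For small `Δ` the error consists of the error of `G` on the band and of the tail of `F`; for
  -- `Δ > Δ₁` it is bounded, hence `O(Δ)`.
  rcases le_or_gt Δ Δ₁ with h | h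
  · have h1 : ∫ ω in (-(Real.pi / Δ))..(Real.pi / Δ), F ω
        = 2 * (J - ∫ ω in Set.Ioi (Real.pi / Δ), F ω) := by
      rw [← intervalIntegral.integral_add_adjacent_intervals (b := 0)
        (hF.intervalIntegrable _ _) (hF.intervalIntegrable _ _)]
      have e1 : ∫ ω in (-(Real.pi / Δ))..0, F ω = ∫ ω in (0 : ℝ)..(Real.pi / Δ), F ω := by
        have := intervalIntegral.integral_comp_neg (a := 0) (b := Real.pi / Δ) F
        rw [neg_zero] at this
        rw [← this]
        simp_rw [hFe]
      have e2 := intervalIntegral.integral_interval_add_Ioi (hFi.integrableOn (s := Set.Ioi 0))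
        (hFi.integrableOn (s := Set.Ioi (Real.pi / Δ)))
      rw [e1, hJ, ← e2]
      ring
    have h2 : |∫ ω in (-(Real.pi / Δ))..(Real.pi / Δ), (G Δ ω - F ω)|
        ≤ C * Δ ^ 2 * (2 * (Real.pi / Δ)) := by
      have := intervalIntegral.norm_integral_le_of_norm_le_const (a := -(Real.pi / Δ))
        (b := Real.pi / Δ) (f := fun ω => G Δ ω - F ω) (C := C * Δ ^ 2) (fun ω hω => by
          rw [Set.uIoc_of_le (by linarith)] at hω
          exact hGF Δ hΔ h ω (abs_le.2 ⟨hω.1.le, hω.2⟩))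
      rw [Real.norm_eq_abs] at this
      refine this.trans_eq ?_
      rw [show Real.pi / Δ - -(Real.pi / Δ) = 2 * (Real.pi / Δ) by ring,
        abs_of_pos (by positivity : 0 < 2 * (Real.pi / Δ))]
    have h3 : |∫ ω in Set.Ioi (Real.pi / Δ), F ω| ≤ K * (Δ / Real.pi) := by
      have i2 := (integrableOn_Ioi_rpow_of_lt (show (-2 : ℝ) < -1 by norm_num) hN).const_mul K
      have h4 := norm_integral_le_of_norm_le (μ := volume.restrict (Set.Ioi (Real.pi / Δ)))
        (f := F) i2 (by
          filter_upwards [ae_restrict_mem measurableSet_Ioi] with ω hω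
          have hω0 : 0 < ω := hN.trans hω
          refine (hFK ω).trans (mul_le_mul_of_nonneg_left ?_ hK0)
          rw [Real.rpow_neg hω0.le, Real.rpow_two]
          exact inv_anti₀ (by positivity) (by linarith))
      rw [integral_const_mul, integral_Ioi_rpow_of_lt (by norm_num) hN] at h4
      rw [Real.norm_eq_abs] at h4
      refine h4.trans_eq ?_
      rw [show (-2 : ℝ) + 1 = -1 by norm_num, Real.rpow_neg_one]
      field_simp
    have h5 : periodMean Δ (G Δ) / Δ - 1 / Real.pi * J
        = 1 / (2 * Real.pi) * (∫ ω in (-(Real.pi / Δ))..(Real.pi / Δ), (G Δ ω - F ω))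
          - 1 / Real.pi * ∫ ω in Set.Ioi (Real.pi / Δ), F ω := by
      rw [intervalIntegral.integral_sub ((hG Δ hΔ).intervalIntegrable _ _)
        (hF.intervalIntegrable _ _), h1, periodMean]
      field_simp
      ring
    have h6 : |periodMean Δ (G Δ) / Δ - 1 / Real.pi * J| ≤ (C + K / Real.pi ^ 2) * Δ := by
      rw [h5]
      refine (abs_sub _ _).trans ?_
      rw [abs_mul, abs_mul, abs_of_pos (by positivity : 0 < 1 / (2 * Real.pi)),
        abs_of_pos (by positivity : 0 < 1 / Real.pi)]
      calc _ ≤ 1 / (2 * Real.pi) * (C * Δ ^ 2 * (2 * (Real.pi / Δ)))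
            + 1 / Real.pi * (K * (Δ / Real.pi)) := by gcongr
        _ = (C + K / Real.pi ^ 2) * Δ := by field_simp
    refine h6.trans (mul_le_mul_of_nonneg_right ?_ hΔ.le)
    have : 0 ≤ (|B| / Δ₁ + |1 / Real.pi * J|) / Δ₁ := by positivity
    linarith [le_abs_self (C + K / Real.pi ^ 2)]
  · have h1 : |periodMean Δ (G Δ)| ≤ |B| := by
      have := intervalIntegral.norm_integral_le_of_norm_le_const (a := -(Real.pi / Δ))
        (b := Real.pi / Δ) (f := G Δ) (C := |B|)
        (fun ω _ => (hGB Δ hΔ hΔ₀ ω).trans (le_abs_self B))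
      rw [show Real.pi / Δ - -(Real.pi / Δ) = 2 * (Real.pi / Δ) by ring,
        abs_of_pos (by positivity : 0 < 2 * (Real.pi / Δ)), Real.norm_eq_abs] at this
      rw [periodMean, abs_mul, abs_of_pos (by positivity : 0 < Δ / (2 * Real.pi))]
      calc _ ≤ Δ / (2 * Real.pi) * (|B| * (2 * (Real.pi / Δ))) := by gcongr
        _ = |B| := by field_simp
    have h2 : |periodMean Δ (G Δ) / Δ - 1 / Real.pi * J| ≤ |B| / Δ₁ + |1 / Real.pi * J| := by
      refine (abs_sub _ _).trans (add_le_add_left ?_ _)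
      rw [abs_div, abs_of_pos hΔ]
      exact div_le_div₀ (abs_nonneg _) h1 hΔ₁ h.le
    refine h2.trans ?_
    have h3 : ∀ E : ℝ, 0 ≤ E → E ≤ E / Δ₁ * Δ := fun E hE => by
      rw [div_mul_eq_mul_div, le_div_iff₀ hΔ₁]
      exact mul_le_mul_of_nonneg_left h.le hE
    refine (h3 _ (by positivity)).trans (mul_le_mul_of_nonneg_right ?_ hΔ.le)
    linarith [abs_nonneg (C + K / Real.pi ^ 2)]

end SpinSensor

/-! ### Long-time asymptotics of traces and determinants -/

namespace SpinSensor

lemma abs_sub_le_of_Sph_eq {p q : SpinSensor} (h : p.Sph = q.Sph) {x y a b : ℝ}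
    (hx : p.Sph ≤ x) (hy : q.Sph ≤ y) (ha : x - p.Sph ≤ a) (hb : y - q.Sph ≤ b) :
    |x - y| ≤ a + b := by
  rw [abs_le]
  constructor <;> linarith

/-- With equal shot noise the difference of the spectra decays quadratically. -/
lemma exists_abs_psd_sub_le {p q : SpinSensor} (h : p.Sph = q.Sph) :
    ∃ K : ℝ, 0 ≤ K ∧ ∀ ω, |p.psd ω - q.psd ω| ≤ K * (1 + ω ^ 2)⁻¹ := by
  obtain ⟨K₁, h₁, hK₁⟩ := p.exists_psd_sub_le
  obtain ⟨K₂, h₂, hK₂⟩ := q.exists_psd_sub_le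
  refine ⟨K₁ + K₂, by positivity, fun ω => ?_⟩
  rw [add_mul]
  exact abs_sub_le_of_Sph_eq h (p.Sph_le_psd ω) (q.Sph_le_psd ω) (hK₁ ω) (hK₂ ω)

lemma exists_abs_sampledPSD_sub_le_uniform {p q : SpinSensor} (h : p.Sph = q.Sph) (Δ₀ : ℝ) :
    ∃ D : ℝ, 0 ≤ D ∧ ∀ Δ, 0 < Δ → Δ ≤ Δ₀ → ∀ ω,
      |p.sampledPSD Δ ω - q.sampledPSD Δ ω| ≤ D := by
  refine ⟨|p.atomVar * (2 * (1 + p.γ * Δ₀) / p.γ) + q.atomVar * (2 * (1 + q.γ * Δ₀) / q.γ)|,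
    abs_nonneg _, fun Δ hΔ hΔ₀ ω => ?_⟩
  exact (abs_sub_le_of_Sph_eq h (p.Sph_le_sampledPSD hΔ ω) (q.Sph_le_sampledPSD hΔ ω)
    (p.sampledPSD_sub_le hΔ hΔ₀ ω) (q.sampledPSD_sub_le hΔ hΔ₀ ω)).trans (le_abs_self _)

lemma inv_one_add_sq_le_one (ω : ℝ) : (1 + ω ^ 2)⁻¹ ≤ 1 :=
  inv_le_one_of_one_le₀ (by nlinarith [sq_nonneg ω])

/-- Period means of powers of the relative difference of two spectra. -/
lemma exists_periodMean_pow_bound {p q : SpinSensor} (h : p.Sph = q.Sph) (u : SpinSensor)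
    {Δ₀ : ℝ} (hΔ₀ : 0 < Δ₀) {m : ℕ} (hm : 1 ≤ m) :
    IntegrableOn (fun ω => ((p.psd ω - q.psd ω) / u.psd ω) ^ m) (Set.Ioi 0) ∧
    ∃ C : ℝ, ∀ Δ, 0 < Δ → Δ ≤ Δ₀ →
      |periodMean Δ (fun ω => ((p.sampledPSD Δ ω - q.sampledPSD Δ ω) / u.sampledPSD Δ ω) ^ m) / Δ
        - 1 / Real.pi * ∫ ω in Set.Ioi (0 : ℝ), ((p.psd ω - q.psd ω) / u.psd ω) ^ m|
        ≤ C * Δ := by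
  obtain ⟨K, hK0, hK⟩ := exists_abs_psd_sub_le h
  obtain ⟨D, hD0, hD⟩ := exists_abs_sampledPSD_sub_le_uniform h Δ₀
  obtain ⟨Cp, Δp, hCp, hΔp, hp⟩ := p.exists_abs_sampledPSD_sub_psd_le
  obtain ⟨Cq, Δq, hCq, hΔq, hq⟩ := q.exists_abs_sampledPSD_sub_psd_le
  obtain ⟨Cu, Δu, hCu, hΔu, hu⟩ := u.exists_abs_sampledPSD_sub_psd_le
  have hS := u.Sph_pos
  set M := max (D / u.Sph) (K / u.Sph) with hM
  have hM0 : 0 ≤ M := le_max_of_le_left (by positivity)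
  -- `L` bounds the change of the quotient per `Δ²`, `M` the quotients themselves
  set L := (Cp + Cq) / u.Sph + K * Cu / u.Sph ^ 2 with hL
  have hquot : ∀ Δ, 0 < Δ → Δ ≤ Δ₀ → ∀ ω,
      |(p.sampledPSD Δ ω - q.sampledPSD Δ ω) / u.sampledPSD Δ ω| ≤ D / u.Sph := fun Δ h1 h2 ω => by
    have h3 := u.Sph_le_sampledPSD h1 ω
    rw [abs_div, abs_of_pos (hS.trans_le h3)]
    exact div_le_div₀ hD0 (hD Δ h1 h2 ω) hS h3
  have hquot' : ∀ ω, |(p.psd ω - q.psd ω) / u.psd ω| ≤ K / u.Sph * (1 + ω ^ 2)⁻¹ := fun ω => by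
    rw [abs_div, abs_of_pos (u.psd_pos ω), div_mul_eq_mul_div]
    exact div_le_div₀ (by positivity) (hK ω) hS (u.Sph_le_psd ω)
  refine exists_periodMean_bound (K := (K / u.Sph) ^ m) (C := L * m * M ^ (m - 1))
    (Δ₁ := min (min Δp Δq) (min Δu Δ₀)) (B := (D / u.Sph) ^ m)
    (lt_min (lt_min hΔp hΔq) (lt_min hΔu hΔ₀)) ?_ ?_ ?_ ?_ ?_ ?_
  · exact ((p.continuous_psd.sub q.continuous_psd).div u.continuous_psd
      fun ω => (u.psd_pos ω).ne').pow m
  · intro ω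
    simp only [psd_neg]
  · intro ω
    rw [abs_pow]
    refine (pow_le_pow_left₀ (abs_nonneg _) (hquot' ω) m).trans ?_
    rw [mul_pow]
    exact mul_le_mul_of_nonneg_left (pow_le_of_le_one (by positivity) (inv_one_add_sq_le_one ω)
      (by omega)) (by positivity)
  · intro Δ hΔ
    exact (((p.continuous_sampledPSD hΔ).sub (q.continuous_sampledPSD hΔ)).div
      (u.continuous_sampledPSD hΔ) fun ω => (hS.trans_le (u.Sph_le_sampledPSD hΔ ω)).ne').pow m
  · intro Δ h1 h2 ω
    rw [abs_pow]
    exact pow_le_pow_left₀ (abs_nonneg _) (hquot Δ h1 h2 ω) m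
  · intro Δ hΔ h1 ω hω
    have b1 := hp Δ hΔ (h1.trans ((min_le_left _ _).trans (min_le_left _ _))) ω hω
    have b2 := hq Δ hΔ (h1.trans ((min_le_left _ _).trans (min_le_right _ _))) ω hω
    have b3 := hu Δ hΔ (h1.trans ((min_le_right _ _).trans (min_le_left _ _))) ω hω
    have b4 := hquot Δ hΔ (h1.trans ((min_le_right _ _).trans (min_le_right _ _))) ω
    have b5 : |(p.psd ω - q.psd ω) / u.psd ω| ≤ K / u.Sph :=
      (hquot' ω).trans (mul_le_of_le_one_right (by positivity) (inv_one_add_sq_le_one ω))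
    have s1 := u.Sph_le_sampledPSD hΔ ω
    have s2 := hS.trans_le s1
    have s4 := u.psd_pos ω
    have b6 : |(p.sampledPSD Δ ω - q.sampledPSD Δ ω) / u.sampledPSD Δ ω
        - (p.psd ω - q.psd ω) / u.psd ω| ≤ L * Δ ^ 2 := by
      have e : (p.sampledPSD Δ ω - q.sampledPSD Δ ω) / u.sampledPSD Δ ω
          - (p.psd ω - q.psd ω) / u.psd ω
          = ((p.sampledPSD Δ ω - p.psd ω) - (q.sampledPSD Δ ω - q.psd ω)) / u.sampledPSD Δ ω
            - (p.psd ω - q.psd ω) / u.psd ω * (u.sampledPSD Δ ω - u.psd ω)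
              / u.sampledPSD Δ ω := by
        field_simp
        ring
      rw [e]
      refine (abs_sub _ _).trans ?_
      rw [abs_div, abs_div, abs_mul ((p.psd ω - q.psd ω) / u.psd ω), abs_of_pos s2]
      have c1 : |(p.sampledPSD Δ ω - p.psd ω) - (q.sampledPSD Δ ω - q.psd ω)| / u.sampledPSD Δ ω
          ≤ (Cp * Δ ^ 2 + Cq * Δ ^ 2) / u.Sph :=
        div_le_div₀ (by positivity) ((abs_sub _ _).trans (add_le_add b1 b2)) hS s1
      have c2 : |(p.psd ω - q.psd ω) / u.psd ω| * |u.sampledPSD Δ ω - u.psd ω|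
          / u.sampledPSD Δ ω ≤ (K / u.Sph) * (Cu * Δ ^ 2) / u.Sph :=
        div_le_div₀ (by positivity) (mul_le_mul b5 b3 (abs_nonneg _) (by positivity)) hS s1
      refine (add_le_add c1 c2).trans_eq ?_
      rw [hL]
      field_simp
    refine (abs_pow_sub_pow_le _ _ m).trans ?_
    have b7 : max |(p.sampledPSD Δ ω - q.sampledPSD Δ ω) / u.sampledPSD Δ ω|
        |(p.psd ω - q.psd ω) / u.psd ω| ≤ M := max_le_max b4 b5
    calc _ ≤ L * Δ ^ 2 * m * M ^ (m - 1) := by gcongr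
      _ = _ := by ring

lemma abs_log_sub_log_le {x y s : ℝ} (hs : 0 < s) (hx : s ≤ x) (hy : s ≤ y) :
    |Real.log x - Real.log y| ≤ |x - y| / s := by
  have key : ∀ a b : ℝ, s ≤ a → s ≤ b → Real.log a - Real.log b ≤ |a - b| / s := by
    intro a b ha hb
    have hb0 := hs.trans_le hb
    rw [← Real.log_div (hs.trans_le ha).ne' hb0.ne']
    refine (Real.log_le_sub_one_of_pos (div_pos (hs.trans_le ha) hb0)).trans ?_
    rw [div_sub_one hb0.ne']
    exact div_le_div₀ (abs_nonneg _) (le_abs_self _) hs hb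
  rw [abs_le]
  constructor
  · have := key y x hy hx
    rw [abs_sub_comm] at this
    linarith
  · exact key x y hx hy

/-- Period means of the logarithm of the ratio of two spectra. -/
lemma exists_periodMean_log_bound {p q : SpinSensor} (h : p.Sph = q.Sph) (Δ₀ : ℝ) :
    IntegrableOn (fun ω => Real.log (p.psd ω / q.psd ω)) (Set.Ioi 0) ∧
    ∃ C : ℝ, ∀ Δ, 0 < Δ → Δ ≤ Δ₀ →
      |periodMean Δ (fun ω => Real.log (p.sampledPSD Δ ω / q.sampledPSD Δ ω)) / Δ
        - 1 / Real.pi * ∫ ω in Set.Ioi (0 : ℝ), Real.log (p.psd ω / q.psd ω)| ≤ C * Δ := by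
  obtain ⟨K, hK0, hK⟩ := exists_abs_psd_sub_le h
  obtain ⟨D, hD0, hD⟩ := exists_abs_sampledPSD_sub_le_uniform h Δ₀
  obtain ⟨Cp, Δp, hCp, hΔp, hp⟩ := p.exists_abs_sampledPSD_sub_psd_le
  obtain ⟨Cq, Δq, hCq, hΔq, hq⟩ := q.exists_abs_sampledPSD_sub_psd_le
  have hS := p.Sph_pos
  have hps : ∀ Δ, 0 < Δ → ∀ ω, p.Sph ≤ p.sampledPSD Δ ω := fun Δ hΔ => p.Sph_le_sampledPSD hΔ
  have hqs : ∀ Δ, 0 < Δ → ∀ ω, p.Sph ≤ q.sampledPSD Δ ω := fun Δ hΔ ω =>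
    h.le.trans (q.Sph_le_sampledPSD hΔ ω)
  have hpc := p.Sph_le_psd
  have hqc : ∀ ω, p.Sph ≤ q.psd ω := fun ω => h.le.trans (q.Sph_le_psd ω)
  have hlog : ∀ x y, p.Sph ≤ x → p.Sph ≤ y → Real.log (x / y) = Real.log x - Real.log y :=
    fun x y hx hy => Real.log_div (hS.trans_le hx).ne' (hS.trans_le hy).ne'
  refine exists_periodMean_bound (K := K / p.Sph) (C := (Cp + Cq) / p.Sph)
    (Δ₁ := min Δp Δq) (B := D / p.Sph) (lt_min hΔp hΔq) ?_ ?_ ?_ ?_ ?_ ?_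
  · exact (p.continuous_psd.div q.continuous_psd fun ω => (q.psd_pos ω).ne').log
      fun ω => (div_pos (p.psd_pos ω) (q.psd_pos ω)).ne'
  · intro ω
    simp only [psd_neg]
  · intro ω
    rw [hlog _ _ (hpc ω) (hqc ω), div_mul_eq_mul_div]
    exact (abs_log_sub_log_le hS (hpc ω) (hqc ω)).trans
      (div_le_div_of_nonneg_right (hK ω) hS.le)
  · intro Δ hΔ
    have h1 : ∀ ω, 0 < p.sampledPSD Δ ω := fun ω => hS.trans_le (hps Δ hΔ ω)
    have h2 : ∀ ω, 0 < q.sampledPSD Δ ω := fun ω => hS.trans_le (hqs Δ hΔ ω)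
    exact ((p.continuous_sampledPSD hΔ).div (q.continuous_sampledPSD hΔ)
      fun ω => (h2 ω).ne').log fun ω => (div_pos (h1 ω) (h2 ω)).ne'
  · intro Δ h1 h2 ω
    rw [hlog _ _ (hps Δ h1 ω) (hqs Δ h1 ω)]
    exact (abs_log_sub_log_le hS (hps Δ h1 ω) (hqs Δ h1 ω)).trans
      (div_le_div_of_nonneg_right (hD Δ h1 h2 ω) hS.le)
  · intro Δ hΔ h1 ω hω
    have b1 := hp Δ hΔ (h1.trans (min_le_left _ _)) ω hω
    have b2 := hq Δ hΔ (h1.trans (min_le_right _ _)) ω hω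
    have c1 := (abs_log_sub_log_le hS (hps Δ hΔ ω) (hpc ω)).trans
      (div_le_div_of_nonneg_right b1 hS.le)
    have c2 := (abs_log_sub_log_le hS (hqs Δ hΔ ω) (hqc ω)).trans
      (div_le_div_of_nonneg_right b2 hS.le)
    rw [hlog _ _ (hps Δ hΔ ω) (hqs Δ hΔ ω), hlog _ _ (hpc ω) (hqc ω)]
    have e : Real.log (p.sampledPSD Δ ω) - Real.log (q.sampledPSD Δ ω)
        - (Real.log (p.psd ω) - Real.log (q.psd ω))
        = (Real.log (p.sampledPSD Δ ω) - Real.log (p.psd ω))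
          - (Real.log (q.sampledPSD Δ ω) - Real.log (q.psd ω)) := by ring
    rw [e]
    refine (abs_sub _ _).trans ((add_le_add c1 c2).trans_eq ?_)
    ring

/-- An approximate linear law with slope `μ`, where `μ / Δ` is close to `c`, restated with the
slope split into `c` and a small remainder. -/
lemma abs_sub_le_of_slope {X μ c C Δ : ℝ} (hΔ : 0 < Δ) (n : ℕ) (hX : |X - n * μ| ≤ C) :
    |X - n * Δ * (c + (μ / Δ - c))| ≤ C := by
  have e : X - n * Δ * (c + (μ / Δ - c)) = X - n * μ := by field_simp; ring
  rwa [e]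

/-- Long-time asymptotics of the traces of powers. -/
theorem exists_trace_asymptotics {p q : SpinSensor} (h : p.Sph = q.Sph) {u : SpinSensor}
    (hu : u = p ∨ u = q) {Δ₀ : ℝ} (hΔ₀ : 0 < Δ₀) {m : ℕ} (hm : 1 ≤ m) :
    ∃ (C : ℝ) (r : ℝ → ℝ), ∀ Δ, 0 < Δ → Δ ≤ Δ₀ → |r Δ| ≤ C * Δ ∧ ∀ n : ℕ,
      |(((u.cov Δ n)⁻¹ * (p.cov Δ n - q.cov Δ n)) ^ m).trace - n * Δ * (1 / Real.pi *
        (∫ ω in Set.Ioi (0 : ℝ), ((p.psd ω - q.psd ω) / u.psd ω) ^ m) + r Δ)| ≤ C := by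
  obtain ⟨C₁, h₁⟩ := exists_trace_bound p q Δ₀
  obtain ⟨-, C₂, h₂⟩ := exists_periodMean_pow_bound h u hΔ₀ hm
  refine ⟨max (C₁ m) C₂, fun Δ => periodMean Δ (fun ω =>
    ((p.sampledPSD Δ ω - q.sampledPSD Δ ω) / u.sampledPSD Δ ω) ^ m) / Δ - 1 / Real.pi *
      ∫ ω in Set.Ioi (0 : ℝ), ((p.psd ω - q.psd ω) / u.psd ω) ^ m, fun Δ hΔ hΔ' => ⟨?_, ?_⟩⟩
  · exact (h₂ Δ hΔ hΔ').trans (mul_le_mul_of_nonneg_right (le_max_right _ _) hΔ.le)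
  · intro n
    -- `u` is one of the two end points of the interpolation
    obtain ⟨s, hs, hcov, hpsd⟩ : ∃ s ∈ Set.Icc (0 : ℝ) 1, mixCov p q Δ n s = u.cov Δ n ∧
        mixPSD p q Δ s = u.sampledPSD Δ := by
      rcases hu with rfl | rfl
      · exact ⟨1, ⟨zero_le_one, le_rfl⟩, by simp [mixCov], funext fun ω => by simp [mixPSD]⟩
      · exact ⟨0, ⟨le_rfl, zero_le_one⟩, by simp [mixCov], funext fun ω => by simp [mixPSD]⟩
    have := h₁ Δ hΔ hΔ' s hs n m
    rw [hcov, hpsd] at this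
    exact abs_sub_le_of_slope hΔ n (this.trans (le_max_left _ _))

/-- Long-time asymptotics of the log-determinant ratio. -/
theorem exists_log_det_asymptotics {p q : SpinSensor} (h : p.Sph = q.Sph) (Δ₀ : ℝ) :
    ∃ (C : ℝ) (r : ℝ → ℝ), ∀ Δ, 0 < Δ → Δ ≤ Δ₀ → |r Δ| ≤ C * Δ ∧ ∀ n : ℕ,
      |Real.log ((p.cov Δ n).det / (q.cov Δ n).det) - n * Δ * (1 / Real.pi *
        (∫ ω in Set.Ioi (0 : ℝ), Real.log (p.psd ω / q.psd ω)) + r Δ)| ≤ C := by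
  obtain ⟨C₁, h₁⟩ := exists_log_det_bound p q Δ₀
  obtain ⟨-, C₂, h₂⟩ := exists_periodMean_log_bound h Δ₀
  refine ⟨max C₁ C₂, fun Δ => periodMean Δ (fun ω =>
    Real.log (p.sampledPSD Δ ω / q.sampledPSD Δ ω)) / Δ - 1 / Real.pi *
      ∫ ω in Set.Ioi (0 : ℝ), Real.log (p.psd ω / q.psd ω), fun Δ hΔ hΔ' => ⟨?_, fun n => ?_⟩⟩
  · exact (h₂ Δ hΔ hΔ').trans (mul_le_mul_of_nonneg_right (le_max_right _ _) hΔ.le)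
  · exact abs_sub_le_of_slope hΔ n ((h₁ Δ hΔ hΔ' n).trans (le_max_left _ _))

end SpinSensor

/-! ### Gaussian densities -/

section GaussianDensity

open scoped MatrixOrder

lemma ofReal_sqrt_two_pi_pow (n : ℕ) :
    ((Real.sqrt ((2 * Real.pi) ^ n) : ℝ) : ℂ) = (2 * Real.pi : ℂ) ^ ((n : ℂ) / 2) := by
  have h0 : (0 : ℝ) ≤ 2 * Real.pi := by positivity
  rw [Real.sqrt_eq_rpow, ← Real.rpow_natCast, ← Real.rpow_mul h0, Complex.ofReal_cpow h0]
  congr 1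
  · push_cast; rfl
  · push_cast; ring

/-- The density of the standard Gaussian measure, identified through its characteristic
function. -/
lemma stdGaussian_eq_withDensity (n : ℕ) : stdGaussian (EuclideanSpace ℝ (Fin n))
    = volume.withDensity (fun x => ENNReal.ofReal
      (Real.exp (-(1 / 2) * ‖x‖ ^ 2) / Real.sqrt ((2 * Real.pi) ^ n))) := by
  set d : EuclideanSpace ℝ (Fin n) → ℝ := fun x =>
    Real.exp (-(1 / 2) * ‖x‖ ^ 2) / Real.sqrt ((2 * Real.pi) ^ n) with hd
  have hd0 : ∀ x, 0 ≤ d x := fun x => by positivity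
  have hdm : Measurable d := by fun_prop
  have hb : 0 < ((1 / 2 : ℂ)).re := by norm_num
  have hint : Integrable d := by
    have h1 := (GaussianFourier.integrable_cexp_neg_mul_sq_norm_add hb 0
      (0 : EuclideanSpace ℝ (Fin n))).re
    refine (h1.div_const (Real.sqrt ((2 * Real.pi) ^ n))).congr
      (Filter.Eventually.of_forall fun x => ?_)
    have : (-(1 / 2 : ℂ) * (‖x‖ : ℂ) ^ 2 + 0 * ((inner ℝ (0 : EuclideanSpace ℝ (Fin n)) x : ℝ) : ℂ))
        = ((-(1 / 2) * ‖x‖ ^ 2 : ℝ) : ℂ) := by push_cast; ring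
    simp only [hd]
    rw [this, ← Complex.ofReal_exp, RCLike.re_to_complex, Complex.ofReal_re]
  have : IsFiniteMeasure (volume.withDensity fun x => ENNReal.ofReal (d x)) := by
    refine isFiniteMeasure_withDensity ?_
    rw [← ofReal_integral_eq_lintegral_ofReal hint (Filter.Eventually.of_forall hd0)]
    exact ENNReal.ofReal_ne_top
  refine Measure.ext_of_charFun (funext fun t => ?_)
  rw [charFun_stdGaussian, charFun_apply, integral_withDensity_eq_integral_toReal_smul
    (by fun_prop) (Filter.Eventually.of_forall fun _ => ENNReal.ofReal_lt_top)]
  have h2 : ∀ x : EuclideanSpace ℝ (Fin n), (ENNReal.ofReal (d x)).toReal •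
      Complex.exp ((inner ℝ x t : ℝ) * Complex.I)
      = ((Real.sqrt ((2 * Real.pi) ^ n) : ℝ) : ℂ)⁻¹ *
        Complex.exp (-(1 / 2 : ℂ) * (‖x‖ : ℂ) ^ 2 + Complex.I * ((inner ℝ t x : ℝ) : ℂ)) := by
    intro x
    rw [ENNReal.toReal_ofReal (hd0 x), Complex.real_smul, hd, Complex.exp_add,
      real_inner_comm t x]
    push_cast
    rw [mul_comm Complex.I]
    ring
  refine Eq.trans ?_ (integral_congr_ae (Filter.Eventually.of_forall h2)).symm
  rw [integral_const_mul, GaussianFourier.integral_cexp_neg_mul_sq_norm_add hb,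
    ofReal_sqrt_two_pi_pow, finrank_euclideanSpace_fin]
  have h3 : ((Real.pi : ℂ) / (1 / 2)) = 2 * Real.pi := by ring
  have h4 : (2 * Real.pi : ℂ) ^ ((n : ℂ) / 2) ≠ 0 := by
    rw [← ofReal_sqrt_two_pi_pow]
    exact_mod_cast (Real.sqrt_pos.2 (by positivity)).ne'
  rw [h3, inv_mul_cancel_left₀ h4, Complex.I_sq]
  congr 1
  ring

/-- Image under an invertible linear map of a measure with a density. -/
lemma map_toEuclideanCLM_withDensity {n : ℕ} {A : Matrix (Fin n) (Fin n) ℝ} (hA : IsUnit A.det)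
    {g : EuclideanSpace ℝ (Fin n) → ENNReal} (hg : Measurable g) :
    (volume.withDensity g).map (toEuclideanCLM (𝕜 := ℝ) A) = volume.withDensity (fun x =>
      ENNReal.ofReal |A.det⁻¹| * g (toEuclideanCLM (𝕜 := ℝ) A⁻¹ x)) := by
  have hf : Measurable (toEuclideanCLM (𝕜 := ℝ) A) := by fun_prop
  have hfi : Measurable (toEuclideanCLM (𝕜 := ℝ) A⁻¹) := by fun_prop
  have hdet : LinearMap.det (toEuclideanLin A) = A.det := LinearMap.det_toLpLin 2 A
  have hvol : (volume : Measure (EuclideanSpace ℝ (Fin n))).map (toEuclideanCLM (𝕜 := ℝ) A)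
      = ENNReal.ofReal |A.det⁻¹| • volume := by
    have := Measure.map_linearMap_addHaar_eq_smul_addHaar
      (volume : Measure (EuclideanSpace ℝ (Fin n))) (f := toEuclideanLin A)
      (by rw [hdet]; exact hA.ne_zero)
    rw [hdet] at this
    exact this
  have hinv : ∀ x, toEuclideanCLM (𝕜 := ℝ) A⁻¹ (toEuclideanCLM (𝕜 := ℝ) A x) = x := fun x => by
    rw [← mul_apply_eq_comp, ← map_mul, Matrix.nonsing_inv_mul _ hA, map_one, one_apply_eq_self]
  ext s hs
  have h0 := lintegral_const_mul (μ := volume.restrict s) (ENNReal.ofReal |A.det⁻¹|)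
    (hg.comp hfi)
  simp only [Function.comp_apply] at h0
  rw [Measure.map_apply hf hs, withDensity_apply _ (hf hs), withDensity_apply _ hs, h0]
  have h1 := setLIntegral_map (μ := (volume : Measure (EuclideanSpace ℝ (Fin n)))) hs
    (hg.comp hfi) hf
  rw [hvol, Measure.restrict_smul, lintegral_smul_measure, smul_eq_mul] at h1
  refine Eq.trans ?_ h1.symm
  simp only [Function.comp_apply, hinv]

/-- The density of a centred nondegenerate multivariate Gaussian measure. -/
theorem multivariateGaussian_eq_withDensity {n : ℕ} {S : Matrix (Fin n) (Fin n) ℝ}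
    (hS : S.PosDef) : multivariateGaussian 0 S = volume.withDensity (fun x => ENNReal.ofReal
      (Real.exp (-(1 / 2) * (x.ofLp ⬝ᵥ S⁻¹ *ᵥ x.ofLp)) /
        Real.sqrt ((2 * Real.pi) ^ n * S.det))) := by
  set A := CFC.sqrt S with hAdef
  have hAA : A * A = S := CFC.sqrt_mul_sqrt_self S hS.posSemidef.nonneg
  have hAps : A.PosSemidef := (CFC.sqrt_nonneg S).posSemidef
  have hdetS := hS.det_pos
  have hdetA : A.det = Real.sqrt S.det := by
    rw [← hAA, Matrix.det_mul, Real.sqrt_mul_self hAps.det_nonneg]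
  have hdetA0 : 0 < A.det := by rw [hdetA]; exact Real.sqrt_pos.2 hdetS
  have hAu : IsUnit A.det := isUnit_iff_ne_zero.2 hdetA0.ne'
  have hAt : (A⁻¹)ᵀ = A⁻¹ := by
    have : Aᵀ = A := by simpa using hAps.isHermitian.eq
    rw [Matrix.transpose_nonsing_inv, this]
  rw [multivariateGaussian]
  simp only [zero_add]
  rw [stdGaussian_eq_withDensity, map_toEuclideanCLM_withDensity hAu (by fun_prop)]
  congr 1
  funext x
  rw [← ENNReal.ofReal_mul (abs_nonneg _)]
  congr 1
  have h1 : ‖toEuclideanCLM (𝕜 := ℝ) A⁻¹ x‖ ^ 2 = x.ofLp ⬝ᵥ S⁻¹ *ᵥ x.ofLp := by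
    rw [← real_inner_self_eq_norm_sq, EuclideanSpace.inner_eq_star_dotProduct,
      ofLp_toEuclideanCLM, star_trivial, ← Matrix.vecMul_transpose, hAt,
      ← Matrix.dotProduct_mulVec, Matrix.mulVec_vecMul, hAt, ← Matrix.mul_inv_rev, hAA]
  rw [h1, abs_of_pos (inv_pos.2 hdetA0), hdetA, Real.sqrt_mul (by positivity), inv_mul_eq_div,
    div_div]

end GaussianDensity

/-! ### Cumulants of Gaussian quadratic forms -/

section QuadraticForm

open scoped MatrixOrder

lemma one_sub_I_mul_mem_slitPlane (u a : ℝ) : 1 - Complex.I * u * a ∈ Complex.slitPlane :=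
  Or.inl (by simp [Complex.mul_re, Complex.mul_im])

/-- The characteristic function of `a x² / 2` for a standard normal `x`, that is
`(1 - i u a) ^ (-1/2)` with the principal branch. -/
lemma integral_cexp_sq_gaussianReal (u a : ℝ) :
    ∫ x : ℝ, Complex.exp (Complex.I * u * (1 / 2 * (a * x ^ 2) : ℝ)) ∂(gaussianReal 0 1)
      = Complex.exp (-(1 / 2) * Complex.log (1 - Complex.I * u * a)) := by
  set z : ℂ := 1 - Complex.I * u * a with hz
  have hzs : z ∈ Complex.slitPlane := one_sub_I_mul_mem_slitPlane u a
  have hz0 : z ≠ 0 := Complex.slitPlane_ne_zero hzs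
  have hpi : (0 : ℝ) < 2 * Real.pi := by positivity
  have hb : 0 < (z / 2).re := by
    rw [show z / 2 = ((1 / 2 : ℝ) : ℂ) * z by push_cast; ring, Complex.re_ofReal_mul]
    simp [hz, Complex.mul_re, Complex.mul_im]
  have h1 : ∀ x : ℝ, gaussianPDFReal 0 1 x •
      Complex.exp (Complex.I * u * (1 / 2 * (a * x ^ 2) : ℝ))
      = ((Real.sqrt (2 * Real.pi) : ℝ) : ℂ)⁻¹ * Complex.exp (-(z / 2) * (x : ℂ) ^ 2) := by
    intro x
    rw [gaussianPDFReal, Complex.real_smul]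
    push_cast
    rw [mul_one, mul_assoc, ← Complex.exp_add]
    congr 2
    rw [hz]
    ring
  rw [integral_gaussianReal_eq_integral_smul one_ne_zero,
    integral_congr_ae (Filter.Eventually.of_forall h1), integral_const_mul,
    integral_gaussian_complex hb]
  have h2 : (Real.pi : ℂ) / (z / 2) = ((2 * Real.pi : ℝ) : ℂ) * z⁻¹ := by
    push_cast; field_simp
  have h3 : ((Real.sqrt (2 * Real.pi) : ℝ) : ℂ)
      = Complex.exp ((Real.log (2 * Real.pi) : ℝ) * (1 / 2 : ℂ)) := by
    rw [Real.sqrt_eq_rpow, Real.rpow_def_of_pos hpi]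
    push_cast; rfl
  rw [h2, Complex.cpow_def_of_ne_zero (mul_ne_zero (by exact_mod_cast hpi.ne') (inv_ne_zero hz0)),
    Complex.log_ofReal_mul hpi (inv_ne_zero hz0), Complex.log_inv _
      (Complex.slitPlane_arg_ne_pi hzs), h3, ← Complex.exp_neg, ← Complex.exp_add]
  congr 1
  ring

lemma trace_pow_eq_sum_eigenvalues_pow {n : ℕ} {N : Matrix (Fin n) (Fin n) ℝ}
    (hN : N.IsHermitian) (m : ℕ) : (N ^ m).trace = ∑ i, hN.eigenvalues i ^ m := by
  conv_lhs => rw [hN.spectral_theorem, ← map_pow, Unitary.conjStarAlgAut_apply,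
    Matrix.trace_mul_cycle, Unitary.coe_star_mul_self, one_mul, Matrix.diagonal_pow,
    Matrix.trace_diagonal]
  rfl

lemma trace_mul_pow_comm {n : ℕ} (A B : Matrix (Fin n) (Fin n) ℝ) (m : ℕ) :
    ((A * B) ^ m).trace = ((B * A) ^ m).trace := by
  cases m with
  | zero => simp
  | succ k =>
    rw [pow_succ, ← mul_assoc, mul_pow_mul, mul_assoc, Matrix.trace_mul_comm, mul_assoc,
      ← pow_succ]

lemma dotProduct_mulVec_sum_eigenvectorBasis {n : ℕ} {N : Matrix (Fin n) (Fin n) ℝ}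
    (hN : N.IsHermitian) (x : Fin n → ℝ) :
    (∑ i, x i • hN.eigenvectorBasis i).ofLp ⬝ᵥ N *ᵥ (∑ i, x i • hN.eigenvectorBasis i).ofLp
      = ∑ i, hN.eigenvalues i * x i ^ 2 := by
  set b := hN.eigenvectorBasis
  have h1 : toEuclideanCLM (𝕜 := ℝ) N (∑ i, x i • b i)
      = ∑ i, (x i * hN.eigenvalues i) • b i := by
    rw [map_sum]
    refine Finset.sum_congr rfl fun i _ => ?_
    rw [map_smul, mul_smul]
    congr 1
    ext j
    rw [ofLp_toEuclideanCLM, hN.mulVec_eigenvectorBasis]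
    rfl
  have h2 := EuclideanSpace.inner_eq_star_dotProduct (𝕜 := ℝ)
    (toEuclideanCLM (𝕜 := ℝ) N (∑ i, x i • b i)) (∑ i, x i • b i)
  rw [ofLp_toEuclideanCLM, star_trivial] at h2
  rw [← h2, h1, b.orthonormal.inner_sum]
  refine Finset.sum_congr rfl fun i _ => ?_
  simp
  ring

/-- The quadratic form `xᵀ B x / 2` of a centred Gaussian vector with covariance `S = A²` is a sum
of independent terms `aᵢ xᵢ² / 2` with `xᵢ` standard normal and `aᵢ` the eigenvalues of the
symmetric matrix `A B A`, whose powers have the same traces as those of `B S`. -/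
theorem exists_charFun_quadraticForm {n : ℕ} {S B : Matrix (Fin n) (Fin n) ℝ}
    (hS : S.PosSemidef) (hB : B.IsHermitian) :
    ∃ a : Fin n → ℝ, (∀ m : ℕ, ((B * S) ^ m).trace = ∑ i, a i ^ m) ∧
      ∀ u : ℝ, ∫ x, Complex.exp (Complex.I * u * (1 / 2 * (x.ofLp ⬝ᵥ B *ᵥ x.ofLp) : ℝ))
          ∂(multivariateGaussian 0 S)
        = Complex.exp (-(1 / 2) * ∑ i, Complex.log (1 - Complex.I * u * a i)) := by
  set A := CFC.sqrt S with hAdef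
  have hAA : A * A = S := CFC.sqrt_mul_sqrt_self S hS.nonneg
  have hAps : A.PosSemidef := (CFC.sqrt_nonneg S).posSemidef
  have hAt : Aᵀ = A := by simpa using hAps.isHermitian.eq
  have hN : (A * B * A).IsHermitian := by
    have := Matrix.isHermitian_mul_mul_conjTranspose A hB
    rwa [hAps.isHermitian.eq] at this
  refine ⟨hN.eigenvalues, fun m => ?_, fun u => ?_⟩
  · rw [← trace_pow_eq_sum_eigenvalues_pow, ← hAA, ← mul_assoc, trace_mul_pow_comm, mul_assoc]
  · have hform : ∀ x : EuclideanSpace ℝ (Fin n),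
        (toEuclideanCLM (𝕜 := ℝ) A x).ofLp ⬝ᵥ B *ᵥ (toEuclideanCLM (𝕜 := ℝ) A x).ofLp
          = x.ofLp ⬝ᵥ (A * B * A) *ᵥ x.ofLp := by
      intro x
      rw [ofLp_toEuclideanCLM, ← Matrix.vecMul_transpose, hAt, ← Matrix.dotProduct_mulVec,
        ← Matrix.mulVec_transpose, hAt, Matrix.mulVec_mulVec, Matrix.mulVec_mulVec, mul_assoc]
    rw [multivariateGaussian, ← hAdef, integral_map (by fun_prop) (by fun_prop)]
    simp only [zero_add, hform]
    rw [stdGaussian_eq_map_pi_orthonormalBasis hN.eigenvectorBasis,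
      integral_map (Measurable.aemeasurable (by fun_prop)) (by fun_prop)]
    simp only [dotProduct_mulVec_sum_eigenvectorBasis]
    have hprod : ∀ x : Fin n → ℝ,
        Complex.exp (Complex.I * u * (1 / 2 * ∑ i, hN.eigenvalues i * x i ^ 2 : ℝ))
          = ∏ i, Complex.exp (Complex.I * u * (1 / 2 * (hN.eigenvalues i * x i ^ 2) : ℝ)) := by
      intro x
      rw [← Complex.exp_sum, Finset.mul_sum, Complex.ofReal_sum, Finset.mul_sum]
    simp only [hprod]
    rw [integral_fintype_prod_eq_prod (fun i (t : ℝ) =>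
      Complex.exp (Complex.I * u * (1 / 2 * (hN.eigenvalues i * t ^ 2) : ℝ)))]
    simp only [integral_cexp_sq_gaussianReal]
    rw [← Complex.exp_sum, Finset.mul_sum]

/-- The logarithm of the characteristic function of `c + ∑ i, a i * (x i ^ 2) / 2` for independent
standard normal `x i`, on the branch that vanishes at `0`. -/
noncomputable def logCharQuadratic {n : ℕ} (c : ℝ) (a : Fin n → ℝ) (u : ℝ) : ℂ :=
  Complex.I * u * c + -(1 / 2) * ∑ i, Complex.log (1 - Complex.I * u * a i)

lemma contDiff_logCharQuadratic {n : ℕ} (c : ℝ) (a : Fin n → ℝ) :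
    ContDiff ℝ (⊤ : ℕ∞) (logCharQuadratic c a) := by
  have hof : ContDiff ℝ (⊤ : ℕ∞) (fun u : ℝ => (u : ℂ)) := Complex.ofRealCLM.contDiff
  have hlog : ∀ i, ContDiff ℝ (⊤ : ℕ∞) fun u : ℝ => Complex.log (1 - Complex.I * u * a i) := by
    intro i
    refine contDiff_iff_contDiffAt.2 fun u => ?_
    have h1 : ContDiffAt ℝ (⊤ : ℕ∞) Complex.log (1 - Complex.I * u * a i) :=
      (Complex.contDiffAt_log (one_sub_I_mul_mem_slitPlane u (a i))).restrict_scalars ℝ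
    exact h1.comp u (f := fun u : ℝ => 1 - Complex.I * (u : ℂ) * (a i : ℂ)) (by fun_prop)
  unfold logCharQuadratic
  refine ContDiff.add (by fun_prop) (contDiff_const.mul (ContDiff.sum fun i _ => hlog i))

lemma hasDerivAt_one_sub_I_mul (a u : ℝ) :
    HasDerivAt (fun u : ℝ => 1 - Complex.I * u * a) (-(Complex.I * a)) u := by
  have h := ((Complex.ofRealCLM.hasDerivAt (x := u)).const_mul Complex.I).mul_const (a : ℂ)
  simpa using h.const_sub 1

lemma deriv_logCharQuadratic {n : ℕ} (c : ℝ) (a : Fin n → ℝ) :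
    deriv (logCharQuadratic c a) = fun u : ℝ => Complex.I * c +
      (1 / 2) * ∑ i, Complex.I * a i * (1 - Complex.I * u * a i)⁻¹ := by
  funext u
  have h1 : HasDerivAt (fun u : ℝ => Complex.I * u * c) (Complex.I * c) u := by
    simpa using ((Complex.ofRealCLM.hasDerivAt (x := u)).const_mul Complex.I).mul_const (c : ℂ)
  have h2 : ∀ i, HasDerivAt (fun u : ℝ => Complex.log (1 - Complex.I * u * a i))
      (-(Complex.I * a i) / (1 - Complex.I * u * a i)) u := fun i =>
    (hasDerivAt_one_sub_I_mul (a i) u).clog_real (one_sub_I_mul_mem_slitPlane u (a i))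
  have h3 := h1.add ((HasDerivAt.fun_sum fun i (_ : i ∈ Finset.univ) => h2 i).const_mul
    (-(1 / 2) : ℂ))
  refine h3.deriv.trans ?_
  rw [Finset.mul_sum, Finset.mul_sum]
  congr 1
  refine Finset.sum_congr rfl fun i _ => ?_
  rw [div_eq_mul_inv]
  ring

lemma iteratedDeriv_inv_one_sub_I_mul (a : ℝ) (k : ℕ) :
    iteratedDeriv k (fun u : ℝ => (1 - Complex.I * u * a)⁻¹)
      = fun u : ℝ => k.factorial * (Complex.I * a) ^ k * (1 - Complex.I * u * a)⁻¹ ^ (k + 1) := by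
  induction k with
  | zero => simp
  | succ k ih =>
    rw [iteratedDeriv_succ, ih]
    funext u
    have h0 := Complex.slitPlane_ne_zero (one_sub_I_mul_mem_slitPlane u a)
    refine ((((hasDerivAt_one_sub_I_mul a u).fun_inv h0).fun_pow (k + 1)).const_mul
      (k.factorial * (Complex.I * a) ^ k : ℂ)).deriv.trans ?_
    rw [Nat.factorial_succ]
    push_cast
    rw [div_eq_mul_inv, ← inv_pow]
    ring

lemma iteratedDeriv_logCharQuadratic {n : ℕ} (c : ℝ) (a : Fin n → ℝ) (k : ℕ) :
    iteratedDeriv (k + 1) (logCharQuadratic c a) 0 = Complex.I ^ (k + 1) *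
      ((1 / 2 * (k.factorial : ℝ) * ∑ i, a i ^ (k + 1) + (if k = 0 then c else 0) : ℝ) : ℂ) := by
  have hsm : ∀ i, ContDiff ℝ (⊤ : ℕ∞) fun u : ℝ => (1 - Complex.I * u * a i)⁻¹ := fun i =>
    ContDiff.inv (contDiff_const.sub ((contDiff_const.mul Complex.ofRealCLM.contDiff).mul
      contDiff_const)) fun u => Complex.slitPlane_ne_zero (one_sub_I_mul_mem_slitPlane u (a i))
  have hsm' : ∀ i, ContDiffAt ℝ k (fun u : ℝ => (1 - Complex.I * u * a i)⁻¹) 0 := fun i =>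
    ((hsm i).of_le (by exact_mod_cast le_top)).contDiffAt
  rw [iteratedDeriv_succ', deriv_logCharQuadratic, iteratedDeriv_fun_add contDiffAt_const
    (contDiffAt_const.mul (ContDiffAt.sum fun i _ => contDiffAt_const.mul (hsm' i))),
    iteratedDeriv_const_mul_field (1 / 2 : ℂ) (fun u : ℝ =>
      ∑ i, Complex.I * a i * (1 - Complex.I * u * a i)⁻¹),
    iteratedDeriv_fun_sum fun i _ => contDiffAt_const.mul (hsm' i), iteratedDeriv_const]
  simp only [iteratedDeriv_const_mul_field, iteratedDeriv_inv_one_sub_I_mul]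
  rw [Finset.mul_sum]
  push_cast
  rw [mul_add, Finset.mul_sum, Finset.mul_sum, add_comm]
  congr 1
  · refine Finset.sum_congr rfl fun i _ => ?_
    simp
    ring
  · split_ifs with h
    · simp [h]
    · simp

/-- Near `0` the principal logarithm undoes the exponential, by continuity of the exponent. -/
lemma log_exp_logCharQuadratic_eventuallyEq {n : ℕ} (c : ℝ) (a : Fin n → ℝ) :
    (fun u => Complex.log (Complex.exp (logCharQuadratic c a u))) =ᶠ[nhds 0]
      logCharQuadratic c a := by
  have hc : Continuous fun u => (logCharQuadratic c a u).im :=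
    Complex.continuous_im.comp (contDiff_logCharQuadratic c a).continuous
  have h0 : (logCharQuadratic c a 0).im = 0 := by simp [logCharQuadratic]
  have h1 := hc.continuousAt.eventually_mem (Ioo_mem_nhds (a := -Real.pi) (b := Real.pi)
    (x := (logCharQuadratic c a 0).im) (by rw [h0]; simpa using Real.pi_pos)
    (by rw [h0]; exact Real.pi_pos))
  filter_upwards [h1] with u hu
  exact Complex.log_exp hu.1 hu.2.le

end QuadraticForm

/-! ### The log-likelihood ratio -/

section LikelihoodRatio

variable (p : Fin 2 → SpinSensor) {Δ : ℝ} (n : ℕ)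

lemma diffPrecision_isHermitian (hΔ : 0 < Δ) : (diffPrecision p Δ n).IsHermitian :=
  ((p 0).cov_posDef hΔ n).isHermitian.inv.sub ((p 1).cov_posDef hΔ n).isHermitian.inv

lemma logLikelihoodRatio_eq (hΔ : 0 < Δ) (x : EuclideanSpace ℝ (Fin n)) :
    logLikelihoodRatio p Δ n x = 1 / 2 * Real.log (detRatio p Δ n)
      + 1 / 2 * (x.ofLp ⬝ᵥ diffPrecision p Δ n *ᵥ x.ofLp) := by
  have h0 := ((p 0).cov_posDef hΔ n).det_pos
  have h1 := ((p 1).cov_posDef hΔ n).det_pos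
  have hpi : (0 : ℝ) < (2 * Real.pi) ^ n := by positivity
  rw [logLikelihoodRatio, detRatio, diffPrecision, Matrix.sub_mulVec, dotProduct_sub,
    SpinSensor.density, SpinSensor.density, Real.log_div (by positivity) (by positivity),
    Real.log_div (by positivity) (by positivity), Real.log_div (by positivity) (by positivity),
    Real.log_exp, Real.log_exp, Real.log_sqrt (by positivity), Real.log_sqrt (by positivity),
    Real.log_mul hpi.ne' h0.ne', Real.log_mul hpi.ne' h1.ne', Real.log_div h0.ne' h1.ne']
  ring

/-- The characteristic function of the log-likelihood ratio under hypothesis `h`, in terms of the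
eigenvalues of `T_h^{1/2} D T_h^{1/2}`. -/
lemma exists_llrCharFun_eq (hΔ : 0 < Δ) (h : Fin 2) : ∃ a : Fin n → ℝ,
    (∀ m : ℕ, ((diffPrecision p Δ n * (p h).cov Δ n) ^ m).trace = ∑ i, a i ^ m) ∧
    ∀ u : ℝ, llrCharFun p Δ n h u
      = Complex.exp (logCharQuadratic (1 / 2 * Real.log (detRatio p Δ n)) a u) := by
  obtain ⟨a, ha, hu⟩ := exists_charFun_quadraticForm ((p h).cov_posDef hΔ n).posSemidef
    (diffPrecision_isHermitian p n hΔ)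
  refine ⟨a, ha, fun u => ?_⟩
  rw [llrCharFun, logCharQuadratic, Complex.exp_add, ← hu u, ← integral_const_mul]
  refine integral_congr_ae (Filter.Eventually.of_forall fun x => ?_)
  simp only [logLikelihoodRatio_eq p n hΔ x]
  rw [Complex.ofReal_add, mul_add, Complex.exp_add]

/-- The cumulants of the log-likelihood ratio exist and are traces of powers. -/
theorem llrCumulant_eq (hΔ : 0 < Δ) (h : Fin 2) :
    ContDiffAt ℝ (⊤ : ℕ∞) (fun u : ℝ => Complex.log (llrCharFun p Δ n h u)) 0 ∧
    ∀ m : ℕ, 1 ≤ m → llrCumulant p Δ n h m =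
      ((1 / 2 * ((m - 1).factorial : ℝ) * ((diffPrecision p Δ n * (p h).cov Δ n) ^ m).trace
        + (if m = 1 then 1 / 2 * Real.log (detRatio p Δ n) else 0) : ℝ) : ℂ) := by
  obtain ⟨a, ha, hu⟩ := exists_llrCharFun_eq p n hΔ h
  have hev : (fun u : ℝ => Complex.log (llrCharFun p Δ n h u)) =ᶠ[nhds 0]
      logCharQuadratic (1 / 2 * Real.log (detRatio p Δ n)) a := by
    simp only [hu]
    exact log_exp_logCharQuadratic_eventuallyEq _ _
  refine ⟨(contDiff_logCharQuadratic _ a).contDiffAt.congr_of_eventuallyEq hev, fun m hm => ?_⟩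
  obtain ⟨k, rfl⟩ := Nat.exists_eq_add_of_le' hm
  rw [llrCumulant, hev.iteratedDeriv_eq, iteratedDeriv_logCharQuadratic, ha,
    inv_mul_cancel_left₀ (pow_ne_zero _ Complex.I_ne_zero)]
  simp

end LikelihoodRatio

/-! ### Growth of the cumulants -/

section Growth

variable (p : Fin 2 → SpinSensor)

/-- Under either hypothesis the matrix `D T_h` is the relative difference of the covariance
matrices, taken with respect to the covariance under the other hypothesis. -/
lemma diffPrecision_mul_cov {Δ : ℝ} (hΔ : 0 < Δ) (n : ℕ) (h : Fin 2) :
    diffPrecision p Δ n * (p h).cov Δ n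
      = ((p (1 - h)).cov Δ n)⁻¹ * ((p 1).cov Δ n - (p 0).cov Δ n) := by
  have hu : ∀ k, IsUnit ((p k).cov Δ n).det := fun k =>
    isUnit_iff_ne_zero.2 ((p k).cov_posDef hΔ n).det_pos.ne'
  fin_cases h <;>
    simp [diffPrecision, sub_mul, mul_sub, Matrix.nonsing_inv_mul _ (hu _)]

lemma psd_ratio_sub (h : Fin 2) (ω : ℝ) :
    (p h).psd ω / (p 0).psd ω - (p h).psd ω / (p 1).psd ω
      = ((p 1).psd ω - (p 0).psd ω) / (p (1 - h)).psd ω := by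
  have h0 := ((p 0).psd_pos ω).ne'
  have h1 := ((p 1).psd_pos ω).ne'
  fin_cases h
  · simp only [Fin.zero_eta, sub_zero]
    field_simp
  · simp only [Fin.mk_one, sub_self]
    field_simp

/-- For a common level of the shot noise, every cumulant grows linearly in time, at the spectral
rate up to a correction of the order of the sampling period. -/
theorem exists_llrCumulant_asymptotics (hS : (p 0).Sph = (p 1).Sph) (h : Fin 2) {m : ℕ}
    (hm : 1 ≤ m) {Δ₀ : ℝ} (hΔ₀ : 0 < Δ₀) :
    ∃ (C : ℝ) (r : ℝ → ℝ), ∀ Δ : ℝ, 0 < Δ → Δ ≤ Δ₀ → |r Δ| ≤ C * Δ ∧ ∀ n : ℕ,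
      ‖llrCumulant p Δ n h m - (((n : ℝ) * Δ * (cumulantRate p h m + r Δ) : ℝ) : ℂ)‖ ≤ C := by
  have hu : p (1 - h) = p 1 ∨ p (1 - h) = p 0 := by fin_cases h <;> simp
  obtain ⟨C₁, r₁, h₁⟩ := SpinSensor.exists_trace_asymptotics hS.symm hu hΔ₀ hm
  obtain ⟨C₂, r₂, h₂⟩ := SpinSensor.exists_log_det_asymptotics hS Δ₀
  set f : ℝ := 1 / 2 * ((m - 1).factorial : ℝ) with hf
  set e : ℝ := if m = 1 then 1 / 2 else 0 with he
  have hf0 : 0 ≤ f := by positivity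
  have he0 : 0 ≤ e := by rw [he]; split_ifs <;> norm_num
  have key : ∀ x y A B : ℝ, |x| ≤ A → |y| ≤ B → |f * x + e * y| ≤ f * A + e * B := by
    intro x y A B hx hy
    refine (abs_add_le _ _).trans ?_
    rw [abs_mul f, abs_mul e, abs_of_nonneg hf0, abs_of_nonneg he0]
    gcongr
  refine ⟨f * C₁ + e * C₂, fun Δ => f * r₁ Δ + e * r₂ Δ, fun Δ hΔ hΔ' => ?_⟩
  obtain ⟨hr₁, ht⟩ := h₁ Δ hΔ hΔ'
  obtain ⟨hr₂, hd⟩ := h₂ Δ hΔ hΔ'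
  refine ⟨(key _ _ _ _ hr₁ hr₂).trans_eq (by ring), fun n => ?_⟩
  rw [(llrCumulant_eq p n hΔ h).2 m hm, diffPrecision_mul_cov p hΔ, ← Complex.ofReal_sub,
    Complex.norm_real, Real.norm_eq_abs]
  refine (congrArg _ ?_).trans_le (key _ _ _ _ (ht n) (hd n))
  have hrate : cumulantRate p h m
      = f * (1 / Real.pi * ∫ ω in Set.Ioi (0 : ℝ),
          (((p 1).psd ω - (p 0).psd ω) / (p (1 - h)).psd ω) ^ m)
        + e * (1 / Real.pi * ∫ ω in Set.Ioi (0 : ℝ),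
          Real.log ((p 0).psd ω / (p 1).psd ω)) := by
    simp only [cumulantRate, psd_ratio_sub]
    rw [hf, he]
    split_ifs
    · field_simp
    · field_simp
      ring
  have hdet : (if m = 1 then 1 / 2 * Real.log (detRatio p Δ n) else 0)
      = e * Real.log (((p 0).cov Δ n).det / ((p 1).cov Δ n).det) := by
    rw [he, detRatio]
    split_ifs <;> ring
  rw [hrate, hdet]
  ring

end Growth

theorem mainTheorem4 (p : Fin 2 → SpinSensor) :
    -- exact statements for every sampling period and every number of observations
    (∀ (Δ : ℝ), 0 < Δ → ∀ n : ℕ,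
      -- the covariance matrices are nondegenerate and the densities are those of the laws
      (∀ h : Fin 2, ((p h).cov Δ n).PosDef ∧
        (p h).law Δ n = volume.withDensity (fun x => ENNReal.ofReal ((p h).density Δ n x))) ∧
      -- the log-likelihood ratio is a quadratic form plus a constant
      (∀ x : EuclideanSpace ℝ (Fin n),
        logLikelihoodRatio p Δ n x =
          1 / 2 * Real.log (detRatio p Δ n)
            + 1 / 2 * (x.ofLp ⬝ᵥ diffPrecision p Δ n *ᵥ x.ofLp)) ∧
      -- all cumulants exist and are given by traces
      (∀ h : Fin 2,
        ContDiffAt ℝ (⊤ : ℕ∞) (fun u : ℝ => Complex.log (llrCharFun p Δ n h u)) 0 ∧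
        ∀ m : ℕ, 1 ≤ m →
          llrCumulant p Δ n h m =
            ((1 / 2 * ((m - 1).factorial : ℝ)
                * ((diffPrecision p Δ n * (p h).cov Δ n) ^ m).trace
              + (if m = 1 then 1 / 2 * Real.log (detRatio p Δ n) else 0) : ℝ) : ℂ))) ∧
    -- the power spectral density is a sum of two Lorentzians and a constant
    (∀ (h : Fin 2) (ω : ℝ),
      Integrable (fun t : ℝ => (p h).atomCorr t) ∧
      (p h).fourierPSD ω = ((p h).psd ω : ℂ) ∧
      (p h).psd ω =
        (p h).gD ^ 2 * (p h).Q / (2 * (p h).γ ^ 2)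
            * ((p h).γ ^ 2 / ((p h).γ ^ 2 + (ω - (p h).ωL) ^ 2)
              + (p h).γ ^ 2 / ((p h).γ ^ 2 + (ω + (p h).ωL) ^ 2))
          + (p h).Sph) ∧
    -- long-time asymptotics, for a common level of the shot noise
    ((p 0).Sph = (p 1).Sph →
      IntegrableOn (fun ω : ℝ => Real.log ((p 0).psd ω / (p 1).psd ω)) (Set.Ioi 0) ∧
      ∀ (h : Fin 2) (m : ℕ), 1 ≤ m →
        IntegrableOn (fun ω : ℝ =>
          ((p h).psd ω / (p 0).psd ω - (p h).psd ω / (p 1).psd ω) ^ m) (Set.Ioi 0) ∧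
        ∀ Δ₀ : ℝ, 0 < Δ₀ →
          ∃ (C : ℝ) (r : ℝ → ℝ), ∀ Δ : ℝ, 0 < Δ → Δ ≤ Δ₀ →
            |r Δ| ≤ C * Δ ∧
            ∀ n : ℕ,
              ‖llrCumulant p Δ n h m
                - (((n : ℝ) * Δ * (cumulantRate p h m + r Δ) : ℝ) : ℂ)‖ ≤ C) := by
  refine ⟨fun Δ hΔ n => ⟨fun h => ⟨(p h).cov_posDef hΔ n, ?_⟩, logLikelihoodRatio_eq p n hΔ,
    llrCumulant_eq p n hΔ⟩, fun h ω => ⟨(p h).integrable_atomCorr, (p h).fourierPSD_eq_psd ω,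
    (p h).psd_eq_lorentzian ω⟩, fun hS => ⟨?_, fun h m hm => ⟨?_, fun Δ₀ hΔ₀ =>
      exists_llrCumulant_asymptotics p hS h hm hΔ₀⟩⟩⟩
  · exact multivariateGaussian_eq_withDensity ((p h).cov_posDef hΔ n)
  · exact (SpinSensor.exists_periodMean_log_bound hS 1).1
  · simp only [psd_ratio_sub]
    exact (SpinSensor.exists_periodMean_pow_bound hS.symm (p (1 - h)) one_pos hm).1
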